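/- **Notation.** Let $\mathbb T=\mathbb R/2\pi\mathbb Z$. For $k\in\mathbb Z$ put $|k|_\wr=|k|$ if $k\neq 0$ and $|0|_\wr=1$, and $\langle y\rangle=\sqrt{1+y^2}$. For $s,b\in\mathbb R$ let $X^{s,b}$ be the space of distributions $u(t,x)$ on $\mathbb R\times\mathbb T$ (tempered in $t$) whose space-time Fourier transform $\widehat{\widehat u}(\tau,k)$ is, for every $k\in\mathbb Z$, a measurable function of $\tau$ and for which $$\|u\|_{X^{s,b}}^2=\sum_{k\in\mathbb Z}\int_{\mathbb R}|k|_\wr^{2s}\,\langle \tau+k^2\rangle^{2b}\,\bigl|\widehat{\widehat u}(\tau,k)\bigr|^2\,d\tau<\infty .$$ For $T>0$ let $X^{s,b}_T$ be the space of restrictions to $]0,T[\times\mathbb T$ of elements of $X^{s,b}$, with the norm $\|u\|_{X^{s,b}_T}=\inf\{\|\tilde u\|_{X^{s,b}} : \tilde u=u \text{ on } ]0,T[\times\mathbb T\}$. **Theorem (propagation of compactness).** Let $T>0$, let $0\le b\le 1$ and let $\omega\subset\mathbb T$ be a nonempty open set. Let $(u_n)$ and $(f_n)$ be sequences of distributions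 on $]0,T[\times\mathbb T$ such that $$i\partial_t u_n+\partial_x^2u_n=f_n$$ in the sense of distributions, and suppose that for some constant $C$, for all $n$, $$\|u_n\|_{X^{0,b}_T}\le C,\qquad \|u_n\|_{X^{-1+b,-b}_T}\to 0,\qquad \|f_n\|_{X^{-1+b,-b}_T}\to 0\quad(n\to\infty).$$ Suppose moreover that $u_n\to 0$ strongly in $L^2([0,T],L^2(\omega))$. Then $u_n\to 0$ strongly in $L^2_{loc}([0,T],L^2(\mathbb T))$; that is, $\int_K\|u_n(t)\|_{L^2(\mathbb T)}^2\,dt\to 0$ for every compact $K\subset[0,T]$ (equivalently, for $K=[0,T]$). -/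

import Mathlib

open Set Filter Topology MeasureTheory
open scoped ENNReal NNReal ContDiff

namespace SchrodingerTorus

instance instFactTwoPiPos : Fact (0 < 2 * Real.pi) := ⟨Real.two_pi_pos⟩

/-- The circle `𝕋 = ℝ / 2πℤ`, with its Lebesgue measure of total mass `2π`. -/
noncomputable abbrev Torus : Type := AddCircle (2 * Real.pi)

/-- The lift of a function on `ℝ × 𝕋` to a function on `ℝ × ℝ`, `2π`-periodic in `x`. -/
noncomputable def lift (ψ : ℝ × Torus → ℂ) : ℝ × ℝ → ℂ := fun p => ψ (p.1, (p.2 : Torus))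

/-- The space `C_c^∞(]0,T[ × 𝕋)` of complex valued test functions (smoothness of a function on
`ℝ × 𝕋` is smoothness of its periodic lift). -/
noncomputable def testFun (T : ℝ) : Submodule ℂ (ℝ × Torus → ℂ) where
  carrier := {ψ | ContDiff ℝ ∞ (lift ψ) ∧ HasCompactSupport ψ ∧ tsupport ψ ⊆ Ioo 0 T ×ˢ univ}
  zero_mem' := by
    refine ⟨contDiff_const, HasCompactSupport.zero, ?_⟩
    have h : tsupport (0 : ℝ × Torus → ℂ) = ∅ := tsupport_eq_empty_iff.mpr rfl
    rw [h]
    exact empty_subset _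
  add_mem' := by
    rintro φ ψ ⟨h1, h2, h3⟩ ⟨k1, k2, k3⟩
    exact ⟨h1.add k1, h2.add k2, (tsupport_add φ ψ).trans (union_subset h3 k3)⟩
  smul_mem' := by
    rintro c ψ ⟨h1, h2, h3⟩
    have hs : tsupport (c • ψ) ⊆ tsupport ψ := tsupport_smul_subset_right (fun _ => c) ψ
    exact ⟨h1.const_smul c, h2.mono' ((subset_tsupport _).trans hs), hs.trans h3⟩

/-- A distribution on `]0,T[ × 𝕋`: a linear functional on the test functions which, on each compact
time set, is bounded by the suprema of finitely many derivatives of the test function. -/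
structure Distr (T : ℝ) where
  toFun : testFun T →ₗ[ℂ] ℂ
  bounded' : ∀ K : Set ℝ, IsCompact K → K ⊆ Ioo 0 T → ∃ (C : ℝ) (N : ℕ),
    ∀ ψ : testFun T, tsupport (ψ : ℝ × Torus → ℂ) ⊆ K ×ˢ univ →
      ∀ M : ℝ, (∀ j ≤ N, ∀ p : ℝ × ℝ, ‖iteratedFDeriv ℝ j (lift ψ) p‖ ≤ M) →
        ‖toFun ψ‖ ≤ C * M

/-- The time derivative `∂_t ψ`. -/
noncomputable def dt (ψ : ℝ × Torus → ℂ) : ℝ × Torus → ℂ :=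
  fun p => deriv (fun s : ℝ => ψ (s, p.2)) p.1

/-- The space derivative `∂_x ψ`. -/
noncomputable def dx (ψ : ℝ × Torus → ℂ) : ℝ × Torus → ℂ :=
  fun p => deriv (fun y : ℝ => ψ (p.1, p.2 + (y : Torus))) 0

theorem lift_dt {ψ : ℝ × Torus → ℂ} (h : ContDiff ℝ ∞ (lift ψ)) :
    lift (dt ψ) = fun p => fderiv ℝ (lift ψ) p (1, 0) := by
  funext p
  have h1 : HasFDerivAt (lift ψ) (fderiv ℝ (lift ψ) p) (p.1, p.2) :=
    (h.differentiable (by simp) p).hasFDerivAt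
  have h2 : HasDerivAt (fun s : ℝ => (s, p.2)) ((1 : ℝ), (0 : ℝ)) p.1 :=
    (hasDerivAt_id p.1).prodMk (hasDerivAt_const p.1 p.2)
  exact (h1.comp_hasDerivAt p.1 h2).deriv

theorem lift_dx {ψ : ℝ × Torus → ℂ} (h : ContDiff ℝ ∞ (lift ψ)) :
    lift (dx ψ) = fun p => fderiv ℝ (lift ψ) p (0, 1) := by
  funext p
  have h1 : HasFDerivAt (lift ψ) (fderiv ℝ (lift ψ) p) (p.1, p.2 + 0) := by
    rw [add_zero]
    exact (h.differentiable (by simp) p).hasFDerivAt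
  have h2 : HasDerivAt (fun y : ℝ => (p.1, p.2 + y)) ((0 : ℝ), (1 : ℝ)) 0 :=
    (hasDerivAt_const (0 : ℝ) p.1).prodMk ((hasDerivAt_id (0 : ℝ)).const_add p.2)
  have h3 := (h1.comp_hasDerivAt (0 : ℝ) h2).deriv
  rw [← h3]
  rfl

theorem tsupport_dt (ψ : ℝ × Torus → ℂ) : tsupport (dt ψ) ⊆ tsupport ψ := by
  refine closure_minimal (fun p hp => ?_) (isClosed_tsupport ψ)
  by_contra hn
  apply hp
  have h1 : ψ =ᶠ[𝓝 p] 0 := notMem_tsupport_iff_eventuallyEq.mp hn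
  have hc : Tendsto (fun s : ℝ => (s, p.2)) (𝓝 p.1) (𝓝 p) :=
    (Continuous.prodMk_left p.2).tendsto p.1
  have h2 : (fun s : ℝ => ψ (s, p.2)) =ᶠ[𝓝 p.1] fun _ => (0 : ℂ) := hc.eventually h1
  show deriv (fun s : ℝ => ψ (s, p.2)) p.1 = 0
  rw [h2.deriv_eq, deriv_const]

theorem tsupport_dx (ψ : ℝ × Torus → ℂ) : tsupport (dx ψ) ⊆ tsupport ψ := by
  refine closure_minimal (fun p hp => ?_) (isClosed_tsupport ψ)
  by_contra hn
  apply hp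
  have h1 : ψ =ᶠ[𝓝 p] 0 := notMem_tsupport_iff_eventuallyEq.mp hn
  have hcont : Continuous (fun y : ℝ => (p.1, p.2 + (y : Torus))) :=
    continuous_const.prodMk (continuous_const.add (AddCircle.continuous_mk' _))
  have hc : Tendsto (fun y : ℝ => (p.1, p.2 + (y : Torus))) (𝓝 0) (𝓝 p) := by
    have := hcont.tendsto 0
    simpa using this
  have h2 : (fun y : ℝ => ψ (p.1, p.2 + (y : Torus))) =ᶠ[𝓝 0] fun _ => (0 : ℂ) :=
    hc.eventually h1
  show deriv (fun y : ℝ => ψ (p.1, p.2 + (y : Torus))) 0 = 0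
  rw [h2.deriv_eq, deriv_const]

theorem dt_mem {T : ℝ} {ψ : ℝ × Torus → ℂ} (h : ψ ∈ testFun T) : dt ψ ∈ testFun T := by
  obtain ⟨h1, h2, h3⟩ := h
  refine ⟨?_, h2.mono' ((subset_tsupport _).trans (tsupport_dt ψ)), (tsupport_dt ψ).trans h3⟩
  rw [lift_dt h1]
  exact (h1.fderiv_right (m := ∞) (by simp)).clm_apply contDiff_const

theorem dx_mem {T : ℝ} {ψ : ℝ × Torus → ℂ} (h : ψ ∈ testFun T) : dx ψ ∈ testFun T := by
  obtain ⟨h1, h2, h3⟩ := h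
  refine ⟨?_, h2.mono' ((subset_tsupport _).trans (tsupport_dx ψ)), (tsupport_dx ψ).trans h3⟩
  rw [lift_dx h1]
  exact (h1.fderiv_right (m := ∞) (by simp)).clm_apply contDiff_const

/-- The transpose `ψ ↦ -i ∂_t ψ + ∂_x² ψ` of the operator `i ∂_t + ∂_x²`, on test functions. -/
noncomputable def schrodingerTranspose {T : ℝ} (ψ : testFun T) : testFun T :=
  ⟨(-Complex.I) • dt ψ + dx (dx ψ),
    (testFun T).add_mem ((testFun T).smul_mem _ (dt_mem ψ.2)) (dx_mem (dx_mem ψ.2))⟩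

/-- `i ∂_t u + ∂_x² u = f` on `]0,T[ × 𝕋`, in the sense of distributions. -/
def IsSolution {T : ℝ} (u f : Distr T) : Prop :=
  ∀ ψ : testFun T, u.toFun (schrodingerTranspose ψ) = f.toFun ψ

/-- The weight `|k|^{2s} ⟨τ + k²⟩^{2b}`, where `|k|` is replaced by `1` for `k = 0` and
`⟨y⟩ = √(1 + y²)`. -/
noncomputable def xWeight (s b : ℝ) (k : ℤ) (τ : ℝ) : ℝ :=
  (if k = 0 then 1 else |(k : ℝ)|) ^ (2 * s) * Real.sqrt (1 + (τ + (k : ℝ) ^ 2) ^ 2) ^ (2 * b)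

/-- The norm of `X^{s,b}` on `ℝ × 𝕋`, in terms of the space-time Fourier transform `v k τ`. -/
noncomputable def xNormFourier (s b : ℝ) (v : ℤ → ℝ → ℂ) : ℝ≥0∞ :=
  (∑' k : ℤ, ∫⁻ τ : ℝ, ENNReal.ofReal (xWeight s b k τ) * ‖v k τ‖ₑ ^ 2) ^ (1 / 2 : ℝ)

/-- The pairing with `ψ` of the distribution
`(2π)⁻¹ ∑_k ∫ v k τ e^{i (τ t + k x)} dτ` on `ℝ × 𝕋`, whose space-time Fourier transform
`(2π)⁻¹ ∫∫ e^{-i (τ t + k x)} u(t,x) dt dx` is `v`. -/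
noncomputable def fourierPairing (v : ℤ → ℝ → ℂ) (ψ : ℝ × Torus → ℂ) : ℂ :=
  ((2 * Real.pi)⁻¹ : ℝ) * ∑' k : ℤ, ∫ τ : ℝ, v k τ *
    ∫ p : ℝ × Torus, Complex.exp (Complex.I * τ * p.1) * fourier k p.2 * ψ p

/-- The norm of `X^{s,b}_T`: the infimum of the norms in `X^{s,b}` of the extensions of `u` to
`ℝ × 𝕋`. It is `∞` when `u` does not belong to `X^{s,b}_T`. -/
noncomputable def Distr.xNorm {T : ℝ} (s b : ℝ) (u : Distr T) : ℝ≥0∞ :=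
  ⨅ (v : ℤ → ℝ → ℂ) (_ : ∀ k, AEStronglyMeasurable (v k) volume)
    (_ : ∀ ψ : testFun T, u.toFun ψ = fourierPairing v ψ), xNormFourier s b v

/-- The norm of `u` in `L²([0,T], L²(Ω))`, `Ω` an open subset of `𝕋`: the `L²` norm of the (almost
everywhere unique) function which represents `u` on `]0,T[ × Ω`, and `∞` when there is none in
`L²`. -/
noncomputable def Distr.l2Norm {T : ℝ} (u : Distr T) (Ω : Set Torus) : ℝ≥0∞ :=
  ⨅ (g : ℝ × Torus → ℂ)
    (_ : AEStronglyMeasurable g (volume.restrict (Ioo 0 T ×ˢ Ω)))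
    (_ : ∀ ψ : testFun T, tsupport (ψ : ℝ × Torus → ℂ) ⊆ univ ×ˢ Ω →
      u.toFun ψ = ∫ p in Ioo 0 T ×ˢ Ω, g p * (ψ : ℝ × Torus → ℂ) p),
    eLpNorm g 2 (volume.restrict (Ioo 0 T ×ˢ Ω))

end SchrodingerTorus

/-! Each `u n` has an extension bounded in `X^{0,b}`, hence in `L²`, so on `]0,T[ × 𝕋` it is a
function `g n = ∑ G_k(t) e^{ikx}` of bounded `L²` norm. The heart of the matter is that for a time
cutoff `χ` and `j ≠ 0` the coefficient `∫ χ² e^{ijx} |g n|²` tends to `0`: the mass becomes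
equidistributed in `x`. By density of trigonometric polynomials, `∫ χ² h |g n|²` is then asymptotic
to the mean of `h` times `∫ χ² |g n|²`. For a bump `h` supported in `Ω` the former tends to `0` by
observation and the mean is positive, so the whole mass vanishes (`tendsto_integral_sq_of_modes`,
`enorm_observation_le`).

The coefficient is a sum of interactions `∫ χ² G_k conj(G_{k+j})`. On the Fourier side the equation
says that the modulation `τ + k²` times the `k`-th mode of `χu` is small in the weights of
`X^{-1+b,-b}` (`IsSolution.conv_eq`). The modulations of the two modes differ by `j(2k+j)`, so one
of them is at least of order `|k|`; there the smallness gained from the equation controls the plain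
`L²` size (`le_gainWeight_or`), while the other mode is merely bounded.

A fixed cutoff leaves out the ends of `]0,T[`. If `b > 0`, the `X^{0,b}` bound excludes
concentration on short sets of times, uniformly in `n` (`exists_lintegral_invFt_le`). If `b = 0` it
does not, so the cutoffs depend on `n` and may become arbitrarily steep at the ends. The
interactions are then estimated independently of the steepness: in `mode_identity` the derivative of
`χ²` is the dangerous term, and the diagonal case of the same identity controls it, because the
steep factor of the cutoff is monotone (`IsLayerCutoff.integral_layer_le`,
`IsLayerCutoff.tsum_modes_le`). -/

namespace SchrodingerTorus

/-! ### Tensor test functions and single Fourier modes -/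

/-- The function `a(t) p(x)` on `ℝ × 𝕋`. -/
def tens (a : ℝ → ℂ) (p : Torus → ℂ) : ℝ × Torus → ℂ := fun q => a q.1 * p q.2

theorem tsupport_tens (a : ℝ → ℂ) (p : Torus → ℂ) :
    tsupport (tens a p) ⊆ tsupport a ×ˢ tsupport p := by
  refine closure_minimal (fun q hq => ?_) ((isClosed_tsupport a).prod (isClosed_tsupport p))
  have hq' : a q.1 * p q.2 ≠ 0 := hq
  exact ⟨subset_tsupport _ (left_ne_zero_of_mul hq'), subset_tsupport _ (right_ne_zero_of_mul hq')⟩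

theorem mem_testFun_of_tsupport_subset {T : ℝ} {ψ : ℝ × Torus → ℂ} {K : Set ℝ}
    (h : ContDiff ℝ ∞ (lift ψ)) (hK : IsCompact K) (hKT : K ⊆ Ioo 0 T)
    (hs : tsupport ψ ⊆ K ×ˢ univ) : ψ ∈ testFun T :=
  ⟨h, (hK.prod isCompact_univ).of_isClosed_subset (isClosed_tsupport ψ) hs,
    hs.trans (prod_mono hKT le_rfl)⟩

theorem tens_mem {T : ℝ} {a : ℝ → ℂ} {p : Torus → ℂ} (ha : ContDiff ℝ ∞ a)
    (hc : HasCompactSupport a) (hs : tsupport a ⊆ Ioo 0 T)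
    (hp : ContDiff ℝ ∞ fun x : ℝ => p (x : Torus)) : tens a p ∈ testFun T :=
  mem_testFun_of_tsupport_subset ((ha.comp contDiff_fst).mul (hp.comp contDiff_snd)) hc hs
    fun _ hq => ⟨(tsupport_tens a p hq).1, mem_univ _⟩

theorem fourier_coe_eq_exp (k : ℤ) (x : ℝ) :
    (fourier k (x : Torus) : ℂ) = Complex.exp (Complex.I * k * x) := by
  rw [fourier_coe_apply]
  congr 1
  have : (Real.pi : ℂ) ≠ 0 := by exact_mod_cast Real.pi_ne_zero
  push_cast
  field_simp

theorem contDiff_fourier_coe (k : ℤ) :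
    ContDiff ℝ ∞ fun x : ℝ => (fourier k (x : Torus) : ℂ) := by
  simp_rw [fourier_coe_eq_exp]
  exact Complex.contDiff_exp.comp (contDiff_const.mul Complex.ofRealCLM.contDiff)

theorem dx_fourier (a : ℝ → ℂ) (k : ℤ) :
    dx (tens a (fourier k)) = (Complex.I * k) • tens a (fourier k) := by
  funext p
  have h1 : ∀ y : ℝ, tens a (fourier k) (p.1, p.2 + (y : Torus)) =
      (a p.1 * fourier k p.2) * Complex.exp (Complex.I * k * y) := fun y => by
    have : fourier k (p.2 + (y : Torus)) = fourier k p.2 * fourier k (y : Torus) := by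
      simp [fourier_apply, AddCircle.toCircle_add]
    simp only [tens, this, fourier_coe_eq_exp]
    ring
  have h2 : HasDerivAt (fun y : ℝ => Complex.exp (Complex.I * k * y))
      (Complex.exp (Complex.I * k * (0 : ℝ)) * (Complex.I * k * 1)) 0 :=
    (((hasDerivAt_id (0 : ℝ)).ofReal_comp).const_mul (Complex.I * k)).cexp
  simp only [dx, h1]
  rw [(h2.const_mul _).deriv]
  simp [tens]
  ring

theorem dt_tens {a : ℝ → ℂ} (ha : Differentiable ℝ a) (p : Torus → ℂ) :
    dt (tens a p) = tens (deriv a) p := by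
  funext q
  exact ((ha q.1).hasDerivAt.mul_const (p q.2)).deriv

theorem schrodingerTranspose_tens {T : ℝ} {a : ℝ → ℂ} (ha : Differentiable ℝ a) (k : ℤ)
    (h : tens a (fourier (-k)) ∈ testFun T) :
    (schrodingerTranspose ⟨_, h⟩ : ℝ × Torus → ℂ) =
      tens (fun t => -Complex.I * deriv a t - (k : ℂ) ^ 2 * a t) (fourier (-k)) := by
  have h2 : dx ((Complex.I * (-k : ℤ)) • tens a (fourier (-k))) =
      (Complex.I * (-k : ℤ)) • (Complex.I * (-k : ℤ)) • tens a (fourier (-k)) := by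
    have : (Complex.I * (-k : ℤ)) • tens a (fourier (-k)) =
        tens (fun t => (Complex.I * (-k : ℤ)) * a t) (fourier (-k)) := by
      funext q; simp only [tens, Pi.smul_apply, smul_eq_mul]; ring
    conv_lhs => rw [this, dx_fourier, ← this]
  simp only [schrodingerTranspose, dt_tens ha, dx_fourier, h2]
  funext q
  simp only [tens, Pi.add_apply, Pi.smul_apply, smul_eq_mul]
  push_cast
  linear_combination (k : ℂ) ^ 2 * a q.1 * fourier (-k) q.2 * Complex.I_sq

theorem integral_fourier (k : ℤ) :
    ∫ x : Torus, (fourier k x : ℂ) = if k = 0 then (2 * Real.pi : ℂ) else 0 := by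
  have h := congrFun (fourierCoeff_fourier (T := 2 * Real.pi) k) 0
  have hpi : (2 * Real.pi : ℂ) ≠ 0 := by simp [Real.pi_ne_zero]
  simp only [fourierCoeff, neg_zero, fourier_zero, one_smul, AddCircle.integral_haarAddCircle] at h
  rw [inv_smul_eq_iff₀ (by positivity)] at h
  rw [h]
  by_cases hk : k = 0
  · simp [hk]
  · simp [hk, Ne.symm hk]

theorem fourier_mul_fourier (k l : ℤ) (x : Torus) :
    (fourier k x : ℂ) * fourier l x = fourier (k + l) x := fourier_add.symm

/-- Orthogonality in `x` leaves only the mode `k`, and the total mass `2π` of the circle cancels the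
normalization, so no convergence of the series is in question. -/
theorem fourierPairing_tens (v : ℤ → ℝ → ℂ) (a : ℝ → ℂ) (k : ℤ) :
    fourierPairing v (tens a (fourier (-k))) =
      ∫ τ : ℝ, v k τ * ∫ t : ℝ, Complex.exp (Complex.I * τ * t) * a t := by
  have h : ∀ (l : ℤ) (τ : ℝ), ∫ p : ℝ × Torus, Complex.exp (Complex.I * τ * p.1) * fourier l p.2 *
      tens a (fourier (-k)) p =
      (∫ t : ℝ, Complex.exp (Complex.I * τ * t) * a t) * if l = k then (2 * Real.pi : ℂ) else 0 := by
    intro l τ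
    have h1 : ∀ p : ℝ × Torus, Complex.exp (Complex.I * τ * p.1) * fourier l p.2 *
        tens a (fourier (-k)) p =
        (Complex.exp (Complex.I * τ * p.1) * a p.1) * fourier (l + -k) p.2 := fun p => by
      rw [← fourier_mul_fourier, tens]; ring
    simp_rw [h1]
    rw [Measure.volume_eq_prod, integral_prod_mul (fun t : ℝ => Complex.exp (Complex.I * τ * t) * a t)
      (fun x : Torus => (fourier (l + -k) x : ℂ)), integral_fourier]
    simp [← sub_eq_add_neg, sub_eq_zero]
  rw [fourierPairing, tsum_eq_single k]
  · simp_rw [h, if_true]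
    have e : ∀ τ : ℝ, v k τ * ((∫ t : ℝ, Complex.exp (Complex.I * τ * t) * a t) * (2 * Real.pi)) =
        (v k τ * ∫ t : ℝ, Complex.exp (Complex.I * τ * t) * a t) * (2 * Real.pi) :=
      fun τ => (mul_assoc _ _ _).symm
    have hpi : (Real.pi : ℂ) ≠ 0 := by exact_mod_cast Real.pi_ne_zero
    simp_rw [e]
    rw [integral_mul_const]
    push_cast
    field_simp
  · intro l hl
    simp_rw [h, if_neg hl]
    simp

/-! ### Plancherel's theorem in the normalization `e^{-iτt}` -/

section Plancherel

open FourierTransform ComplexConjugate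

theorem integral_smul_fourier_eq {g h : ℝ → ℂ} (hg : Integrable g) (hh : Integrable h) :
    ∫ x, g x • 𝓕 h x = ∫ x, 𝓕 g x • h x := by
  have := VectorFourier.integral_fourierIntegral_smul_eq_flip (μ := volume) (ν := volume)
    (L := innerₗ ℝ) (e := Real.fourierChar) Real.continuous_fourierChar continuous_inner hg hh
  rw [flip_innerₗ] at this
  exact this.symm

/-- The `L²` transform is only known abstractly. Tested against compactly supported smooth functions
through tempered distributions, it obeys the same multiplication formula as the integral, and this
determines it almost everywhere. -/
theorem fourier_toLp_ae_eq {h : ℝ → ℂ} (h1 : Integrable h) (h2 : MemLp h 2) :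
    (𝓕 (h2.toLp h) : Lp ℂ 2 (volume : Measure ℝ)) =ᵐ[volume] 𝓕 h := by
  have hc : Continuous (𝓕 h) := VectorFourier.fourierIntegral_continuous
    Real.continuous_fourierChar continuous_inner h1
  refine ae_eq_of_integral_contDiff_smul_eq
    ((Lp.memLp _).locallyIntegrable (by norm_num)) hc.locallyIntegrable fun g gs gc => ?_
  have hg1 : HasCompactSupport (Complex.ofRealCLM ∘ g) := gc.comp_left rfl
  have hg2 : ContDiff ℝ ∞ (Complex.ofRealCLM ∘ g) := by fun_prop
  set G := hg1.toSchwartzMap hg2 with hG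
  have e1 := congrArg (fun S => S G) (Lp.fourier_toTemperedDistribution_eq (h2.toLp h))
  simp only [TemperedDistribution.fourier_apply, Lp.toTemperedDistribution_apply] at e1
  have e2 : ∫ x, (𝓕 G) x • (h2.toLp h) x = ∫ x, (𝓕 (G : ℝ → ℂ)) x • h x :=
    integral_congr_ae (h2.coeFn_toLp.mono fun x hx => by simp only [hx, SchwartzMap.fourier_coe])
  rw [e2, ← integral_smul_fourier_eq G.integrable h1] at e1
  simpa [hG] using e1.symm

theorem fourierInv_toLp_ae_eq {h : ℝ → ℂ} (h1 : Integrable h) (h2 : MemLp h 2) :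
    (𝓕⁻ (h2.toLp h) : Lp ℂ 2 (volume : Measure ℝ)) =ᵐ[volume] 𝓕⁻ h := by
  have hc : Continuous (𝓕 h) := VectorFourier.fourierIntegral_continuous
    Real.continuous_fourierChar continuous_inner h1
  have hneg : 𝓕⁻ h = fun x => 𝓕 h (-x) := funext fun x => Real.fourierInv_eq_fourier_neg h x
  have hc' : Continuous (𝓕⁻ h) := hneg ▸ hc.comp continuous_neg
  refine ae_eq_of_integral_contDiff_smul_eq
    ((Lp.memLp _).locallyIntegrable (by norm_num)) hc'.locallyIntegrable fun g gs gc => ?_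
  have hg1 : HasCompactSupport (Complex.ofRealCLM ∘ g) := gc.comp_left rfl
  have hg2 : ContDiff ℝ ∞ (Complex.ofRealCLM ∘ g) := by fun_prop
  set G := hg1.toSchwartzMap hg2 with hG
  have e1 := congrArg (fun S => S G) (Lp.fourierInv_toTemperedDistribution_eq (h2.toLp h))
  simp only [TemperedDistribution.fourierInv_apply, Lp.toTemperedDistribution_apply] at e1
  have e2 : ∫ x, (𝓕⁻ G) x • (h2.toLp h) x = ∫ x, (𝓕 (fun x => G (-x))) x • h x :=
    integral_congr_ae (h2.coeFn_toLp.mono fun x hx => by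
      simp only [hx, SchwartzMap.fourierInv_coe, Real.fourierInv_eq_fourier_comp_neg])
  rw [e2, ← integral_smul_fourier_eq G.integrable.comp_neg h1,
    ← integral_neg_eq_self] at e1
  simpa [hG, hneg] using e1.symm

/-- The Fourier transform `∫ e^{-iτt} h(t) dt`. -/
noncomputable def ft (h : ℝ → ℂ) (τ : ℝ) : ℂ := ∫ t : ℝ, Complex.exp (-(Complex.I * τ * t)) * h t

theorem ft_eq_fourier (h : ℝ → ℂ) (τ : ℝ) : ft h τ = 𝓕 h ((2 * Real.pi)⁻¹ * τ) := by
  rw [Real.fourier_real_eq_integral_exp_smul, ft]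
  congr 1 with t
  rw [smul_eq_mul]
  congr 2
  have : (Real.pi : ℂ) ≠ 0 := by exact_mod_cast Real.pi_ne_zero
  push_cast
  field_simp

theorem conj_ft_conj (h : ℝ → ℂ) (τ : ℝ) :
    conj (ft (fun t => conj (h t)) τ) = ∫ t : ℝ, Complex.exp (Complex.I * τ * t) * h t := by
  rw [ft, ← integral_conj]
  congr 1 with t
  rw [map_mul, ← Complex.exp_conj]
  simp

theorem continuous_ft {h : ℝ → ℂ} (h1 : Integrable h) : Continuous (ft h) := by
  have hc : Continuous (𝓕 h) := VectorFourier.fourierIntegral_continuous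
    Real.continuous_fourierChar continuous_inner h1
  simp_rw [funext (ft_eq_fourier h)]
  fun_prop

theorem memLp_comp_mul_left {f : ℝ → ℂ} (hf : MemLp f 2) {c : ℝ} (hc : c ≠ 0) :
    MemLp (fun x => f (c * x)) 2 := by
  have hm : AEStronglyMeasurable (fun x => f (c * x)) volume := by
    refine hf.1.comp_quasiMeasurePreserving ⟨by fun_prop, ?_⟩
    rw [Real.map_volume_mul_left hc]
    exact Measure.smul_absolutelyContinuous
  rw [memLp_two_iff_integrable_sq_norm hm]
  exact ((memLp_two_iff_integrable_sq_norm hf.1).1 hf).comp_mul_left' hc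

theorem memLp_ft {h : ℝ → ℂ} (h1 : Integrable h) (h2 : MemLp h 2) : MemLp (ft h) 2 := by
  rw [funext (ft_eq_fourier h)]
  exact memLp_comp_mul_left ((memLp_congr_ae (fourier_toLp_ae_eq h1 h2)).1 (Lp.memLp _))
    (by positivity)

theorem integral_ft_mul_conj_ft {h k : ℝ → ℂ} (h1 : Integrable h) (h2 : MemLp h 2)
    (k1 : Integrable k) (k2 : MemLp k 2) :
    ∫ τ, ft h τ * conj (ft k τ) = 2 * Real.pi * ∫ t, h t * conj (k t) := by
  have e := Lp.inner_fourier_eq (k2.toLp k) (h2.toLp h)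
  rw [L2.inner_def, L2.inner_def] at e
  have e1 : ∫ x, 𝓕 h x * conj (𝓕 k x) = ∫ x, h x * conj (k x) := by
    refine Eq.trans (integral_congr_ae ?_) (e.trans (integral_congr_ae ?_))
    · filter_upwards [fourier_toLp_ae_eq h1 h2, fourier_toLp_ae_eq k1 k2] with x hx hy
      rw [hx, hy]; rfl
    · filter_upwards [h2.coeFn_toLp, k2.coeFn_toLp] with x hx hy
      rw [hx, hy]; rfl
  simp_rw [ft_eq_fourier]
  rw [Measure.integral_comp_mul_left (fun x => 𝓕 h x * conj (𝓕 k x)), e1]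
  simp [abs_of_pos Real.pi_pos]

/-- Inverse Fourier transform on `L²(ℝ)`, in duality form. -/
noncomputable def invFt (v : ℝ → ℂ) (hv : MemLp v 2) : Lp ℂ 2 (volume : Measure ℝ) :=
  𝓕⁻ ((memLp_comp_mul_left hv (c := 2 * Real.pi) (by positivity)).toLp _)

/-- Rescaling by `2π` turns the transform with kernel `e^{2πixξ}` into `invFt v = (2π)⁻¹ ∫ e^{iτt}
v(τ) dτ`. As `v` is only in `L²`, the exchange of integrals is Plancherel's identity rather than
Fubini's theorem. -/
theorem integral_mul_exp_eq {v : ℝ → ℂ} (hv : MemLp v 2) {φ : ℝ → ℂ} (h1 : Integrable φ)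
    (h2 : MemLp φ 2) :
    ∫ τ : ℝ, v τ * (∫ t : ℝ, Complex.exp (Complex.I * τ * t) * φ t) =
      2 * Real.pi * ∫ t, invFt v hv t * φ t := by
  set a := (memLp_comp_mul_left hv (c := 2 * Real.pi) (by positivity)).toLp _ with ha
  have k1 : Integrable fun t => conj (φ t) := by
    simpa using (RCLike.conjCLE (K := ℂ)).toContinuousLinearMap.integrable_comp h1
  have k2 : MemLp (fun t => conj (φ t)) 2 := h2.star
  have e := Lp.inner_fourier_eq (k2.toLp _) (invFt v hv)
  have e0 : 𝓕 (invFt v hv) = a := fourier_fourierInv_eq _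
  rw [e0, L2.inner_def, L2.inner_def] at e
  have e1 : ∫ x, v (2 * Real.pi * x) * conj (𝓕 (fun t => conj (φ t)) x) =
      ∫ t, invFt v hv t * φ t := by
    refine Eq.trans (integral_congr_ae ?_) (e.trans (integral_congr_ae ?_))
    · filter_upwards [fourier_toLp_ae_eq k1 k2, (memLp_comp_mul_left hv (c := 2 * Real.pi)
        (by positivity)).coeFn_toLp] with x hx hy
      rw [hx, hy]; rfl
    · filter_upwards [k2.coeFn_toLp] with x hx
      rw [hx]; simp
  simp_rw [← conj_ft_conj, ft_eq_fourier]
  rw [← e1]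
  have := Measure.integral_comp_mul_left
    (fun x => v x * conj (𝓕 (fun t => conj (φ t)) ((2 * Real.pi)⁻¹ * x))) (2 * Real.pi)
  have hp : 2 * Real.pi ≠ 0 := by positivity
  simp only [inv_mul_cancel_left₀ hp] at this
  rw [this]
  have hpi : (Real.pi : ℂ) ≠ 0 := by exact_mod_cast Real.pi_ne_zero
  simp [abs_of_pos Real.pi_pos]
  field_simp

theorem eLpNorm_two_sq {α : Type*} [MeasurableSpace α] (f : α → ℂ) (μ : Measure α) :
    eLpNorm f 2 μ ^ 2 = ∫⁻ x, ‖f x‖ₑ ^ 2 ∂μ := by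
  have := eLpNorm_nnreal_pow_eq_lintegral (f := f) (μ := μ) (p := 2) (by norm_num)
  simpa using this

theorem lintegral_enorm_sq_lt_top {α : Type*} [MeasurableSpace α] {f : α → ℂ} {μ : Measure α}
    (hf : MemLp f 2 μ) : ∫⁻ x, ‖f x‖ₑ ^ 2 ∂μ < ⊤ := by
  rw [← eLpNorm_two_sq]
  exact ENNReal.pow_lt_top hf.2

theorem memLp_two_of_lintegral_lt_top {α : Type*} [MeasurableSpace α] {f : α → ℂ}
    {μ : Measure α} (hm : AEStronglyMeasurable f μ) (hf : ∫⁻ x, ‖f x‖ₑ ^ 2 ∂μ < ⊤) :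
    MemLp f 2 μ := by
  rw [← eLpNorm_two_sq] at hf
  exact ⟨hm, by simpa using hf⟩

theorem lintegral_enorm_sq_eq_ofReal {α : Type*} [MeasurableSpace α] {f : α → ℂ} {μ : Measure α}
    (hf : MemLp f 2 μ) : ∫⁻ x, ‖f x‖ₑ ^ 2 ∂μ = ENNReal.ofReal (∫ x, ‖f x‖ ^ 2 ∂μ) := by
  rw [ofReal_integral_eq_lintegral_ofReal ((memLp_two_iff_integrable_sq_norm hf.1).1 hf)
    (ae_of_all _ fun x => by positivity)]
  refine lintegral_congr fun x => ?_
  rw [ENNReal.ofReal_pow (norm_nonneg _), ofReal_norm]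

theorem lintegral_comp_mul_left' (f : ℝ → ℝ≥0∞) {c : ℝ} (hc : 0 < c) :
    ENNReal.ofReal c * ∫⁻ x, f (c * x) = ∫⁻ x, f x := by
  have h := Real.smul_map_volume_mul_left hc.ne'
  have e := (Homeomorph.mulLeft₀ c hc.ne').measurableEmbedding.lintegral_map (μ := volume) f
  conv_rhs => rw [← h]
  rw [lintegral_smul_measure, abs_of_pos hc, smul_eq_mul]
  exact congrArg _ e.symm

theorem lintegral_enorm_invFt_sq {v : ℝ → ℂ} (hv : MemLp v 2) :
    ENNReal.ofReal (2 * Real.pi) * ∫⁻ t, ‖invFt v hv t‖ₑ ^ 2 = ∫⁻ τ, ‖v τ‖ₑ ^ 2 := by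
  have hp : (0 : ℝ) < 2 * Real.pi := by positivity
  rw [← lintegral_comp_mul_left' (fun τ => ‖v τ‖ₑ ^ 2) hp]
  congr 1
  rw [← eLpNorm_two_sq, ← eLpNorm_two_sq (fun τ => v (2 * Real.pi * τ)),
    ← eLpNorm_congr_ae (memLp_comp_mul_left hv hp.ne').coeFn_toLp, ← Lp.enorm_def, ← Lp.enorm_def]
  congr 1
  rw [← ofReal_norm, ← ofReal_norm]
  congr 1
  exact (Lp.fourierTransformₗᵢ ℝ ℂ).symm.norm_map _

theorem invFt_add {v w : ℝ → ℂ} (hv : MemLp v 2) (hw : MemLp w 2) :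
    invFt (fun τ => v τ + w τ) (hv.add hw) = invFt v hv + invFt w hw := by
  rw [invFt, invFt, invFt, ← FourierTransform.fourierInv_add]
  rfl

theorem enorm_invFt_le {v : ℝ → ℂ} (h1 : Integrable v) (hv : MemLp v 2) :
    ∀ᵐ t, ENNReal.ofReal (2 * Real.pi) * ‖invFt v hv t‖ₑ ≤ ∫⁻ τ, ‖v τ‖ₑ := by
  have hp : (0 : ℝ) < 2 * Real.pi := by positivity
  filter_upwards [fourierInv_toLp_ae_eq (h1.comp_mul_left' hp.ne')
    (memLp_comp_mul_left hv hp.ne')] with t ht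
  rw [invFt, ht, ← lintegral_comp_mul_left' _ hp]
  gcongr
  rw [Real.fourierInv_eq]
  refine (enorm_integral_le_lintegral_enorm _).trans_eq (lintegral_congr fun x => ?_)
  rw [← ofReal_norm, Circle.norm_smul, ofReal_norm]

end Plancherel

/-! ### Superposition of modes in `L²(ℝ × 𝕋)` -/

section Synthesis

open ComplexConjugate

theorem summable_of_pairwise_inner_eq_zero {ι E : Type*} [NormedAddCommGroup E]
    [InnerProductSpace ℂ E] [CompleteSpace E] {x : ι → E}
    (h : Pairwise fun i j => inner ℂ (x i) (x j) = 0) (hs : Summable fun i => ‖x i‖ ^ 2) :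
    Summable x := by
  have hV : OrthogonalFamily ℂ (fun i => Submodule.span ℂ {x i})
      fun i => (Submodule.span ℂ {x i}).subtypeₗᵢ := by
    rintro i j hij ⟨v, hv⟩ ⟨w, hw⟩
    obtain ⟨a, rfl⟩ := Submodule.mem_span_singleton.1 hv
    obtain ⟨c, rfl⟩ := Submodule.mem_span_singleton.1 hw
    simp [inner_smul_left, inner_smul_right, h hij]
  exact (hV.summable_iff_norm_sq_summable
    fun i => ⟨x i, Submodule.mem_span_singleton_self (x i)⟩).2 hs

theorem memLp_bdd_mul {α : Type*} [MeasurableSpace α] {μ : Measure α} {m : α → ℂ}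
    (hm : AEStronglyMeasurable m μ) {C : ℝ} (hC : ∀ x, ‖m x‖ ≤ C) {f : α → ℂ}
    (hf : MemLp f 2 μ) : MemLp (fun x => m x * f x) 2 μ :=
  hf.of_le_mul (c := C) (hm.mul hf.1)
    (ae_of_all _ fun x => by rw [norm_mul]; gcongr; exact hC x)

/-- Multiplication by a bounded measurable function on `L²`. -/
noncomputable def mulL2 {α : Type*} [MeasurableSpace α] {μ : Measure α} (m : α → ℂ)
    (hm : AEStronglyMeasurable m μ) (C : ℝ) (hC : ∀ x, ‖m x‖ ≤ C) : Lp ℂ 2 μ →L[ℂ] Lp ℂ 2 μ :=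
  have key : ∀ f : Lp ℂ 2 μ, MemLp (fun x => m x * f x) 2 μ := fun f =>
    memLp_bdd_mul hm hC (Lp.memLp f)
  LinearMap.mkContinuous
    { toFun := fun f => (key f).toLp _
      map_add' := fun f g => by
        rw [← MemLp.toLp_add]
        refine MemLp.toLp_congr _ _ ((Lp.coeFn_add f g).mono fun x hx => ?_)
        simp only [hx, Pi.add_apply, mul_add]
      map_smul' := fun c f => by
        rw [RingHom.id_apply, ← MemLp.toLp_const_smul]
        refine MemLp.toLp_congr _ _ ((Lp.coeFn_smul c f).mono fun x hx => ?_)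
        simp only [hx, Pi.smul_apply, smul_eq_mul]
        ring } C fun f => by
    refine Lp.norm_le_mul_norm_of_ae_le_mul ((key f).coeFn_toLp.mono fun x hx => ?_)
    rw [LinearMap.coe_mk, AddHom.coe_mk, hx, norm_mul]
    gcongr
    exact hC x

theorem coeFn_mulL2 {α : Type*} [MeasurableSpace α] {μ : Measure α} {m : α → ℂ}
    (hm : AEStronglyMeasurable m μ) {C : ℝ} (hC : ∀ x, ‖m x‖ ≤ C) (f : Lp ℂ 2 μ) :
    mulL2 m hm C hC f =ᵐ[μ] fun x => m x * f x :=
  (memLp_bdd_mul hm hC (Lp.memLp f)).coeFn_toLp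

theorem norm_fourier_apply (k : ℤ) (x : Torus) : ‖(fourier k x : ℂ)‖ = 1 := by
  rw [fourier_apply]; exact Circle.norm_coe _

theorem memLp_tens {a : ℝ → ℂ} (ha : MemLp a 2) (k : ℤ) : MemLp (tens a (fourier k)) 2 := by
  refine (ha.comp_fst (volume : Measure Torus)).of_le_mul (c := 1)
    (ha.1.comp_fst.mul (fourier k).continuous.aestronglyMeasurable.comp_snd)
    (ae_of_all _ fun q => ?_)
  simp [tens, norm_fourier_apply, -fourier_apply]

theorem volume_torus : (volume : Measure Torus) univ = ENNReal.ofReal (2 * Real.pi) :=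
  AddCircle.measure_univ _

theorem lintegral_prod_fst {f : ℝ → ℝ≥0∞} (hf : AEMeasurable f) :
    ∫⁻ q : ℝ × Torus, f q.1 = ENNReal.ofReal (2 * Real.pi) * ∫⁻ t, f t := by
  have := lintegral_prod_mul (μ := (volume : Measure ℝ)) (ν := (volume : Measure Torus)) hf
    (g := fun _ => 1) aemeasurable_const
  simp only [mul_one, lintegral_const, one_mul, volume_torus] at this
  rw [Measure.volume_eq_prod, this, mul_comm]

theorem lintegral_enorm_tens_sq {a : ℝ → ℂ} (ha : AEStronglyMeasurable a) (k : ℤ) :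
    ∫⁻ q, ‖tens a (fourier k) q‖ₑ ^ 2 = ENNReal.ofReal (2 * Real.pi) * ∫⁻ t, ‖a t‖ₑ ^ 2 := by
  rw [← lintegral_prod_fst (ha.enorm.pow_const 2)]
  refine lintegral_congr fun q => ?_
  rw [tens, enorm_mul, ← ofReal_norm (fourier k q.2 : ℂ), norm_fourier_apply]
  simp

theorem tens_ae_congr {a b : ℝ → ℂ} (h : a =ᵐ[volume] b) (p : Torus → ℂ) :
    tens a p =ᵐ[volume] tens b p := by
  have : ∀ᵐ q : ℝ × Torus, a q.1 = b q.1 := Measure.quasiMeasurePreserving_fst.ae h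
  filter_upwards [this] with q hq
  simp only [tens, hq]

/-- The map `a ↦ a(t) e^{ikx}` from `L²(ℝ)` to `L²(ℝ × 𝕋)`. -/
noncomputable def embed (k : ℤ) :
    Lp ℂ 2 (volume : Measure ℝ) →L[ℂ] Lp ℂ 2 (volume : Measure (ℝ × Torus)) :=
  LinearMap.mkContinuous
    { toFun := fun f => (memLp_tens (Lp.memLp f) k).toLp _
      map_add' := fun f g => by
        rw [← MemLp.toLp_add]
        refine MemLp.toLp_congr _ _ ((tens_ae_congr (Lp.coeFn_add f g) _).trans
          (ae_of_all _ fun q => ?_))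
        simp only [tens, Pi.add_apply, add_mul]
      map_smul' := fun c f => by
        rw [RingHom.id_apply, ← MemLp.toLp_const_smul]
        refine MemLp.toLp_congr _ _ ((tens_ae_congr (Lp.coeFn_smul c f) _).trans
          (ae_of_all _ fun q => ?_))
        simp only [tens, Pi.smul_apply, smul_eq_mul, mul_assoc] } (Real.sqrt (2 * Real.pi))
    fun f => by
      have h := lintegral_enorm_tens_sq (Lp.memLp f).1 k
      have e : ENNReal.ofReal (‖(memLp_tens (Lp.memLp f) k).toLp _‖ ^ 2) =
          ENNReal.ofReal ((Real.sqrt (2 * Real.pi) * ‖f‖) ^ 2) := by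
        rw [mul_pow, Real.sq_sqrt (by positivity), ENNReal.ofReal_mul (by positivity),
          ENNReal.ofReal_pow (norm_nonneg _), ENNReal.ofReal_pow (norm_nonneg _), ofReal_norm,
          ofReal_norm, Lp.enorm_def, Lp.enorm_def, eLpNorm_congr_ae (MemLp.coeFn_toLp _),
          eLpNorm_two_sq, eLpNorm_two_sq, h]
      rw [ENNReal.ofReal_eq_ofReal_iff (by positivity) (by positivity)] at e
      exact ((sq_eq_sq₀ (by positivity) (by positivity)).1 e).le

theorem coeFn_embed (k : ℤ) (f : Lp ℂ 2 (volume : Measure ℝ)) :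
    embed k f =ᵐ[volume] tens f (fourier k) :=
  (memLp_tens (Lp.memLp f) k).coeFn_toLp

theorem enorm_embed_sq (k : ℤ) (f : Lp ℂ 2 (volume : Measure ℝ)) :
    ‖embed k f‖ₑ ^ 2 = ENNReal.ofReal (2 * Real.pi) * ∫⁻ t, ‖f t‖ₑ ^ 2 := by
  rw [Lp.enorm_def, eLpNorm_congr_ae (coeFn_embed k f), eLpNorm_two_sq,
    lintegral_enorm_tens_sq (Lp.memLp f).1]

theorem conj_fourier_mul_fourier (k l : ℤ) (x : Torus) :
    conj (fourier k x : ℂ) * fourier l x = fourier (l - k) x := by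
  rw [← fourier_neg, fourier_mul_fourier, neg_add_eq_sub]

theorem integral_conj_tens_mul_tens (a b : ℝ → ℂ) (k l : ℤ) :
    ∫ q, conj (tens a (fourier k) q) * tens b (fourier l) q =
      if k = l then 2 * Real.pi * ∫ t, conj (a t) * b t else 0 := by
  have h : ∀ q : ℝ × Torus, conj (tens a (fourier k) q) * tens b (fourier l) q =
      (conj (a q.1) * b q.1) * fourier (l - k) q.2 := fun q => by
    rw [← conj_fourier_mul_fourier, tens, tens, map_mul]; ring
  simp_rw [h]
  rw [Measure.volume_eq_prod, integral_prod_mul (fun t => conj (a t) * b t)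
    (fun x : Torus => (fourier (l - k) x : ℂ)), integral_fourier]
  by_cases hk : k = l
  · simp [hk, mul_comm]
  · simp [hk, sub_eq_zero, Ne.symm hk]

theorem summable_embed {G : ℤ → Lp ℂ 2 (volume : Measure ℝ)}
    (hG : ∑' k, ∫⁻ t, ‖G k t‖ₑ ^ 2 < ⊤) : Summable fun k => embed k (G k) := by
  refine summable_of_pairwise_inner_eq_zero (fun k l hkl => ?_) ?_
  · beta_reduce
    rw [L2.inner_def]
    refine Eq.trans (integral_congr_ae ?_)
      ((integral_conj_tens_mul_tens (G k) (G l) k l).trans (if_neg hkl))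
    filter_upwards [coeFn_embed k (G k), coeFn_embed l (G l)] with q h1 h2
    rw [h1, h2, RCLike.inner_apply, mul_comm]
  · have h : ∑' k, ‖embed k (G k)‖ₑ ^ 2 < ⊤ := by
      simp_rw [enorm_embed_sq]
      rw [ENNReal.tsum_mul_left]
      exact ENNReal.mul_lt_top ENNReal.ofReal_lt_top hG
    have := ENNReal.summable_toReal h.ne
    simpa using this

/-- The integral is `⟨χ g, χ e^{ijx} g⟩`. Both multiplications are bounded on `L²`, so the expansion
of `g` may be inserted in each slot, and orthogonality in `x` keeps only the pairs of modes `(k + j,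
k)`. Only measurability of `χ` is asked, so that indicator functions are admitted. -/
theorem enorm_integral_modes_le {G : ℤ → Lp ℂ 2 (volume : Measure ℝ)}
    {g : Lp ℂ 2 (volume : Measure (ℝ × Torus))} (hg : HasSum (fun k => embed k (G k)) g)
    {χ : ℝ → ℝ} (hχ : Measurable χ) (hb : ∀ t, |χ t| ≤ 1) (j : ℤ) :
    ‖∫ q : ℝ × Torus, (χ q.1 : ℂ) ^ 2 * fourier j q.2 * (‖g q‖ : ℂ) ^ 2‖ₑ ≤
      ENNReal.ofReal (2 * Real.pi) *
        ∑' k, ‖∫ t, (χ t : ℂ) ^ 2 * (G k t * conj (G (k + j) t))‖ₑ := by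
  have m1 : AEStronglyMeasurable (fun q : ℝ × Torus => (χ q.1 : ℂ)) volume :=
    (Complex.measurable_ofReal.comp (hχ.comp measurable_fst)).aestronglyMeasurable
  have m2 : AEStronglyMeasurable (fun q : ℝ × Torus => (χ q.1 : ℂ) * fourier j q.2) volume :=
    m1.mul (fourier j).continuous.aestronglyMeasurable.comp_snd
  have b1 : ∀ q : ℝ × Torus, ‖(χ q.1 : ℂ)‖ ≤ 1 := fun q => by simpa using hb q.1
  have b2 : ∀ q : ℝ × Torus, ‖(χ q.1 : ℂ) * fourier j q.2‖ ≤ 1 := fun q => by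
    simpa [norm_mul, norm_fourier_apply, -fourier_apply] using hb q.1
  set A := mulL2 _ m1 1 b1
  set B := mulL2 _ m2 1 b2
  have hAB : inner ℂ (A g) (B g) =
      ∫ q : ℝ × Torus, (χ q.1 : ℂ) ^ 2 * fourier j q.2 * (‖g q‖ : ℂ) ^ 2 := by
    rw [L2.inner_def]
    refine integral_congr_ae ?_
    filter_upwards [coeFn_mulL2 m1 b1 g, coeFn_mulL2 m2 b2 g] with q h1 h2
    rw [h1, h2, RCLike.inner_apply, map_mul, Complex.conj_ofReal, ← Complex.mul_conj']
    ring
  have hlk : ∀ l k, inner ℂ (A (embed l (G l))) (B (embed k (G k))) =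
      if l = k + j then 2 * Real.pi * ∫ t, (χ t : ℂ) ^ 2 * (G k t * conj (G (k + j) t)) else 0 := by
    intro l k
    rw [L2.inner_def]
    refine Eq.trans (integral_congr_ae ?_) ((integral_conj_tens_mul_tens
      (fun t => χ t * G l t) (fun t => χ t * G k t) l (k + j)).trans ?_)
    · filter_upwards [coeFn_mulL2 m1 b1 (embed l (G l)), coeFn_mulL2 m2 b2 (embed k (G k)),
        coeFn_embed l (G l), coeFn_embed k (G k)] with q h1 h2 h3 h4
      rw [h1, h2, h3, h4, RCLike.inner_apply]
      simp only [tens, ← fourier_mul_fourier, map_mul]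
      ring
    · split_ifs with h
      · subst h
        congr 2 with t
        rw [map_mul, Complex.conj_ofReal]
        ring
      · rfl
  have hk : ∀ k, inner ℂ (A g) (B (embed k (G k))) =
      2 * Real.pi * ∫ t, (χ t : ℂ) ^ 2 * (G k t * conj (G (k + j) t)) := by
    intro k
    -- The series is summed in the second slot, where the inner product is linear; conjugate
    -- symmetry then restores the order.
    have s1 : HasSum (fun l => inner ℂ (B (embed k (G k))) (A (embed l (G l))))
        (inner ℂ (B (embed k (G k))) (A g)) :=
      (hg.mapL A).mapL (innerSL ℂ (B (embed k (G k))))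
    have s2 := hasSum_single (k + j) (f := fun l => inner ℂ (B (embed k (G k))) (A (embed l (G l))))
      fun l hl => by rw [← inner_conj_symm, hlk, if_neg hl, map_zero]
    rw [← inner_conj_symm, s1.unique s2, inner_conj_symm, hlk, if_pos rfl]
  have s : HasSum (fun k => inner ℂ (A g) (B (embed k (G k)))) (inner ℂ (A g) (B g)) :=
    (hg.mapL B).mapL (innerSL ℂ (A g))
  rw [← hAB, ← s.tsum_eq, ← ENNReal.tsum_mul_left]
  refine enorm_tsum_le_tsum_enorm.trans_eq (tsum_congr fun k => ?_)
  rw [hk, enorm_mul]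
  congr 1
  rw [← ofReal_norm]
  simp [abs_of_pos Real.pi_pos]

end Synthesis

/-! ### Elements of `X^{0,b}_T` as `L²` functions -/

section Representation

open ComplexConjugate

theorem continuous_of_contDiff_lift {ψ : ℝ × Torus → ℂ} (h : ContDiff ℝ ∞ (lift ψ)) :
    Continuous ψ := by
  have hq : IsOpenQuotientMap (Prod.map (id : ℝ → ℝ) ((↑) : ℝ → Torus)) :=
    IsOpenQuotientMap.id.prodMap QuotientAddGroup.isOpenQuotientMap_mk
  exact hq.continuous_comp_iff.1 h.continuous

/-- Mode by mode this is Plancherel in `t` and Fubini in `x`; the sum over modes is the continuity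
of the inner product with `conj ψ` along the `L²`-convergent series. -/
theorem fourierPairing_eq_integral {v : ℤ → ℝ → ℂ} (hv : ∀ k, MemLp (v k) 2)
    {g : Lp ℂ 2 (volume : Measure (ℝ × Torus))}
    (hg : HasSum (fun k => embed k (invFt (v k) (hv k))) g) {ψ : ℝ × Torus → ℂ}
    (hc : Continuous ψ) (hs : HasCompactSupport ψ) :
    fourierPairing v ψ = ∫ q, g q * ψ q := by
  have hψ2 : MemLp ψ 2 := hc.memLp_of_hasCompactSupport hs
  have hψc : MemLp (fun q => conj (ψ q)) 2 := hψ2.star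
  have hterm : ∀ k, ∫ τ : ℝ, v k τ * ∫ p : ℝ × Torus,
      Complex.exp (Complex.I * τ * p.1) * fourier k p.2 * ψ p =
      2 * Real.pi * inner ℂ (hψc.toLp _) (embed k (invFt (v k) (hv k))) := by
    intro k
    set φ : ℝ → ℂ := fun t => ∫ x : Torus, fourier k x * ψ (t, x) with hφ
    have hφc : Continuous φ := by
      have := continuous_parametric_integral_of_continuous (μ := (volume : Measure Torus))
        (f := fun (t : ℝ) (x : Torus) => (fourier k x : ℂ) * ψ (t, x))
        (by
          refine ((fourier k).continuous.comp continuous_snd).mul ?_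
          exact hc.comp (continuous_fst.prodMk continuous_snd)) isCompact_univ
      simpa only [Measure.restrict_univ] using this
    have hφs : HasCompactSupport φ := by
      refine HasCompactSupport.intro (hs.image continuous_fst) fun t ht => ?_
      have : ∀ x, ψ (t, x) = 0 := fun x => by
        by_contra hne
        exact ht ⟨(t, x), subset_tsupport _ hne, rfl⟩
      simp [hφ, this]
    have hin : ∀ τ : ℝ, ∫ p : ℝ × Torus, Complex.exp (Complex.I * τ * p.1) * fourier k p.2 * ψ p =
        ∫ t : ℝ, Complex.exp (Complex.I * τ * t) * φ t := by
      intro τ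
      have hi : Integrable (fun p : ℝ × Torus =>
          Complex.exp (Complex.I * τ * p.1) * fourier k p.2 * ψ p)
          ((volume : Measure ℝ).prod (volume : Measure Torus)) := by
        refine Continuous.integrable_of_hasCompactSupport ?_ hs.mul_left
        have := (fourier (T := 2 * Real.pi) k).continuous
        fun_prop
      rw [Measure.volume_eq_prod, integral_prod _ hi]
      refine integral_congr_ae (ae_of_all _ fun t => ?_)
      simp only [mul_assoc, hφ, integral_const_mul]
    simp_rw [hin]
    rw [integral_mul_exp_eq (hv k) (hφc.integrable_of_hasCompactSupport hφs)
      (hφc.memLp_of_hasCompactSupport hφs)]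
    congr 1
    have hi : Integrable (fun p : ℝ × Torus => tens (invFt (v k) (hv k)) (fourier k) p * ψ p)
        ((volume : Measure ℝ).prod (volume : Measure Torus)) :=
      (memLp_tens (Lp.memLp _) k).integrable_mul hψ2
    rw [L2.inner_def]
    calc ∫ t, invFt (v k) (hv k) t * φ t
        = ∫ p, tens (invFt (v k) (hv k)) (fourier k) p * ψ p := by
          rw [Measure.volume_eq_prod, integral_prod _ hi]
          refine integral_congr_ae (ae_of_all _ fun t => ?_)
          simp only [tens, mul_assoc, hφ, integral_const_mul]
      _ = _ := by
          refine integral_congr_ae ?_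
          filter_upwards [hψc.coeFn_toLp, coeFn_embed k (invFt (v k) (hv k))] with q h1 h2
          rw [h1, h2, RCLike.inner_apply, Complex.conj_conj]
  have hsum : HasSum (fun k => inner ℂ (hψc.toLp _) (embed k (invFt (v k) (hv k))))
      (inner ℂ (hψc.toLp _) g) := hg.mapL (innerSL ℂ (hψc.toLp _))
  have hpi : (Real.pi : ℂ) ≠ 0 := by exact_mod_cast Real.pi_ne_zero
  rw [fourierPairing, tsum_congr hterm, tsum_mul_left, hsum.tsum_eq, ← mul_assoc]
  have : (((2 * Real.pi)⁻¹ : ℝ) : ℂ) * (2 * Real.pi) = 1 := by push_cast; field_simp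
  rw [this, one_mul, L2.inner_def]
  refine integral_congr_ae ?_
  filter_upwards [hψc.coeFn_toLp] with q h1
  rw [h1, RCLike.inner_apply, Complex.conj_conj]

/-- The square of the norm of `X^{s,b}`. -/
noncomputable def xSq (s b : ℝ) (v : ℤ → ℝ → ℂ) : ℝ≥0∞ :=
  ∑' k : ℤ, ∫⁻ τ : ℝ, ENNReal.ofReal (xWeight s b k τ) * ‖v k τ‖ₑ ^ 2

theorem xNormFourier_sq (s b : ℝ) (v : ℤ → ℝ → ℂ) : xNormFourier s b v ^ 2 = xSq s b v := by
  rw [xNormFourier, ← ENNReal.rpow_natCast, ← ENNReal.rpow_mul]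
  norm_num [xSq]

/-- `v` is the Fourier transform of an extension of `u` to `ℝ × 𝕋`. -/
def IsExtension {T : ℝ} (u : Distr T) (v : ℤ → ℝ → ℂ) : Prop :=
  (∀ k, AEStronglyMeasurable (v k) volume) ∧ ∀ ψ : testFun T, u.toFun ψ = fourierPairing v ψ

theorem exists_isExtension_of_xNorm_lt {T : ℝ} {s b : ℝ} {u : Distr T} {c : ℝ≥0∞}
    (h : u.xNorm s b < c) : ∃ v, IsExtension u v ∧ xSq s b v ≤ c ^ 2 := by
  simp only [Distr.xNorm, iInf_lt_iff] at h
  obtain ⟨v, h1, h2, h3⟩ := h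
  exact ⟨v, ⟨h1, h2⟩, by rw [← xNormFourier_sq]; gcongr⟩

/-- The weight `|k|`, replaced by `1` for `k = 0`. -/
noncomputable def kw (k : ℤ) : ℝ := if k = 0 then 1 else |(k : ℝ)|

theorem one_le_kw (k : ℤ) : 1 ≤ kw k := by
  unfold kw
  split_ifs with h
  · exact le_rfl
  · exact_mod_cast Int.one_le_abs h

theorem xWeight_eq (s b : ℝ) (k : ℤ) (τ : ℝ) :
    xWeight s b k τ = kw k ^ (2 * s) * (1 + (τ + (k : ℝ) ^ 2) ^ 2) ^ b := by
  rw [xWeight, kw, Real.sqrt_eq_rpow, ← Real.rpow_mul (by positivity)]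
  congr 2
  ring

theorem xSq_eq (s b : ℝ) (v : ℤ → ℝ → ℂ) : xSq s b v = ∑' k : ℤ, ENNReal.ofReal (kw k ^ (2 * s)) *
    ∫⁻ τ : ℝ, ENNReal.ofReal ((1 + (τ + (k : ℝ) ^ 2) ^ 2) ^ b) * ‖v k τ‖ₑ ^ 2 := by
  refine tsum_congr fun k => ?_
  rw [← lintegral_const_mul' _ _ ENNReal.ofReal_ne_top]
  refine lintegral_congr fun τ => ?_
  have := one_le_kw k
  rw [xWeight_eq, ENNReal.ofReal_mul (by positivity), mul_assoc]

theorem tsum_lintegral_le_xSq {b : ℝ} (hb : 0 ≤ b) (v : ℤ → ℝ → ℂ) :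
    ∑' k, ∫⁻ τ, ‖v k τ‖ₑ ^ 2 ≤ xSq 0 b v := by
  rw [xSq_eq]
  refine ENNReal.tsum_le_tsum fun k => ?_
  simp only [mul_zero, Real.rpow_zero, ENNReal.ofReal_one, one_mul]
  refine lintegral_mono fun τ => ?_
  refine le_mul_of_one_le_left (zero_le)  ?_
  rw [ENNReal.one_le_ofReal]
  exact Real.one_le_rpow (by nlinarith [sq_nonneg (τ + (k : ℝ) ^ 2)]) hb

theorem IsExtension.memLp {T : ℝ} {u : Distr T} {v : ℤ → ℝ → ℂ} (h : IsExtension u v)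
    (hf : ∑' k, ∫⁻ τ, ‖v k τ‖ₑ ^ 2 < ⊤) (k : ℤ) : MemLp (v k) 2 :=
  memLp_two_of_lintegral_lt_top (h.1 k) ((ENNReal.le_tsum k).trans_lt hf)

end Representation

/-! ### Localization in time and boundedness of cutoffs on the weighted spaces -/

section Cutoff

open ComplexConjugate FourierTransform

/-- `χ ∈ C_c^∞(]0,T[)`. -/
def IsCutoff (T : ℝ) (χ : ℝ → ℂ) : Prop :=
  ContDiff ℝ ∞ χ ∧ HasCompactSupport χ ∧ tsupport χ ⊆ Ioo 0 T

/-- The function `t ↦ e^{-iτt} χ(t)`. -/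
noncomputable def modulate (τ : ℝ) (χ : ℝ → ℂ) (t : ℝ) : ℂ :=
  Complex.exp (-(Complex.I * τ * t)) * χ t

theorem contDiff_cexp_mul (c : ℂ) : ContDiff ℝ ∞ fun t : ℝ => Complex.exp (c * t) :=
  Complex.contDiff_exp.comp (contDiff_const.mul Complex.ofRealCLM.contDiff)

theorem IsCutoff.modulate {T : ℝ} {χ : ℝ → ℂ} (h : IsCutoff T χ) (τ : ℝ) :
    IsCutoff T (modulate τ χ) := by
  have hs : tsupport (SchrodingerTorus.modulate τ χ) ⊆ tsupport χ := tsupport_mul_subset_right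
  refine ⟨?_, h.2.1.mul_left, hs.trans h.2.2⟩
  have := (contDiff_cexp_mul (-(Complex.I * τ))).mul h.1
  simpa only [neg_mul] using! this

theorem IsCutoff.deriv {T : ℝ} {χ : ℝ → ℂ} (h : IsCutoff T χ) : IsCutoff T (deriv χ) :=
  ⟨((contDiff_infty_iff_deriv (𝕜 := ℝ)).1 h.1).2, h.2.1.deriv,
    (tsupport_deriv_subset (𝕜 := ℝ)).trans h.2.2⟩

theorem IsCutoff.tens_mem {T : ℝ} {χ : ℝ → ℂ} (h : IsCutoff T χ) (k : ℤ) :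
    tens χ (fourier k) ∈ testFun T :=
  SchrodingerTorus.tens_mem h.1 h.2.1 h.2.2 (contDiff_fourier_coe k)

theorem IsCutoff.integrable {T : ℝ} {χ : ℝ → ℂ} (h : IsCutoff T χ) : Integrable χ :=
  h.1.continuous.integrable_of_hasCompactSupport h.2.1

theorem IsCutoff.memLp {T : ℝ} {χ : ℝ → ℂ} (h : IsCutoff T χ) : MemLp χ 2 :=
  h.1.continuous.memLp_of_hasCompactSupport h.2.1

/-- The convolution `v k * ft χ`, that is, up to a constant, the Fourier transform of the `k`-th
mode of the product with `χ`. -/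
noncomputable def conv (v : ℤ → ℝ → ℂ) (χ : ℝ → ℂ) (k : ℤ) (τ : ℝ) : ℂ :=
  ∫ σ, v k σ * ft χ (τ - σ)

theorem integral_exp_modulate (χ : ℝ → ℂ) (σ τ : ℝ) :
    ∫ t : ℝ, Complex.exp (Complex.I * σ * t) * modulate τ χ t = ft χ (τ - σ) := by
  refine integral_congr_ae (ae_of_all _ fun t => ?_)
  simp only [modulate, ← mul_assoc, ← Complex.exp_add]
  congr 2
  push_cast
  ring

/-- This expresses the localized mode through `u` itself, tested on `e^{-iτt} χ(t) e^{-ikx}`. -/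
theorem IsExtension.toFun_modulate {T : ℝ} {u : Distr T} {v : ℤ → ℝ → ℂ} (h : IsExtension u v)
    {χ : ℝ → ℂ} (hχ : IsCutoff T χ) (k : ℤ) (τ : ℝ) :
    u.toFun ⟨_, (hχ.modulate τ).tens_mem (-k)⟩ = conv v χ k τ := by
  rw [h.2, fourierPairing_tens]
  simp_rw [integral_exp_modulate]
  rfl

theorem deriv_modulate {χ : ℝ → ℂ} (hχ : Differentiable ℝ χ) (τ t : ℝ) :
    deriv (modulate τ χ) t = -(Complex.I * τ) * modulate τ χ t + modulate τ (deriv χ) t := by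
  have h1 : HasDerivAt (fun t : ℝ => Complex.exp (-(Complex.I * τ * t)))
      (Complex.exp (-(Complex.I * τ * t)) * -(Complex.I * τ * 1)) t :=
    ((hasDerivAt_id t).ofReal_comp.const_mul (Complex.I * τ)).neg.cexp
  have h2 : HasDerivAt (modulate τ χ) _ t := h1.mul (hχ t).hasDerivAt
  rw [h2.deriv]
  simp only [modulate]
  ring

/-- On `e^{-iτt} χ(t) e^{-ikx}` the transposed operator acts as multiplication by `-(τ + k²)`, up to
the term where the derivative falls on `χ`. -/
theorem IsSolution.conv_eq {T : ℝ} {u f : Distr T} (hsol : IsSolution u f) {v w : ℤ → ℝ → ℂ}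
    (hv : IsExtension u v) (hw : IsExtension f w) {χ : ℝ → ℂ} (hχ : IsCutoff T χ) (k : ℤ) (τ : ℝ) :
    -((τ + (k : ℝ) ^ 2 : ℝ) : ℂ) * conv v χ k τ =
      conv w χ k τ + Complex.I * conv v (deriv χ) k τ := by
  have hd : Differentiable ℝ χ := hχ.1.differentiable (by simp)
  have hm := (hχ.modulate τ)
  have e := hsol ⟨_, hm.tens_mem (-k)⟩
  have e2 : schrodingerTranspose ⟨_, hm.tens_mem (-k)⟩ =
      (-((τ + (k : ℝ) ^ 2 : ℝ) : ℂ)) • (⟨_, hm.tens_mem (-k)⟩ : testFun T) +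
      (-Complex.I) • (⟨_, (hχ.deriv.modulate τ).tens_mem (-k)⟩ : testFun T) := by
    apply Subtype.ext
    rw [schrodingerTranspose_tens (hm.1.differentiable (by simp))]
    funext q
    simp only [tens, deriv_modulate hd, Submodule.coe_add, Submodule.coe_smul, Pi.add_apply,
      Pi.smul_apply, smul_eq_mul]
    push_cast
    linear_combination (τ : ℂ) * modulate τ χ q.1 * fourier (-k) q.2 * Complex.I_sq
  rw [e2, map_add, map_smul, map_smul, hv.toFun_modulate hχ, hv.toFun_modulate hχ.deriv,
    hw.toFun_modulate hχ, smul_eq_mul, smul_eq_mul] at e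
  linear_combination e

theorem ft_modulate_eq {a χ : ℝ → ℂ} (τ : ℝ) :
    ∫ t, a t * modulate τ χ t = ft (fun t => χ t * a t) τ := by
  refine integral_congr_ae (ae_of_all _ fun t => ?_)
  simp only [modulate]
  ring

theorem conv_eq_ft {T : ℝ} {v : ℤ → ℝ → ℂ} {k : ℤ} (hv : MemLp (v k) 2) {χ : ℝ → ℂ}
    (hχ : IsCutoff T χ) (τ : ℝ) :
    conv v χ k τ = 2 * Real.pi * ft (fun t => χ t * invFt (v k) hv t) τ := by
  have h := hχ.modulate τ
  rw [← ft_modulate_eq, ← integral_mul_exp_eq hv h.integrable h.memLp]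
  simp_rw [integral_exp_modulate]
  rfl

theorem continuous_ft_cutoff {T : ℝ} {χ : ℝ → ℂ} (hχ : IsCutoff T χ) : Continuous (ft χ) :=
  continuous_ft hχ.integrable

/-- The transform of a test function is a Schwartz function. The weight is the loss in
`rpow_weight_le`. -/
theorem lintegral_weight_ft_lt_top {T : ℝ} {χ : ℝ → ℂ} (hχ : IsCutoff T χ) :
    ∫⁻ η, ENNReal.ofReal (2 * (1 + η ^ 2)) * ‖ft χ η‖ₑ < ⊤ := by
  have hp : (0 : ℝ) < 2 * Real.pi := by positivity
  set S : SchwartzMap ℝ ℂ := 𝓕 (hχ.2.1.toSchwartzMap hχ.1) with hS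
  have h0 := S.integrable_pow_mul volume 0
  have h2 := S.integrable_pow_mul volume 2
  have hi : Integrable fun ξ : ℝ => 2 * (1 + (2 * Real.pi * ξ) ^ 2) * ‖S ξ‖ := by
    refine ((h0.const_mul 2).add (h2.const_mul (2 * (2 * Real.pi) ^ 2))).congr
      (ae_of_all _ fun ξ => ?_)
    simp only [Pi.add_apply, Real.norm_eq_abs, sq_abs]
    ring
  rw [← lintegral_comp_mul_left' _ hp]
  refine ENNReal.mul_lt_top ENNReal.ofReal_lt_top (lt_of_eq_of_lt ?_ hi.lintegral_lt_top)
  refine lintegral_congr fun ξ => ?_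
  rw [ENNReal.ofReal_mul (p := 2 * (1 + (2 * Real.pi * ξ) ^ 2)) (by positivity), ofReal_norm,
    ft_eq_fourier, inv_mul_cancel_left₀ hp.ne']
  rfl

/-- Peetre's inequality. The range `[-1, 1]` of exponents covers both `b` and `-b`; negative
exponents follow by exchanging `y` and `z`. -/
theorem rpow_weight_le {β : ℝ} (h1 : -1 ≤ β) (h2 : β ≤ 1) (y z : ℝ) :
    (1 + y ^ 2) ^ β ≤ 2 * (1 + (y - z) ^ 2) * (1 + z ^ 2) ^ β := by
  have key : ∀ {β : ℝ}, 0 ≤ β → β ≤ 1 → ∀ y z : ℝ,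
      (1 + y ^ 2) ^ β ≤ 2 * (1 + (y - z) ^ 2) * (1 + z ^ 2) ^ β := by
    intro β h0 h1 y z
    have e : 1 + y ^ 2 ≤ 2 * (1 + (y - z) ^ 2) * (1 + z ^ 2) := by
      nlinarith [sq_nonneg (y - 2 * z), sq_nonneg ((y - z) * z)]
    calc (1 + y ^ 2) ^ β ≤ (2 * (1 + (y - z) ^ 2) * (1 + z ^ 2)) ^ β := by gcongr
      _ = (2 * (1 + (y - z) ^ 2)) ^ β * (1 + z ^ 2) ^ β :=
        Real.mul_rpow (by positivity) (by positivity)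
      _ ≤ (2 * (1 + (y - z) ^ 2)) ^ (1 : ℝ) * (1 + z ^ 2) ^ β := by
        gcongr
        nlinarith [sq_nonneg (y - z)]
      _ = _ := by rw [Real.rpow_one]
  rcases le_total 0 β with h | h
  · exact key h h2 y z
  · have := key (neg_nonneg.2 h) (by linarith) z y
    rw [Real.rpow_neg (by positivity), Real.rpow_neg (by positivity), inv_le_iff_one_le_mul₀
      (by positivity)] at this
    have hy : (0 : ℝ) < (1 + y ^ 2) ^ β := by positivity
    calc (1 + y ^ 2) ^ β ≤ (1 + y ^ 2) ^ β * (2 * (1 + (z - y) ^ 2) * ((1 + y ^ 2) ^ β)⁻¹ *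
          (1 + z ^ 2) ^ β) := le_mul_of_one_le_right hy.le this
      _ = _ := by field_simp; ring

/-- Cauchy–Schwarz for the measure with density `g`, applied to `f` and `1`. -/
theorem lintegral_mul_sq_le {α : Type*} [MeasurableSpace α] {μ : Measure α} {f g : α → ℝ≥0∞}
    (hf : AEMeasurable f μ) (hg : AEMeasurable g μ) :
    (∫⁻ x, f x * g x ∂μ) ^ 2 ≤ (∫⁻ x, f x ^ 2 * g x ∂μ) * ∫⁻ x, g x ∂μ := by
  have h := ENNReal.lintegral_mul_norm_pow_le (μ := μ) ((hf.pow_const 2).mul hg) hg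
    (p := 1 / 2) (q := 1 / 2) (by norm_num) (by norm_num) (by norm_num)
  have e : ∀ x, ((fun x => f x ^ 2) * g) x ^ (1 / 2 : ℝ) * g x ^ (1 / 2 : ℝ) = f x * g x := by
    intro x
    rw [Pi.mul_apply, ENNReal.mul_rpow_of_nonneg _ _ (by norm_num), mul_assoc,
      ← ENNReal.rpow_add_of_nonneg _ _ (by norm_num) (by norm_num), ← ENNReal.rpow_natCast,
      ← ENNReal.rpow_mul]
    norm_num
  simp_rw [e] at h
  calc (∫⁻ x, f x * g x ∂μ) ^ 2
      ≤ ((∫⁻ x, f x ^ 2 * g x ∂μ) ^ (1 / 2 : ℝ) * (∫⁻ x, g x ∂μ) ^ (1 / 2 : ℝ)) ^ 2 := by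
        gcongr; exact h
    _ = _ := by
      rw [mul_pow, ← ENNReal.rpow_natCast, ← ENNReal.rpow_natCast, ← ENNReal.rpow_mul,
        ← ENNReal.rpow_mul]
      norm_num

/-- A weighted Young inequality: Peetre's inequality moves the weight from `τ` to `σ` at the expense
of the rapidly decaying kernel. Translation by `k²` changes nothing, so the constant is uniform in
`k` and the estimate can be summed. -/
theorem exists_lintegral_conv_le {T : ℝ} {χ : ℝ → ℂ} (hχ : IsCutoff T χ) :
    ∃ C : ℝ≥0∞, C ≠ ⊤ ∧ ∀ (v : ℤ → ℝ → ℂ) (k : ℤ), AEStronglyMeasurable (v k) volume →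
      ∀ β : ℝ, -1 ≤ β → β ≤ 1 →
      ∫⁻ τ, ENNReal.ofReal ((1 + (τ + (k : ℝ) ^ 2) ^ 2) ^ β) * ‖conv v χ k τ‖ₑ ^ 2 ≤
        C * ∫⁻ τ, ENNReal.ofReal ((1 + (τ + (k : ℝ) ^ 2) ^ 2) ^ β) * ‖v k τ‖ₑ ^ 2 := by
  set K := ft χ with hK
  have hKc : Continuous K := continuous_ft_cutoff hχ
  have hKm : Measurable K := hKc.measurable
  have hC1 := lintegral_weight_ft_lt_top hχ
  have hconv : ∀ v k τ, conv v χ k τ = ∫ σ, v k σ * K (τ - σ) := fun v k τ => rfl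
  rw [← hK] at hC1
  clear_value K
  set C1 := ∫⁻ η, ENNReal.ofReal (2 * (1 + η ^ 2)) * ‖K η‖ₑ
  set C0 := ∫⁻ η, ‖K η‖ₑ with hC0
  have hC01 : C0 ≤ C1 := lintegral_mono fun η => le_mul_of_one_le_left zero_le
    (by rw [ENNReal.one_le_ofReal]; nlinarith [sq_nonneg η])
  refine ⟨C1 * C0, ENNReal.mul_ne_top hC1.ne (hC01.trans_lt hC1).ne, fun v k hv β h1 h2 => ?_⟩
  set w : ℝ → ℝ≥0∞ := fun τ => ENNReal.ofReal ((1 + (τ + (k : ℝ) ^ 2) ^ 2) ^ β) with hw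
  have hwm : Measurable w := by fun_prop
  have hwle : ∀ τ σ, w τ ≤ ENNReal.ofReal (2 * (1 + (τ - σ) ^ 2)) * w σ := fun τ σ => by
    rw [hw, ← ENNReal.ofReal_mul (by positivity)]
    refine ENNReal.ofReal_le_ofReal ?_
    have := rpow_weight_le h1 h2 (τ + (k : ℝ) ^ 2) (σ + (k : ℝ) ^ 2)
    rwa [add_sub_add_right_eq_sub] at this
  have hpt : ∀ τ, w τ * ‖conv v χ k τ‖ₑ ^ 2 ≤ (∫⁻ σ, (w σ * ‖v k σ‖ₑ ^ 2) *
      (ENNReal.ofReal (2 * (1 + (τ - σ) ^ 2)) * ‖K (τ - σ)‖ₑ)) * C0 := by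
    intro τ
    have a1 : ‖conv v χ k τ‖ₑ ^ 2 ≤ (∫⁻ σ, ‖v k σ‖ₑ ^ 2 * ‖K (τ - σ)‖ₑ) * C0 := by
      have b1 : ‖conv v χ k τ‖ₑ ≤ ∫⁻ σ, ‖v k σ‖ₑ * ‖K (τ - σ)‖ₑ := by
        rw [hconv]
        refine (enorm_integral_le_lintegral_enorm _).trans_eq (lintegral_congr fun σ => ?_)
        rw [enorm_mul]
      have b2 : ∫⁻ σ, ‖K (τ - σ)‖ₑ = C0 :=
        lintegral_sub_left_eq_self (fun η => ‖K η‖ₑ) τ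
      rw [← b2]
      refine (pow_le_pow_left' b1 2).trans (lintegral_mul_sq_le hv.enorm ?_)
      exact (by fun_prop : Measurable fun σ => ‖K (τ - σ)‖ₑ).aemeasurable
    calc w τ * ‖conv v χ k τ‖ₑ ^ 2
        ≤ w τ * ((∫⁻ σ, ‖v k σ‖ₑ ^ 2 * ‖K (τ - σ)‖ₑ) * C0) := by gcongr
      _ = (∫⁻ σ, w τ * (‖v k σ‖ₑ ^ 2 * ‖K (τ - σ)‖ₑ)) * C0 := by
        rw [← mul_assoc, lintegral_const_mul' _ _ (by simp [hw])]
      _ ≤ _ := by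
        refine mul_le_mul_left (lintegral_mono fun σ => ?_) _
        calc w τ * (‖v k σ‖ₑ ^ 2 * ‖K (τ - σ)‖ₑ)
            ≤ (ENNReal.ofReal (2 * (1 + (τ - σ) ^ 2)) * w σ) *
              (‖v k σ‖ₑ ^ 2 * ‖K (τ - σ)‖ₑ) := by gcongr; exact hwle τ σ
          _ = _ := by ring
  have hm : AEMeasurable (Function.uncurry fun τ σ : ℝ => (w σ * ‖v k σ‖ₑ ^ 2) *
      (ENNReal.ofReal (2 * (1 + (τ - σ) ^ 2)) * ‖K (τ - σ)‖ₑ))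
      ((volume : Measure ℝ).prod volume) := by
    have m1 : AEMeasurable (fun p : ℝ × ℝ => w p.2 * ‖v k p.2‖ₑ ^ 2)
        ((volume : Measure ℝ).prod volume) :=
      (hwm.aemeasurable.mul (hv.enorm.pow_const 2)).comp_snd
    have m2 : Measurable fun p : ℝ × ℝ =>
        ENNReal.ofReal (2 * (1 + (p.1 - p.2) ^ 2)) * ‖K (p.1 - p.2)‖ₑ := by fun_prop
    exact m1.mul m2.aemeasurable
  calc ∫⁻ τ, w τ * ‖conv v χ k τ‖ₑ ^ 2
      ≤ ∫⁻ τ, (∫⁻ σ, (w σ * ‖v k σ‖ₑ ^ 2) *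
        (ENNReal.ofReal (2 * (1 + (τ - σ) ^ 2)) * ‖K (τ - σ)‖ₑ)) * C0 := lintegral_mono hpt
    _ = (∫⁻ σ, ∫⁻ τ, (w σ * ‖v k σ‖ₑ ^ 2) *
        (ENNReal.ofReal (2 * (1 + (τ - σ) ^ 2)) * ‖K (τ - σ)‖ₑ)) * C0 := by
      rw [lintegral_mul_const' _ _ (hC01.trans_lt hC1).ne, lintegral_lintegral_swap hm]
    _ = (∫⁻ σ, (w σ * ‖v k σ‖ₑ ^ 2) * C1) * C0 := by
      congr 1
      refine lintegral_congr fun σ => ?_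
      rw [lintegral_const_mul'' _ (by fun_prop)]
      congr 1
      exact lintegral_sub_right_eq_self (fun η => ENNReal.ofReal (2 * (1 + η ^ 2)) * ‖K η‖ₑ) σ
    _ = C1 * C0 * ∫⁻ σ, w σ * ‖v k σ‖ₑ ^ 2 := by
      rw [lintegral_mul_const' _ _ hC1.ne]
      ring

end Cutoff

/-! ### Interaction of different modes under a fixed cutoff -/

section Interior

theorem exists_xSq_conv_le {T : ℝ} {χ : ℝ → ℂ} (hχ : IsCutoff T χ) :
    ∃ C : ℝ≥0∞, C ≠ ⊤ ∧ ∀ v : ℤ → ℝ → ℂ, (∀ k, AEStronglyMeasurable (v k) volume) →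
      ∀ s β : ℝ, -1 ≤ β → β ≤ 1 → xSq s β (conv v χ) ≤ C * xSq s β v := by
  obtain ⟨C, hC, h⟩ := exists_lintegral_conv_le hχ
  refine ⟨C, hC, fun v hv s β h1 h2 => ?_⟩
  rw [xSq_eq, xSq_eq, ← ENNReal.tsum_mul_left]
  refine ENNReal.tsum_le_tsum fun k => ?_
  rw [mul_left_comm]
  gcongr
  exact h v k (hv k) β h1 h2

theorem continuous_conv {T : ℝ} {v : ℤ → ℝ → ℂ} {k : ℤ} (hv : MemLp (v k) 2) {χ : ℝ → ℂ}
    (hχ : IsCutoff T χ) : Continuous (conv v χ k) := by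
  rw [funext (conv_eq_ft hv hχ)]
  exact continuous_const.mul (continuous_ft (hχ.memLp.integrable_mul (Lp.memLp _)))

theorem kw_le_of_abs {k : ℤ} {c : ℝ} (h1 : 1 ≤ c) (h : |(k : ℝ)| ≤ c) : kw k ≤ c := by
  unfold kw
  split_ifs <;> assumption

theorem one_le_abs_intCast {j : ℤ} (hj : j ≠ 0) : (1 : ℝ) ≤ |(j : ℝ)| := by
  exact_mod_cast Int.one_le_abs hj

/-- Since `|j| ≥ 1`, the gap `j(2k+j)` dominates `2k+j`, which determines `k` up to `j`. The
frequency is thus bounded by the resonance gap, with a constant depending on `j` only. -/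
theorem kw_le {j : ℤ} (hj : j ≠ 0) (k : ℤ) :
    kw k ≤ (1 + |(j : ℝ)|) * (1 + |(j : ℝ) * (2 * k + j)|) := by
  have hj1 := one_le_abs_intCast hj
  have h2 : |(2 * k + j : ℝ)| ≤ |(j : ℝ) * (2 * k + j)| := by
    rw [abs_mul]; exact le_mul_of_one_le_left (abs_nonneg _) hj1
  have h3 : |(k : ℝ)| * 2 ≤ |(2 * k + j : ℝ)| + |(j : ℝ)| := by
    have := abs_sub (2 * k + j : ℝ) j
    rwa [add_sub_cancel_right, abs_mul, abs_two, mul_comm] at this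
  have h4 := abs_nonneg ((j : ℝ) * (2 * k + j))
  refine kw_le_of_abs ?_ ?_ <;> nlinarith

theorem kw_add_le {j : ℤ} (hj : j ≠ 0) (k : ℤ) :
    kw (k + j) ≤ (1 + |(j : ℝ)|) * (1 + |(j : ℝ) * (2 * k + j)|) := by
  -- The pair `(k + j, -j)` has the opposite gap.
  have h := kw_le (neg_ne_zero.2 hj) (k + j)
  have e : ((-j : ℤ) : ℝ) * (2 * ((k + j : ℤ) : ℝ) + ((-j : ℤ) : ℝ)) = -((j : ℝ) * (2 * k + j)) := by
    push_cast; ring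
  rw [e, abs_neg] at h
  simpa using h

/-- The weight gained on the support of the Fourier transform. -/
noncomputable def gainWeight (b : ℝ) (k : ℤ) (τ : ℝ) : ℝ :=
  kw k ^ (2 * (-1 + b)) * (1 + (τ + (k : ℝ) ^ 2) ^ 2) ^ (1 - b)

/-- The weight is the power `1 - b` of `⟨τ + k²⟩² / |k|²`, and a lower bound `d ≤ 1` survives an
exponent in `[0, 1]`. -/
theorem le_gainWeight {b d : ℝ} (hb0 : 0 ≤ b) (hb1 : b ≤ 1) (hd0 : 0 < d) (hd1 : d ≤ 1) {k : ℤ}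
    {τ : ℝ} (h : d * kw k ^ 2 ≤ 1 + (τ + (k : ℝ) ^ 2) ^ 2) : d ≤ gainWeight b k τ := by
  have hk := one_le_kw k
  have e : gainWeight b k τ = ((1 + (τ + (k : ℝ) ^ 2) ^ 2) / kw k ^ 2) ^ (1 - b) := by
    rw [gainWeight, Real.div_rpow (by positivity) (by positivity), div_eq_inv_mul,
      ← Real.rpow_natCast (kw k), ← Real.rpow_mul (by positivity), ← Real.rpow_neg (by positivity)]
    congr 2
    push_cast
    ring
  rw [e]
  calc d = d ^ (1 : ℝ) := (Real.rpow_one d).symm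
    _ ≤ d ^ (1 - b) := Real.rpow_le_rpow_of_exponent_ge hd0 hd1 (by linarith)
    _ ≤ _ := Real.rpow_le_rpow hd0.le ((le_div_iff₀ (by positivity)).2 h) (by linarith)

theorem gainWeight_nonneg (b : ℝ) (k : ℤ) (τ : ℝ) : 0 ≤ gainWeight b k τ := by
  have hk := one_le_kw k
  unfold gainWeight
  positivity

/-- The two modulations differ by `j(2k+j)`, so the larger one is at least half of this gap and, by
`kw_le`, of the order of the frequency. The factor `(1 + |j|)²` is the square of the constant there,
and `9` comes from `(1 + 2|y|)² ≤ 9(1 + y²)`. -/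
theorem le_gainWeight_or {b : ℝ} (hb0 : 0 ≤ b) (hb1 : b ≤ 1) {j : ℤ} (hj : j ≠ 0) (k : ℤ) (τ : ℝ) :
    (9 * (1 + |(j : ℝ)|) ^ 2)⁻¹ ≤ gainWeight b k τ ∨
      (9 * (1 + |(j : ℝ)|) ^ 2)⁻¹ ≤ gainWeight b (k + j) τ := by
  have hd0 : (0 : ℝ) < (9 * (1 + |(j : ℝ)|) ^ 2)⁻¹ := by positivity
  have hd1 : (9 * (1 + |(j : ℝ)|) ^ 2)⁻¹ ≤ 1 :=
    inv_le_one_of_one_le₀ (by nlinarith [abs_nonneg (j : ℝ)])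
  have key : ∀ {y y' K : ℝ}, 0 ≤ K → y' - y = j * (2 * k + j) → |y| ≤ |y'| →
      K ≤ (1 + |(j : ℝ)|) * (1 + |(j : ℝ) * (2 * k + j)|) →
      (9 * (1 + |(j : ℝ)|) ^ 2)⁻¹ * K ^ 2 ≤ 1 + y' ^ 2 := by
    intro y y' K hK hy hyy hle
    rw [inv_mul_le_iff₀ (by positivity)]
    have h1 : |(j : ℝ) * (2 * k + j)| ≤ 2 * |y'| := by
      rw [← hy]; linarith [abs_sub y' y]
    have h2 : (1 + 2 * |y'|) ^ 2 ≤ 9 * (1 + y' ^ 2) := by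
      nlinarith [sq_abs y', sq_nonneg (|y'| - 2), sq_nonneg (|y'| - 1), abs_nonneg y']
    calc K ^ 2 ≤ ((1 + |(j : ℝ)|) * (1 + 2 * |y'|)) ^ 2 := by
          gcongr; exact hle.trans (by gcongr)
      _ = (1 + |(j : ℝ)|) ^ 2 * (1 + 2 * |y'|) ^ 2 := by ring
      _ ≤ (1 + |(j : ℝ)|) ^ 2 * (9 * (1 + y' ^ 2)) := by gcongr
      _ = _ := by ring
  have e : (τ + ((k + j : ℤ) : ℝ) ^ 2) - (τ + (k : ℝ) ^ 2) = j * (2 * k + j) := by push_cast; ring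
  rcases le_total |τ + (k : ℝ) ^ 2| |τ + ((k + j : ℤ) : ℝ) ^ 2| with h | h
  · exact Or.inr (le_gainWeight hb0 hb1 hd0 hd1
      (key (zero_le_one.trans (one_le_kw _)) e h (kw_add_le hj k)))
  · refine Or.inl (le_gainWeight hb0 hb1 hd0 hd1 ?_)
    -- Exchanging the roles of the two modulations reverses the sign of the gap; negating both
    -- restores it.
    have e' : -(τ + (k : ℝ) ^ 2) - -(τ + ((k + j : ℤ) : ℝ) ^ 2) = j * (2 * k + j) := by
      rw [← e]; ring
    have := key (zero_le_one.trans (one_le_kw k)) e' (by simpa only [abs_neg] using h) (kw_le hj k)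
    simpa only [neg_sq] using this

/-- Young's inequality puts `ε` on the factor without gain and `(4ε)⁻¹` on the factor with gain,
where `d⁻¹` buys the weight. -/
theorem mul_le_gain {a a' ρ ρ' d ε : ℝ} (ha : 0 ≤ a) (ha' : 0 ≤ a') (hρ : 0 ≤ ρ) (hρ' : 0 ≤ ρ')
    (hd : 0 < d) (hε : 0 < ε) (h : d ≤ ρ ∨ d ≤ ρ') :
    a * a' ≤ ε * (a ^ 2 + a' ^ 2) + (4 * ε * d)⁻¹ * (ρ * a ^ 2 + ρ' * a' ^ 2) := by
  have key : ∀ {a a' ρ ρ' : ℝ}, 0 ≤ a → 0 ≤ a' → 0 ≤ ρ' → d ≤ ρ →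
      a * a' ≤ ε * (a ^ 2 + a' ^ 2) + (4 * ε * d)⁻¹ * (ρ * a ^ 2 + ρ' * a' ^ 2) := by
    intro a a' ρ ρ' ha ha' hρ' h
    have h1 : a * a' ≤ ε * a' ^ 2 + (4 * ε)⁻¹ * a ^ 2 := by
      have : ε * a' ^ 2 + (4 * ε)⁻¹ * a ^ 2 - a * a' = ε * (a' - (2 * ε)⁻¹ * a) ^ 2 := by
        field_simp; ring
      nlinarith [mul_nonneg hε.le (sq_nonneg (a' - (2 * ε)⁻¹ * a))]
    have h2 : (4 * ε)⁻¹ * a ^ 2 ≤ (4 * ε * d)⁻¹ * (ρ * a ^ 2 + ρ' * a' ^ 2) := by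
      calc (4 * ε)⁻¹ * a ^ 2 = (4 * ε * d)⁻¹ * (d * a ^ 2) := by field_simp
        _ ≤ (4 * ε * d)⁻¹ * (ρ * a ^ 2 + ρ' * a' ^ 2) := by
          gcongr
          nlinarith [mul_nonneg hρ' (sq_nonneg a'), mul_le_mul_of_nonneg_right h (sq_nonneg a)]
    nlinarith [mul_nonneg hε.le (sq_nonneg a)]
  rcases h with h | h
  · exact key ha ha' hρ' h
  · have := key ha' ha hρ h
    linarith [mul_comm a a']

/-- The gain weight is the weight of `X^{-1+b,-b}` times `1 + (τ + k²)²`. The equation controls the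
square; the summand `1`, like the commutator `Y` with the cutoff, is where smallness of `u` itself
in `X^{-1+b,-b}` enters. -/
theorem gainWeight_mul_sq_le {b : ℝ} (k : ℤ) (τ : ℝ) {X F Y : ℂ}
    (h : -((τ + (k : ℝ) ^ 2 : ℝ) : ℂ) * X = F + Complex.I * Y) :
    gainWeight b k τ * ‖X‖ ^ 2 ≤ xWeight (-1 + b) (-b) k τ * (‖X‖ ^ 2 + (2 * ‖F‖ ^ 2 + 2 * ‖Y‖ ^ 2)) := by
  have hk := one_le_kw k
  have h1 : (τ + (k : ℝ) ^ 2) ^ 2 * ‖X‖ ^ 2 ≤ 2 * ‖F‖ ^ 2 + 2 * ‖Y‖ ^ 2 := by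
    have e := congrArg norm h
    rw [norm_mul, norm_neg, Complex.norm_real] at e
    have e2 : ‖F + Complex.I * Y‖ ≤ ‖F‖ + ‖Y‖ := by
      refine (norm_add_le _ _).trans_eq ?_
      rw [norm_mul, Complex.norm_I, one_mul]
    rw [← sq_abs, ← mul_pow, ← Real.norm_eq_abs, e]
    nlinarith [norm_nonneg (F + Complex.I * Y), sq_nonneg (‖F‖ - ‖Y‖), norm_nonneg F, norm_nonneg Y]
  have e3 : (1 + (τ + (k : ℝ) ^ 2) ^ 2) ^ (1 - b) =
      (1 + (τ + (k : ℝ) ^ 2) ^ 2) ^ (-b) * (1 + (τ + (k : ℝ) ^ 2) ^ 2) := by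
    rw [sub_eq_neg_add, Real.rpow_add (by positivity), Real.rpow_one]
  rw [gainWeight, xWeight_eq, e3]
  have hw : 0 ≤ kw k ^ (2 * (-1 + b)) * (1 + (τ + (k : ℝ) ^ 2) ^ 2) ^ (-b) := by positivity
  nlinarith [mul_le_mul_of_nonneg_left h1 hw]

theorem measurable_gainWeight (b : ℝ) (k : ℤ) : Measurable (gainWeight b k) := by
  unfold gainWeight
  fun_prop

theorem measurable_xWeight (s b : ℝ) (k : ℤ) : Measurable (xWeight s b k) := by
  unfold xWeight
  fun_prop

/-- The bounded norm and the small norm of `u` are approached by different extensions. Localized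
modes do not see the choice, so bounds from both extensions may be combined. -/
theorem IsExtension.conv_eq_conv {T : ℝ} {u : Distr T} {v v' : ℤ → ℝ → ℂ} (h : IsExtension u v)
    (h' : IsExtension u v') {χ : ℝ → ℂ} (hχ : IsCutoff T χ) : conv v χ = conv v' χ := by
  funext k τ
  rw [← h.toFun_modulate hχ, h'.toFun_modulate hχ]

theorem tsum_gainWeight_conv_le {T b : ℝ} {u f : Distr T} (hsol : IsSolution u f)
    {v v' w : ℤ → ℝ → ℂ} (hv : IsExtension u v) (hv' : IsExtension u v') (hw : IsExtension f w)
    (hL2 : ∀ k, MemLp (v k) 2) {χ : ℝ → ℂ} (hχ : IsCutoff T χ) :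
    ∑' k, ∫⁻ τ, ENNReal.ofReal (gainWeight b k τ) * ‖conv v χ k τ‖ₑ ^ 2 ≤
      xSq (-1 + b) (-b) (conv v' χ) + (2 * xSq (-1 + b) (-b) (conv w χ) +
        2 * xSq (-1 + b) (-b) (conv v' (deriv χ))) := by
  rw [← hv.conv_eq_conv hv' hχ, ← hv.conv_eq_conv hv' hχ.deriv]
  simp only [xSq]
  rw [← ENNReal.tsum_mul_left, ← ENNReal.tsum_mul_left, ← ENNReal.tsum_add, ← ENNReal.tsum_add]
  refine ENNReal.tsum_le_tsum fun k => ?_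
  have c1 := continuous_conv (hL2 k) hχ
  have c2 := continuous_conv (hL2 k) hχ.deriv
  have mw := measurable_xWeight (-1 + b) (-b) k
  rw [← lintegral_const_mul' _ _ (by norm_num), ← lintegral_const_mul' _ _ (by norm_num),
    ← lintegral_add_right, ← lintegral_add_left]
  rotate_left
  · exact mw.ennreal_ofReal.mul (c1.measurable.enorm.pow_const 2)
  · exact (mw.ennreal_ofReal.mul (c2.measurable.enorm.pow_const 2)).const_mul 2
  refine lintegral_mono fun τ => ?_
  have hk := one_le_kw k
  have hx : 0 ≤ xWeight (-1 + b) (-b) k τ := by rw [xWeight_eq]; positivity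
  have h := ENNReal.ofReal_le_ofReal (gainWeight_mul_sq_le (b := b) k τ (hsol.conv_eq hv hw hχ k τ))
  rw [ENNReal.ofReal_mul (gainWeight_nonneg b k τ), ENNReal.ofReal_mul hx,
    ENNReal.ofReal_add (by positivity) (by positivity),
    ENNReal.ofReal_add (by positivity) (by positivity), ENNReal.ofReal_mul zero_le_two,
    ENNReal.ofReal_mul zero_le_two, ENNReal.ofReal_pow (norm_nonneg _),
    ENNReal.ofReal_pow (norm_nonneg _), ENNReal.ofReal_pow (norm_nonneg _), ofReal_norm, ofReal_norm,
    ofReal_norm, ENNReal.ofReal_ofNat] at h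
  refine h.trans_eq ?_
  ring

theorem tsum_lintegral_mul_shift_le {b : ℝ} (hb0 : 0 ≤ b) (hb1 : b ≤ 1) {j : ℤ} (hj : j ≠ 0)
    {X : ℤ → ℝ → ℂ} (hX : ∀ k, Measurable (X k)) {ε : ℝ} (hε : 0 < ε) :
    ∑' k, ∫⁻ τ, ‖X k τ‖ₑ * ‖X (k + j) τ‖ₑ ≤
      ENNReal.ofReal ε * (2 * ∑' k, ∫⁻ τ, ‖X k τ‖ₑ ^ 2) +
      ENNReal.ofReal (4 * ε * (9 * (1 + |(j : ℝ)|) ^ 2)⁻¹)⁻¹ *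
        (2 * ∑' k, ∫⁻ τ, ENNReal.ofReal (gainWeight b k τ) * ‖X k τ‖ₑ ^ 2) := by
  -- Summation over `ℤ` is invariant under the shift by `j`, so each doubled sum accounts for the
  -- modes `k` and `k + j` together.
  have sh : ∀ F : ℤ → ℝ≥0∞, 2 * ∑' k, F k = ∑' k, (F k + F (k + j)) := fun F => by
    rw [ENNReal.tsum_add, two_mul]
    congr 1
    exact ((Equiv.addRight j).tsum_eq F).symm
  rw [sh, sh, ← ENNReal.tsum_mul_left, ← ENNReal.tsum_mul_left, ← ENNReal.tsum_add]
  refine ENNReal.tsum_le_tsum fun k => ?_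
  have m1 : ∀ k, Measurable fun τ => ‖X k τ‖ₑ ^ 2 := fun k => (hX k).enorm.pow_const 2
  have m2 : ∀ k, Measurable fun τ => ENNReal.ofReal (gainWeight b k τ) * ‖X k τ‖ₑ ^ 2 :=
    fun k => (measurable_gainWeight b k).ennreal_ofReal.mul (m1 k)
  have m3 : Measurable fun τ => ENNReal.ofReal ε * (‖X k τ‖ₑ ^ 2 + ‖X (k + j) τ‖ₑ ^ 2) :=
    ((m1 k).add (m1 _)).const_mul _
  rw [← lintegral_add_left (m1 k), ← lintegral_add_left (m2 k),
    ← lintegral_const_mul' _ _ ENNReal.ofReal_ne_top,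
    ← lintegral_const_mul' _ _ ENNReal.ofReal_ne_top, ← lintegral_add_left m3]
  refine lintegral_mono fun τ => ?_
  have g1 := gainWeight_nonneg b k τ
  have g2 := gainWeight_nonneg b (k + j) τ
  have h := ENNReal.ofReal_le_ofReal (mul_le_gain (norm_nonneg (X k τ)) (norm_nonneg (X (k + j) τ))
    g1 g2 (by positivity) hε (le_gainWeight_or hb0 hb1 hj k τ))
  rw [ENNReal.ofReal_mul (norm_nonneg _), ENNReal.ofReal_add (by positivity) (by positivity),
    ENNReal.ofReal_mul hε.le, ENNReal.ofReal_mul (by positivity),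
    ENNReal.ofReal_add (by positivity) (by positivity),
    ENNReal.ofReal_add (by positivity) (by positivity),
    ENNReal.ofReal_mul g1, ENNReal.ofReal_mul g2, ENNReal.ofReal_pow (norm_nonneg _),
    ENNReal.ofReal_pow (norm_nonneg _), ofReal_norm, ofReal_norm] at h
  exact h

/-- The order of the constants matters: `A` is free of `ε`, while `D` may blow up as `ε → 0`, and
both are uniform in `u` and `f`. One lets `n → ∞` before `ε → 0`. -/
theorem exists_tsum_lintegral_conv_le {T b : ℝ} (hb0 : 0 ≤ b) (hb1 : b ≤ 1) {j : ℤ} (hj : j ≠ 0)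
    {χ : ℝ → ℂ} (hχ : IsCutoff T χ) :
    ∃ A : ℝ≥0∞, A ≠ ⊤ ∧ ∀ ε : ℝ, 0 < ε → ∃ D : ℝ≥0∞, D ≠ ⊤ ∧ ∀ {u f : Distr T},
      IsSolution u f → ∀ {v v' w : ℤ → ℝ → ℂ}, IsExtension u v → IsExtension u v' →
      IsExtension f w → xSq 0 b v < ⊤ →
      ∑' k, ∫⁻ τ, ‖conv v χ k τ‖ₑ * ‖conv v χ (k + j) τ‖ₑ ≤
        ENNReal.ofReal ε * (A * xSq 0 b v) +
          D * (xSq (-1 + b) (-b) v' + xSq (-1 + b) (-b) w) := by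
  obtain ⟨C, hC, h⟩ := exists_xSq_conv_le hχ
  obtain ⟨C', hC', h'⟩ := exists_xSq_conv_le hχ.deriv
  refine ⟨2 * C, ENNReal.mul_ne_top (by norm_num) hC, fun ε hε => ?_⟩
  set D := ENNReal.ofReal (4 * ε * (9 * (1 + |(j : ℝ)|) ^ 2)⁻¹)⁻¹ with hD
  refine ⟨D * (2 * (C + (2 * C + 2 * C'))), by finiteness,
    fun hsol v v' w hv hv' hw hfin => ?_⟩
  have hL2 : ∀ k, MemLp (v k) 2 := hv.memLp ((tsum_lintegral_le_xSq hb0 v).trans_lt hfin)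
  refine (tsum_lintegral_mul_shift_le hb0 hb1 hj
    (fun k => (continuous_conv (hL2 k) hχ).measurable) hε).trans ?_
  have e1 : ∑' k, ∫⁻ τ, ‖conv v χ k τ‖ₑ ^ 2 ≤ C * xSq 0 b v :=
    (tsum_lintegral_le_xSq hb0 _).trans (h v hv.1 0 b (by linarith) hb1)
  have e2 := tsum_gainWeight_conv_le (b := b) hsol hv hv' hw hL2 hχ
  have a1 := h v' hv'.1 (-1 + b) (-b) (by linarith) (by linarith)
  have a2 := h w hw.1 (-1 + b) (-b) (by linarith) (by linarith)
  have a3 := h' v' hv'.1 (-1 + b) (-b) (by linarith) (by linarith)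
  have e3 : ∑' k, ∫⁻ τ, ENNReal.ofReal (gainWeight b k τ) * ‖conv v χ k τ‖ₑ ^ 2 ≤
      (C + (2 * C + 2 * C')) * (xSq (-1 + b) (-b) v' + xSq (-1 + b) (-b) w) := by
    refine e2.trans ?_
    set p := xSq (-1 + b) (-b) v'
    set q := xSq (-1 + b) (-b) w
    calc _ ≤ C * p + (2 * (C * q) + 2 * (C' * p)) := by gcongr
      _ ≤ C * (p + q) + (2 * (C * (p + q)) + 2 * (C' * (p + q))) := by
        gcongr
        · exact le_self_add
        · exact le_add_self
        · exact le_self_add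
      _ = _ := by ring
  calc _ ≤ ENNReal.ofReal ε * (2 * (C * xSq 0 b v)) + D * (2 * ((C + (2 * C + 2 * C')) *
        (xSq (-1 + b) (-b) v' + xSq (-1 + b) (-b) w))) := by gcongr
    _ = _ := by ring

end Interior

/-! ### Equidistribution in space and the observation on `Ω` -/

section Observation

open ComplexConjugate

/-- The classes of smooth functions in `L²(ℝ × 𝕋)`. -/
noncomputable def smoothL2 : Submodule ℂ (Lp ℂ 2 (volume : Measure (ℝ × Torus))) where
  carrier := {P | ∃ p : ℝ × Torus → ℂ, ContDiff ℝ ∞ (lift p) ∧ P =ᵐ[volume] p}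
  zero_mem' := ⟨0, contDiff_const, Lp.coeFn_zero _ _ _⟩
  add_mem' := by
    rintro P Q ⟨p, h1, h2⟩ ⟨q, h3, h4⟩
    exact ⟨p + q, h1.add h3, (Lp.coeFn_add P Q).trans (h2.add h4)⟩
  smul_mem' := by
    rintro c P ⟨p, h1, h2⟩
    exact ⟨c • p, h1.const_smul c, (Lp.coeFn_smul c P).trans (h2.const_smul c)⟩

theorem embed_mem_closure (k : ℤ) (G : Lp ℂ 2 (volume : Measure ℝ)) :
    embed k G ∈ closure (smoothL2 : Set (Lp ℂ 2 (volume : Measure (ℝ × Torus)))) := by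
  have hd := SchwartzMap.denseRange_toLpCLM (E := ℝ) (F := ℂ) (p := 2)
    (μ := (volume : Measure ℝ)) (by norm_num) G
  refine map_mem_closure (embed k).continuous hd ?_
  rintro _ ⟨S, rfl⟩
  refine ⟨tens S (fourier k), ((S.smooth ⊤).comp contDiff_fst).mul
    ((contDiff_fourier_coe k).comp contDiff_snd), (coeFn_embed k _).trans (tens_ae_congr ?_ _)⟩
  exact S.coeFn_toLp 2 volume

theorem mem_closure_smoothL2 {G : ℤ → Lp ℂ 2 (volume : Measure ℝ)}
    {g : Lp ℂ 2 (volume : Measure (ℝ × Torus))} (hg : HasSum (fun k => embed k (G k)) g) :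
    g ∈ closure (smoothL2 : Set (Lp ℂ 2 (volume : Measure (ℝ × Torus)))) := by
  have : g ∈ smoothL2.topologicalClosure :=
    smoothL2.isClosed_topologicalClosure.mem_of_tendsto hg (Eventually.of_forall fun s =>
      Submodule.sum_mem _ fun k _ => embed_mem_closure k (G k))
  exact this

theorem enorm_integral_mul_le {α : Type*} [MeasurableSpace α] {μ : Measure α} {f g : α → ℂ}
    (hf : AEStronglyMeasurable f μ) (hg : AEStronglyMeasurable g μ) :
    ‖∫ x, f x * g x ∂μ‖ₑ ≤ eLpNorm f 2 μ * eLpNorm g 2 μ := by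
  refine (enorm_integral_le_lintegral_enorm _).trans ?_
  have := eLpNorm_smul_le_mul_eLpNorm (p := 2) (q := 2) (r := 1) hg hf
  rw [eLpNorm_one_eq_lintegral_enorm] at this
  simpa [smul_eq_mul] using this

/-- The quantity is `⟨g, χ²θ g⟩`, but `χ²θ conj(g)` is no test function. With a smooth `P` in the
first slot, the pairing is `u` tested on `χ²θ conj(P)`, which is supported over `Ω` and so bounded
by the observed norm; the bound passes to the closure. This avoids identifying `g` with the observed
function on `Ω`. -/
theorem enorm_observation_le {T : ℝ} {u : Distr T} {Ω : Set Torus}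
    {g : Lp ℂ 2 (volume : Measure (ℝ × Torus))}
    (hrep : ∀ ψ : testFun T, u.toFun ψ = ∫ q, g q * (ψ : ℝ × Torus → ℂ) q)
    (hg : g ∈ closure (smoothL2 : Set (Lp ℂ 2 (volume : Measure (ℝ × Torus)))))
    {χ : ℝ → ℝ} (hχ : IsCutoff T fun t => (χ t : ℂ)) (hχ1 : ∀ t, |χ t| ≤ 1)
    {θ : Torus → ℝ} (hθ : ContDiff ℝ ∞ fun x : ℝ => θ (x : Torus)) (hθ1 : ∀ x, |θ x| ≤ 1)
    (hθΩ : tsupport θ ⊆ Ω) {c : ℝ≥0∞} (hct : c ≠ ⊤) (hc : u.l2Norm Ω < c) :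
    ‖∫ q : ℝ × Torus, (χ q.1 : ℂ) ^ 2 * θ q.2 * (‖g q‖ : ℂ) ^ 2‖ₑ ≤ c * ‖g‖ₑ := by
  simp only [Distr.l2Norm, iInf_lt_iff] at hc
  obtain ⟨γ, hγm, hγ, hγc⟩ := hc
  set m : ℝ × Torus → ℂ := fun q => (χ q.1 : ℂ) ^ 2 * θ q.2 with hm
  have hmsm : ContDiff ℝ ∞ (lift m) :=
    ((hχ.1.comp contDiff_fst).pow 2).mul
      (Complex.ofRealCLM.contDiff.comp (hθ.comp contDiff_snd))
  have hmm : AEStronglyMeasurable m volume :=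
    (continuous_of_contDiff_lift hmsm).aestronglyMeasurable
  have hm1 : ∀ q, ‖m q‖ ≤ 1 := fun q => by
    rw [hm, norm_mul, norm_pow, Complex.norm_real, Complex.norm_real, Real.norm_eq_abs,
      Real.norm_eq_abs]
    exact mul_le_one₀ (pow_le_one₀ (abs_nonneg _) (hχ1 _)) (abs_nonneg _) (hθ1 _)
  have hB : ∀ P : Lp ℂ 2 (volume : Measure (ℝ × Torus)),
      inner ℂ P (mulL2 m hmm 1 hm1 g) = ∫ q, g q * (m q * conj (P q)) := by
    intro P
    rw [L2.inner_def]
    refine integral_congr_ae ?_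
    filter_upwards [coeFn_mulL2 hmm hm1 g] with q h1
    rw [h1, RCLike.inner_apply]
    ring
  have hsm : ∀ P ∈ (smoothL2 : Set (Lp ℂ 2 (volume : Measure (ℝ × Torus)))),
      ‖inner ℂ P (mulL2 m hmm 1 hm1 g)‖ₑ ≤ c * ‖P‖ₑ := by
    rintro P ⟨p, hp, hPp⟩
    set ψ : ℝ × Torus → ℂ := fun q => m q * conj (p q) with hψ
    have hsupp : tsupport ψ ⊆ tsupport (fun t => (χ t : ℂ)) ×ˢ tsupport θ := by
      refine closure_minimal (fun q hq => ?_) ((isClosed_tsupport _).prod (isClosed_tsupport _))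
      have h1 : m q ≠ 0 := left_ne_zero_of_mul hq
      have h2 : (χ q.1 : ℂ) ^ 2 ≠ 0 := left_ne_zero_of_mul h1
      have h3 : (θ q.2 : ℂ) ≠ 0 := right_ne_zero_of_mul h1
      exact ⟨subset_tsupport (fun t => (χ t : ℂ)) (pow_ne_zero_iff two_ne_zero |>.1 h2),
        subset_tsupport _ (Complex.ofReal_ne_zero.1 h3)⟩
    have hψm : ψ ∈ testFun T := mem_testFun_of_tsupport_subset
      (hmsm.mul (Complex.conjCLE.contDiff.comp hp)) hχ.2.1 hχ.2.2
      (hsupp.trans (prod_mono le_rfl (subset_univ _)))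
    -- Since `ψ` is supported over `Ω`, `u` can be evaluated on it through `g` as well as through
    -- `γ`.
    have e1 := (hrep ⟨ψ, hψm⟩).symm.trans
      (hγ ⟨ψ, hψm⟩ (hsupp.trans (prod_mono (subset_univ _) hθΩ)))
    have e2 : inner ℂ P (mulL2 m hmm 1 hm1 g) = ∫ q, g q * ψ q := by
      rw [hB]
      refine integral_congr_ae (hPp.mono fun q hq => ?_)
      simp only [hq, hψ]
    have hψc : Continuous ψ := continuous_of_contDiff_lift hψm.1
    rw [e2]
    refine (congrArg _ e1).trans_le
      ((enorm_integral_mul_le hγm hψc.aestronglyMeasurable).trans ?_)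
    refine mul_le_mul' hγc.le ((eLpNorm_mono_measure _ Measure.restrict_le_self).trans ?_)
    rw [Lp.enorm_def, eLpNorm_congr_ae hPp]
    refine eLpNorm_mono fun q => ?_
    rw [hψ, norm_mul, RCLike.norm_conj]
    exact mul_le_of_le_one_left (norm_nonneg _) (hm1 q)
  have hcl : IsClosed {P : Lp ℂ 2 (volume : Measure (ℝ × Torus)) |
      ‖inner ℂ P (mulL2 m hmm 1 hm1 g)‖ₑ ≤ c * ‖P‖ₑ} := by
    exact isClosed_le (by fun_prop) ((ENNReal.continuous_const_mul hct).comp continuous_enorm)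
  have : ‖inner ℂ g (mulL2 m hmm 1 hm1 g)‖ₑ ≤ c * ‖g‖ₑ := closure_minimal hsm hcl hg
  rw [hB] at this
  refine (congrArg _ (integral_congr_ae (ae_of_all _ fun q => ?_))).trans_le this
  simp only [hm, ← Complex.mul_conj']
  ring

/-- Uniformly bounded functionals that tend to `0` on the dense span of the characters tend to `0`
everywhere. -/
theorem tendsto_zero_of_fourier {Λ : ℕ → C(Torus, ℂ) →ₗ[ℂ] ℂ} {B : ℝ}
    (hB : ∀ n h, ‖Λ n h‖ ≤ B * ‖h‖)
    (hf : ∀ k, Tendsto (fun n => Λ n (fourier k)) atTop (𝓝 0)) (h : C(Torus, ℂ)) :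
    Tendsto (fun n => Λ n h) atTop (𝓝 0) := by
  have hspan : ∀ p ∈ Submodule.span ℂ (range (fourier (T := 2 * Real.pi))),
      Tendsto (fun n => Λ n p) atTop (𝓝 0) := by
    intro p hp
    induction hp using Submodule.span_induction with
    | mem x hx => obtain ⟨k, rfl⟩ := hx; exact hf k
    | zero => simp
    | add x y _ _ hx hy => simpa using hx.add hy
    | smul a x _ hx => simpa using hx.const_mul a
  have hB0 : 0 ≤ B := by
    have := hB 0 (fourier 0)
    rw [fourier_norm, mul_one] at this
    exact (norm_nonneg _).trans this
  rw [Metric.tendsto_atTop]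
  intro ε hε
  have hh : h ∈ closure (Submodule.span ℂ (range (fourier (T := 2 * Real.pi))) :
      Set C(Torus, ℂ)) := by
    have : h ∈ (Submodule.span ℂ (range (fourier (T := 2 * Real.pi)))).topologicalClosure := by
      rw [span_fourier_closure_eq_top]; trivial
    exact this
  obtain ⟨p, hp, hpd⟩ := Metric.mem_closure_iff.1 hh (ε / (2 * (B + 1))) (by positivity)
  obtain ⟨N, hN⟩ := Metric.tendsto_atTop.1 (hspan p hp) (ε / 2) (by positivity)
  refine ⟨N, fun n hn => ?_⟩
  have h1 := hN n hn
  rw [dist_zero_right] at h1 ⊢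
  have h2 : ‖Λ n (h - p)‖ ≤ ε / 2 := by
    refine (hB n _).trans ?_
    rw [dist_eq_norm] at hpd
    calc B * ‖h - p‖ ≤ (B + 1) * (ε / (2 * (B + 1))) := by gcongr; linarith
      _ = ε / 2 := by field_simp
  calc ‖Λ n h‖ = ‖Λ n (h - p) + Λ n p‖ := by rw [← map_add, sub_add_cancel]
    _ ≤ ‖Λ n (h - p)‖ + ‖Λ n p‖ := norm_add_le _ _
    _ < ε := by linarith

/-- The function `cos(y - x₀)` is smooth on the circle and equals `1` only at `x₀`, so by
compactness it stays below some `m < 1` off `Ω`. A smooth step at the level `(m + 1)/2` gives the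
bump without charts. -/
theorem exists_smooth_bump {Ω : Set Torus} (hΩ : IsOpen Ω) (hne : Ω.Nonempty) :
    ∃ θ : Torus → ℝ, (ContDiff ℝ ∞ fun x : ℝ => θ (x : Torus)) ∧ Continuous θ ∧ (∀ x, 0 ≤ θ x) ∧
      (∀ x, θ x ≤ 1) ∧ tsupport θ ⊆ Ω ∧ 0 < ∫ x, θ x := by
  obtain ⟨x₀, hx₀⟩ := hne
  set c : Torus → ℝ := fun y => (fourier 1 (y - x₀) : ℂ).re with hc
  have hcc : Continuous c :=
    Complex.continuous_re.comp ((fourier 1).continuous.comp (continuous_id.sub continuous_const))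
  have hclt : ∀ y, y ≠ x₀ → c y < 1 := by
    intro y hy
    have hn : ‖(fourier 1 (y - x₀) : ℂ)‖ = 1 := norm_fourier_apply 1 _
    refine lt_of_le_of_ne ((Complex.re_le_norm _).trans_eq hn) fun h => hy ?_
    have him : (fourier 1 (y - x₀) : ℂ) = 1 := by
      have := Complex.sq_norm (fourier 1 (y - x₀) : ℂ)
      rw [hn, Complex.normSq_apply] at this
      have h' : (fourier 1 (y - x₀) : ℂ).re = 1 := h
      rw [h'] at this
      apply Complex.ext
      · simpa using h'
      · have : (fourier 1 (y - x₀) : ℂ).im ^ 2 = 0 := by nlinarith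
        simpa using this
    rw [fourier_one] at him
    have h1 : (y - x₀).toCircle = (0 : Torus).toCircle := by
      apply Circle.ext
      rw [him]; simp
    exact sub_eq_zero.1 (AddCircle.injective_toCircle Real.two_pi_pos.ne' h1)
  obtain ⟨m, hm1, hm⟩ : ∃ m < 1, ∀ y ∈ Ωᶜ, c y ≤ m := by
    rcases (Ωᶜ).eq_empty_or_nonempty with h | h
    -- If `Ω` is the whole circle, any level below `1` serves.
    · exact ⟨0, one_pos, fun y hy => by simp [h] at hy⟩
    · obtain ⟨z, hz, hzm⟩ := hΩ.isClosed_compl.isCompact.exists_isMaxOn h hcc.continuousOn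
      exact ⟨c z, hclt z fun h => hz (h ▸ hx₀), fun y hy => hzm hy⟩
  have hθc : Continuous fun y => Real.smoothTransition (c y - (m + 1) / 2) :=
    Real.smoothTransition.continuous.comp (hcc.sub continuous_const)
  refine ⟨fun y => Real.smoothTransition (c y - (m + 1) / 2), ?_, hθc,
    fun _ => Real.smoothTransition.nonneg _, fun _ => Real.smoothTransition.le_one _, ?_, ?_⟩
  · refine Real.smoothTransition.contDiff.comp (ContDiff.sub ?_ contDiff_const)
    have e : ∀ x : ℝ, c (x : Torus) =
        Complex.reCLM (fourier 1 (x : Torus) * fourier 1 (-x₀) : ℂ) := fun x => by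
      simp only [hc, sub_eq_add_neg, fourier_one, AddCircle.toCircle_add]
      rfl
    simp_rw [e]
    exact Complex.reCLM.contDiff.comp ((contDiff_fourier_coe 1).mul contDiff_const)
  · have hs : tsupport (fun y => Real.smoothTransition (c y - (m + 1) / 2)) ⊆
        {y | (m + 1) / 2 ≤ c y} := by
      refine closure_minimal (fun y hy => ?_) (isClosed_le continuous_const hcc)
      by_contra hn
      rw [mem_ofPred_eq, not_le] at hn
      exact hy (Real.smoothTransition.zero_of_nonpos (by linarith))
    refine hs.trans fun y hy => ?_
    by_contra hn
    have := hm y hn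
    rw [mem_ofPred_eq] at hy
    linarith
  · refine hθc.integral_pos_of_hasCompactSupport_nonneg_nonzero
      (HasCompactSupport.of_compactSpace _) (fun _ => Real.smoothTransition.nonneg _) (x := x₀) ?_
    refine (Real.smoothTransition.pos_of_pos ?_).ne'
    simp only [hc, sub_self, fourier_eval_zero, Complex.one_re]
    linarith

theorem lintegral_sq_eq_enorm_integral {g : ℝ × Torus → ℂ} (hg : MemLp g 2) {χ : ℝ → ℝ}
    (hχ : Measurable χ) (hχ1 : ∀ t, |χ t| ≤ 1) :
    ∫⁻ q : ℝ × Torus, ENNReal.ofReal (χ q.1 ^ 2) * ‖g q‖ₑ ^ 2 =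
      ‖∫ q : ℝ × Torus, (χ q.1 : ℂ) ^ 2 * fourier 0 q.2 * (‖g q‖ : ℂ) ^ 2‖ₑ := by
  have e : ∀ q : ℝ × Torus, (χ q.1 : ℂ) ^ 2 * fourier 0 q.2 * (‖g q‖ : ℂ) ^ 2 =
      ((χ q.1 ^ 2 * ‖g q‖ ^ 2 : ℝ) : ℂ) := fun q => by
    rw [fourier_zero]; push_cast; ring
  have h2 : Integrable fun q : ℝ × Torus => χ q.1 ^ 2 * ‖g q‖ ^ 2 := by
    refine ((memLp_two_iff_integrable_sq_norm hg.1).1 hg).bdd_mul (c := 1)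
      ((hχ.comp measurable_fst).pow_const 2).aestronglyMeasurable (ae_of_all _ fun q => ?_)
    rw [norm_pow, Real.norm_eq_abs]
    exact pow_le_one₀ (abs_nonneg _) (hχ1 _)
  simp only [e]
  rw [integral_complex_ofReal, ← ofReal_norm, Complex.norm_real, Real.norm_of_nonneg
    (integral_nonneg fun q => by positivity), ofReal_integral_eq_lintegral_ofReal h2
    (ae_of_all _ fun q => by positivity)]
  refine lintegral_congr fun q => ?_
  rw [ENNReal.ofReal_mul (by positivity), ENNReal.ofReal_pow (norm_nonneg _), ofReal_norm]

/-- The measures `χ²|g n|²`, projected to the circle, become multiples of Lebesgue measure because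
their nonzero Fourier coefficients vanish in the limit; their mass on a bump in `Ω` vanishes too,
hence so does their total mass. -/
theorem tendsto_integral_sq_of_modes {T : ℝ} {Ω : Set Torus} (hΩ : IsOpen Ω) (hne : Ω.Nonempty)
    {u : ℕ → Distr T} {g : ℕ → Lp ℂ 2 (volume : Measure (ℝ × Torus))}
    (hrep : ∀ n, ∀ ψ : testFun T, (u n).toFun ψ = ∫ q, g n q * (ψ : ℝ × Torus → ℂ) q)
    (hg : ∀ n, g n ∈ closure (smoothL2 : Set (Lp ℂ 2 (volume : Measure (ℝ × Torus)))))
    {M : ℝ} (hM : ∀ n, ‖g n‖ ≤ M) {χ : ℕ → ℝ → ℝ} (hχ : ∀ n, IsCutoff T fun t => (χ n t : ℂ))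
    (hχ1 : ∀ n t, |χ n t| ≤ 1)
    (huΩ : Tendsto (fun n => (u n).l2Norm Ω) atTop (𝓝 0))
    (hj : ∀ j : ℤ, j ≠ 0 → Tendsto (fun n => ∫ q : ℝ × Torus,
      (χ n q.1 : ℂ) ^ 2 * fourier j q.2 * (‖g n q‖ : ℂ) ^ 2) atTop (𝓝 0)) :
    Tendsto (fun n => ∫⁻ q : ℝ × Torus, ENNReal.ofReal (χ n q.1 ^ 2) * ‖g n q‖ₑ ^ 2)
      atTop (𝓝 0) := by
  have hM0 : 0 ≤ M := (norm_nonneg _).trans (hM 0)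
  have hχm : ∀ n, Measurable (χ n) := fun n => by
    have : χ n = fun t => ((χ n t : ℂ)).re := rfl
    rw [this]
    exact (Complex.continuous_re.comp (hχ n).1.continuous).measurable
  have hgi : ∀ n, Integrable fun q => ‖g n q‖ ^ 2 := fun n =>
    (memLp_two_iff_integrable_sq_norm (Lp.memLp (g n)).1).1 (Lp.memLp (g n))
  have hgint : ∀ n, ∫ q, ‖g n q‖ ^ 2 = ‖g n‖ ^ 2 := fun n => by
    have h := lintegral_enorm_sq_eq_ofReal (Lp.memLp (g n))
    rw [← eLpNorm_two_sq, ← Lp.enorm_def, ← ofReal_norm, ← ENNReal.ofReal_pow (norm_nonneg _),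
      ENNReal.ofReal_eq_ofReal_iff (by positivity) (by positivity)] at h
    exact h.symm
  have hmeas : ∀ n (h : C(Torus, ℂ)), AEStronglyMeasurable
      (fun q : ℝ × Torus => (χ n q.1 : ℂ) ^ 2 * h q.2) volume := fun n h => by
    have h1 : Measurable fun q : ℝ × Torus => (χ n q.1 : ℂ) :=
      Complex.measurable_ofReal.comp ((hχm n).comp measurable_fst)
    exact (h1.pow_const 2).aestronglyMeasurable.mul h.continuous.aestronglyMeasurable.comp_snd
  have hbd : ∀ n (h : C(Torus, ℂ)) (q : ℝ × Torus), ‖(χ n q.1 : ℂ) ^ 2 * h q.2‖ ≤ ‖h‖ := by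
    intro n h q
    rw [norm_mul, norm_pow, Complex.norm_real, Real.norm_eq_abs]
    calc |χ n q.1| ^ 2 * ‖h q.2‖ ≤ 1 * ‖h‖ := by
          gcongr
          · exact pow_le_one₀ (abs_nonneg _) (hχ1 n _)
          · exact h.norm_coe_le_norm _
      _ = ‖h‖ := one_mul _
  have hint : ∀ n (h : C(Torus, ℂ)), Integrable fun q : ℝ × Torus =>
      (χ n q.1 : ℂ) ^ 2 * h q.2 * (‖g n q‖ : ℂ) ^ 2 := fun n h => by
    have h2 : Integrable fun q => (‖g n q‖ : ℂ) ^ 2 := by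
      exact (hgi n).ofReal (𝕜 := ℂ) |>.congr (ae_of_all _ fun q => by push_cast; rfl)
    exact h2.bdd_mul (c := ‖h‖) (hmeas n h) (ae_of_all _ (hbd n h))
  set L : ℕ → C(Torus, ℂ) → ℂ := fun n h =>
    ∫ q : ℝ × Torus, (χ n q.1 : ℂ) ^ 2 * h q.2 * (‖g n q‖ : ℂ) ^ 2 with hL
  have hLle : ∀ n h, ‖L n h‖ ≤ M ^ 2 * ‖h‖ := by
    intro n h
    calc ‖L n h‖ ≤ ∫ q, ‖h‖ * ‖g n q‖ ^ 2 := by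
          refine norm_integral_le_of_norm_le ((hgi n).const_mul _) (ae_of_all _ fun q => ?_)
          rw [norm_mul, norm_pow, Complex.norm_real, norm_norm]
          gcongr
          exact hbd n h q
      _ = ‖h‖ * ‖g n‖ ^ 2 := by rw [integral_const_mul, hgint]
      _ ≤ M ^ 2 * ‖h‖ := by
        rw [mul_comm]
        gcongr
        exact hM n
  have hLadd : ∀ n h k, L n (h + k) = L n h + L n k := fun n h k => by
    rw [hL, ← integral_add (hint n h) (hint n k)]
    refine integral_congr_ae (ae_of_all _ fun q => ?_)
    simp only [ContinuousMap.add_apply]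
    ring
  have hLsmul : ∀ n (a : ℂ) h, L n (a • h) = a * L n h := fun n a h => by
    rw [hL, ← integral_const_mul]
    refine integral_congr_ae (ae_of_all _ fun q => ?_)
    simp only [ContinuousMap.smul_apply, smul_eq_mul]
    ring
  set I : C(Torus, ℂ) → ℂ := fun h => ∫ x : Torus, h x ∂AddCircle.haarAddCircle with hI
  have hcint : ∀ h : C(Torus, ℂ), Integrable h AddCircle.haarAddCircle := fun h =>
    h.continuous.integrable_of_hasCompactSupport (HasCompactSupport.of_compactSpace _)
  have hIle : ∀ h, ‖I h‖ ≤ ‖h‖ := fun h => by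
    refine (norm_integral_le_of_norm_le_const (ae_of_all _ h.norm_coe_le_norm)).trans_eq ?_
    simp
  -- Subtracting the mean of `h` times the zeroth coefficient makes `Λ n` vanish on `fourier 0`, the
  -- one character not covered by `hj`.
  set Λ : ℕ → C(Torus, ℂ) →ₗ[ℂ] ℂ := fun n =>
    { toFun := fun h => L n h - I h * L n (fourier 0)
      map_add' := fun h k => by
        rw [hLadd, hI]
        simp only [ContinuousMap.add_apply]
        rw [integral_add (hcint h) (hcint k)]
        ring
      map_smul' := fun a h => by
        rw [hLsmul, hI]
        simp only [ContinuousMap.smul_apply, smul_eq_mul, RingHom.id_apply]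
        rw [integral_const_mul]
        ring } with hΛ
  have hΛB : ∀ n h, ‖Λ n h‖ ≤ (2 * M ^ 2) * ‖h‖ := by
    intro n h
    have h0 := hLle n (fourier 0)
    rw [fourier_norm, mul_one] at h0
    calc ‖Λ n h‖ ≤ ‖L n h‖ + ‖I h * L n (fourier 0)‖ := norm_sub_le _ _
      _ ≤ M ^ 2 * ‖h‖ + ‖h‖ * M ^ 2 := by
        rw [norm_mul]
        gcongr
        · exact hLle n h
        · exact hIle h
      _ = _ := by ring
  have hΛf : ∀ k, Tendsto (fun n => Λ n (fourier k)) atTop (𝓝 0) := by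
    intro k
    have hIk : I (fourier k) = if k = 0 then 1 else 0 := by
      rw [hI]
      simp only
      rw [AddCircle.integral_haarAddCircle, integral_fourier]
      split_ifs
      · rw [Complex.real_smul]
        have : (Real.pi : ℂ) ≠ 0 := by exact_mod_cast Real.pi_ne_zero
        push_cast
        field_simp
      · simp
    by_cases hk : k = 0
    · subst hk
      have : ∀ n, Λ n (fourier 0) = 0 := fun n => by
        simp only [hΛ, LinearMap.coe_mk, AddHom.coe_mk, hIk, if_true]
        ring
      simp only [this]
      exact tendsto_const_nhds
    · have : ∀ n, Λ n (fourier k) = L n (fourier k) := fun n => by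
        simp only [hΛ, LinearMap.coe_mk, AddHom.coe_mk, hIk, if_neg hk]
        ring
      simp only [this]
      exact hj k hk
  obtain ⟨θ, hθs, hθc, hθ0, hθ1, hθΩ, hθi⟩ := exists_smooth_bump hΩ hne
  set Θ : C(Torus, ℂ) := ⟨fun x => (θ x : ℂ), Complex.continuous_ofReal.comp hθc⟩ with hΘ
  have hLΘ : Tendsto (fun n => L n Θ) atTop (𝓝 0) := by
    rw [tendsto_zero_iff_enorm_tendsto_zero]
    rw [ENNReal.tendsto_nhds_zero]
    intro ε hε
    -- The minimum keeps the bound finite when `ε = ⊤`; adding `1` to `M` avoids division by zero.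
    have hc0 : 0 < min 1 (ε / (ENNReal.ofReal M + 1)) :=
      lt_min one_pos (ENNReal.div_pos hε.ne' (by finiteness))
    filter_upwards [huΩ.eventually_lt_const hc0] with n hn
    have hct : min 1 (ε / (ENNReal.ofReal M + 1)) ≠ ⊤ :=
      ((min_le_left _ _).trans_lt ENNReal.one_lt_top).ne
    refine (enorm_observation_le (hrep n) (hg n) (hχ n) (hχ1 n) hθs
      (fun x => abs_le.2 ⟨by linarith [hθ0 x], hθ1 x⟩) hθΩ hct hn).trans ?_
    calc min 1 (ε / (ENNReal.ofReal M + 1)) * ‖g n‖ₑ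
        ≤ ε / (ENNReal.ofReal M + 1) * (ENNReal.ofReal M + 1) := by
          refine mul_le_mul' (min_le_right _ _) (le_add_right ?_)
          rw [← ofReal_norm]
          exact ENNReal.ofReal_le_ofReal (hM n)
      _ = ε := ENNReal.div_mul_cancel (by simp) (by finiteness)
  have hIΘ : I Θ ≠ 0 := by
    have e : I Θ = (((2 * Real.pi)⁻¹ * ∫ x, θ x : ℝ) : ℂ) := by
      rw [hI]
      simp only [hΘ, ContinuousMap.coe_mk]
      rw [AddCircle.integral_haarAddCircle, integral_complex_ofReal, Complex.real_smul]
      push_cast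
      ring
    rw [e]
    exact Complex.ofReal_ne_zero.2 (by positivity)
  have hL0 : Tendsto (fun n => L n (fourier 0)) atTop (𝓝 0) := by
    -- By definition of `Λ`, `I Θ * L n (fourier 0) = L n Θ - Λ n Θ`, and `I Θ` can be divided out.
    have h1 := (hLΘ.sub (tendsto_zero_of_fourier hΛB hΛf Θ)).const_mul (I Θ)⁻¹
    rw [sub_zero, mul_zero] at h1
    refine h1.congr fun n => ?_
    simp only [hΛ, LinearMap.coe_mk, AddHom.coe_mk]
    field_simp
    ring
  have hfin : ∀ n, ∫⁻ q : ℝ × Torus, ENNReal.ofReal (χ n q.1 ^ 2) * ‖g n q‖ₑ ^ 2 =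
      ‖L n (fourier 0)‖ₑ := by
    intro n
    exact (lintegral_sq_eq_enorm_integral (Lp.memLp (g n)) (hχm n) (hχ1 n))
  simp only [hfin]
  exact (tendsto_zero_iff_enorm_tendsto_zero).1 hL0

end Observation

/-! ### Plancherel for interactions, and absence of concentration in time for `b > 0` -/

section Concentration

open ComplexConjugate

theorem one_le_ofReal_two_pi : (1 : ℝ≥0∞) ≤ ENNReal.ofReal (2 * Real.pi) := by
  rw [ENNReal.one_le_ofReal]
  linarith [Real.pi_gt_three]

theorem lintegral_invFt_le {v : ℝ → ℂ} (hv : MemLp v 2) :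
    ∫⁻ t, ‖invFt v hv t‖ₑ ^ 2 ≤ ∫⁻ τ, ‖v τ‖ₑ ^ 2 := by
  rw [← lintegral_enorm_invFt_sq hv]
  exact le_mul_of_one_le_left zero_le one_le_ofReal_two_pi

/-- Plancherel in time. The exact relation carries `(2π)³`, one factor from each `conv` and one from
Plancherel; it exceeds `1` and is dropped. -/
theorem enorm_integral_sq_mul_le_conv {T : ℝ} {v : ℤ → ℝ → ℂ} (hv : ∀ k, MemLp (v k) 2)
    {χ : ℝ → ℝ} (hχ : IsCutoff T fun t => (χ t : ℂ)) (k l : ℤ) :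
    ‖∫ t, (χ t : ℂ) ^ 2 * (invFt (v k) (hv k) t * conj (invFt (v l) (hv l) t))‖ₑ ≤
      ∫⁻ τ, ‖conv v (fun t => (χ t : ℂ)) k τ‖ₑ * ‖conv v (fun t => (χ t : ℂ)) l τ‖ₑ := by
  obtain ⟨C, hC⟩ := hχ.1.continuous.bounded_above_of_compact_support hχ.2.1
  have h1 : ∀ k, Integrable fun t => (χ t : ℂ) * invFt (v k) (hv k) t :=
    fun k => hχ.memLp.integrable_mul (Lp.memLp _)
  have h2 : ∀ k, MemLp (fun t => (χ t : ℂ) * invFt (v k) (hv k) t) 2 :=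
    fun k => memLp_bdd_mul hχ.1.continuous.aestronglyMeasurable hC (Lp.memLp _)
  have e := integral_ft_mul_conj_ft (h1 k) (h2 k) (h1 l) (h2 l)
  have e1 : ∫ τ, conv v (fun t => (χ t : ℂ)) k τ * conj (conv v (fun t => (χ t : ℂ)) l τ) =
      ((2 * Real.pi) ^ 3 : ℝ) *
        ∫ t, (χ t : ℂ) ^ 2 * (invFt (v k) (hv k) t * conj (invFt (v l) (hv l) t)) := by
    have e2 : ∀ τ, conv v (fun t => (χ t : ℂ)) k τ * conj (conv v (fun t => (χ t : ℂ)) l τ) =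
        (2 * Real.pi) ^ 2 * (ft (fun t => (χ t : ℂ) * invFt (v k) (hv k) t) τ *
          conj (ft (fun t => (χ t : ℂ) * invFt (v l) (hv l) t) τ)) := fun τ => by
      rw [conv_eq_ft (hv k) hχ, conv_eq_ft (hv l) hχ]
      simp only [map_mul, Complex.conj_ofReal, map_ofNat]
      ring
    simp_rw [e2]
    rw [integral_const_mul, e, ← mul_assoc]
    congr 1
    · push_cast; ring
    · refine integral_congr_ae (ae_of_all _ fun t => ?_)
      simp only [map_mul, Complex.conj_ofReal]
      ring
  have hp : (1 : ℝ≥0∞) ≤ ‖(((2 * Real.pi) ^ 3 : ℝ) : ℂ)‖ₑ := by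
    rw [← ofReal_norm, Complex.norm_real, Real.norm_of_nonneg (by positivity),
      ENNReal.ofReal_pow (by positivity)]
    exact one_le_pow₀ one_le_ofReal_two_pi
  calc _ ≤ ‖∫ τ, conv v (fun t => (χ t : ℂ)) k τ * conj (conv v (fun t => (χ t : ℂ)) l τ)‖ₑ := by
        rw [e1, enorm_mul]
        exact le_mul_of_one_le_left zero_le hp
    _ ≤ _ := by
        refine (enorm_integral_le_lintegral_enorm _).trans_eq (lintegral_congr fun τ => ?_)
        rw [enorm_mul, RCLike.enorm_conj]

/-- The case `j = 0` of `enorm_integral_modes_le`, with the indicator of `S` as cutoff. -/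
theorem lintegral_sq_modes_le {G : ℤ → Lp ℂ 2 (volume : Measure ℝ)}
    {g : Lp ℂ 2 (volume : Measure (ℝ × Torus))} (hg : HasSum (fun k => embed k (G k)) g)
    {S : Set ℝ} (hS : MeasurableSet S) :
    ∫⁻ q in S ×ˢ univ, ‖g q‖ₑ ^ 2 ≤
      ENNReal.ofReal (2 * Real.pi) * ∑' k, ∫⁻ t in S, ‖G k t‖ₑ ^ 2 := by
  set χ : ℝ → ℝ := S.indicator 1 with hχ
  have hχm : Measurable χ := measurable_one.indicator hS
  have hχ1 : ∀ t, |χ t| ≤ 1 := fun t => by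
    by_cases h : t ∈ S <;> simp [hχ, h]
  have h := enorm_integral_modes_le hg hχm hχ1 0
  rw [← lintegral_sq_eq_enorm_integral (Lp.memLp g) hχm hχ1] at h
  have e1 : ∫⁻ q : ℝ × Torus, ENNReal.ofReal (χ q.1 ^ 2) * ‖g q‖ₑ ^ 2 =
      ∫⁻ q in S ×ˢ univ, ‖g q‖ₑ ^ 2 := by
    rw [← lintegral_indicator (hS.prod MeasurableSet.univ)]
    refine lintegral_congr fun q => ?_
    by_cases hq : q.1 ∈ S <;> simp [hχ, hq, indicator]
  rw [e1] at h
  refine h.trans ?_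
  gcongr with k
  refine (enorm_integral_le_lintegral_enorm _).trans_eq ?_
  rw [← lintegral_indicator hS]
  refine lintegral_congr fun t => ?_
  by_cases ht : t ∈ S
  · simp [hχ, ht, enorm_mul, sq]
  · simp [hχ, ht]

/-- The part of modulation at most `M` has its frequencies in an interval of length `2M`, so it is
bounded in time and has little mass on a small set. The rest is small in `L²`, because its weight is
at least `(1 + M²)^b`, which is large as `b > 0`. The interval is merely translated by `k²`, so `δ`
does not depend on `k`. -/
theorem exists_lintegral_invFt_le {b : ℝ} (hb : 0 < b) {ε : ℝ} (hε : 0 < ε) :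
    ∃ δ : ℝ, 0 < δ ∧ ∀ (k : ℤ) (v : ℝ → ℂ) (hv : MemLp v 2) (S : Set ℝ),
      volume S ≤ ENNReal.ofReal δ → ∫⁻ t in S, ‖invFt v hv t‖ₑ ^ 2 ≤ ENNReal.ofReal ε *
        ∫⁻ τ, ENNReal.ofReal ((1 + (τ + (k : ℝ) ^ 2) ^ 2) ^ b) * ‖v τ‖ₑ ^ 2 := by
  -- The inequality `|x + y|² ≤ 2|x|² + 2|y|²` doubles both parts. The level `4 / ε` leaves `ε/2`
  -- for the high part, and `δ = ε/(8M)` leaves `2 · 2M · δ = ε/2` for the low part.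
  obtain ⟨M, hM1, hM⟩ : ∃ M : ℝ, 1 ≤ M ∧ 4 / ε ≤ (1 + M ^ 2) ^ b := by
    have h1 : Tendsto (fun M : ℝ => (1 + M ^ 2) ^ b) atTop atTop :=
      (tendsto_rpow_atTop hb).comp
        (tendsto_atTop_add_const_left _ _ (tendsto_pow_atTop two_ne_zero))
    obtain ⟨M, h2, h3⟩ := ((h1.eventually_ge_atTop (4 / ε)).and (eventually_ge_atTop 1)).exists
    exact ⟨M, h3, h2⟩
  refine ⟨ε / (8 * M), by positivity, fun k v hv S hS => ?_⟩
  set w : ℝ → ℝ≥0∞ := fun τ => ENNReal.ofReal ((1 + (τ + (k : ℝ) ^ 2) ^ 2) ^ b) with hw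
  set A := ∫⁻ τ, w τ * ‖v τ‖ₑ ^ 2 with hA
  set J : Set ℝ := Icc (-M - (k : ℝ) ^ 2) (M - (k : ℝ) ^ 2) with hJ
  have hJm : MeasurableSet J := measurableSet_Icc
  have hJv : volume J = ENNReal.ofReal (2 * M) := by
    rw [hJ, Real.volume_Icc]; congr 1; ring
  have hw1 : ∀ τ, 1 ≤ w τ := fun τ => by
    rw [hw, ENNReal.one_le_ofReal]
    exact Real.one_le_rpow (by nlinarith [sq_nonneg (τ + (k : ℝ) ^ 2)]) hb.le
  have hwJ : ∀ τ ∉ J, ENNReal.ofReal (4 / ε) ≤ w τ := fun τ hτ => by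
    refine ENNReal.ofReal_le_ofReal (hM.trans ?_)
    have : M ≤ |τ + (k : ℝ) ^ 2| := by
      by_contra hn
      rw [not_le, abs_lt] at hn
      exact hτ ⟨by linarith, by linarith⟩
    rw [← sq_abs (τ + (k : ℝ) ^ 2)]
    gcongr
  have hlo : MemLp (J.indicator v) 2 := hv.indicator hJm
  have hhi : MemLp (Jᶜ.indicator v) 2 := hv.indicator hJm.compl
  have hlo1 : Integrable (J.indicator v) := by
    rw [integrable_indicator_iff hJm]
    have : IsFiniteMeasure (volume.restrict J) := ⟨by rw [Measure.restrict_apply_univ, hJv]; exact ENNReal.ofReal_lt_top⟩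
    exact (hv.restrict J).integrable (by norm_num)
  have hsum : invFt v hv = invFt (J.indicator v) hlo + invFt (Jᶜ.indicator v) hhi := by
    rw [← invFt_add]
    congr 1
    exact (indicator_self_add_compl J v).symm
  have b1 : ∀ᵐ t, ‖invFt (J.indicator v) hlo t‖ₑ ^ 2 ≤ A * ENNReal.ofReal (2 * M) := by
    filter_upwards [enorm_invFt_le hlo1 hlo] with t ht
    have c1 : ‖invFt (J.indicator v) hlo t‖ₑ ≤ ∫⁻ τ in J, ‖v τ‖ₑ * 1 := by
      refine (le_mul_of_one_le_left zero_le one_le_ofReal_two_pi).trans (ht.trans_eq ?_)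
      rw [← lintegral_indicator hJm]
      refine lintegral_congr fun τ => ?_
      by_cases h : τ ∈ J <;> simp [h]
    refine (pow_le_pow_left' c1 2).trans
      ((lintegral_mul_sq_le hv.1.enorm.restrict aemeasurable_const).trans ?_)
    simp only [mul_one, lintegral_const, one_mul, Measure.restrict_apply_univ, hJv]
    gcongr
    refine (setLIntegral_le_lintegral _ _).trans (lintegral_mono fun τ => ?_)
    exact le_mul_of_one_le_left zero_le (hw1 τ)
  have b2 : ∫⁻ t, ‖invFt (Jᶜ.indicator v) hhi t‖ₑ ^ 2 ≤ ENNReal.ofReal (ε / 4) * A := by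
    refine (lintegral_invFt_le hhi).trans ?_
    rw [hA, ← lintegral_const_mul' _ _ ENNReal.ofReal_ne_top]
    refine lintegral_mono fun τ => ?_
    by_cases h : τ ∈ J
    · simp [h]
    · rw [indicator_of_mem h, ← mul_assoc]
      refine le_mul_of_one_le_left zero_le ?_
      calc (1 : ℝ≥0∞) = ENNReal.ofReal (ε / 4) * ENNReal.ofReal (4 / ε) := by
            rw [← ENNReal.ofReal_mul (by positivity)]; field_simp; simp
        _ ≤ _ := by gcongr; exact hwJ τ h
  have hpt : ∀ᵐ t, ‖invFt v hv t‖ₑ ^ 2 ≤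
      2 * (A * ENNReal.ofReal (2 * M)) + 2 * ‖invFt (Jᶜ.indicator v) hhi t‖ₑ ^ 2 := by
    rw [hsum]
    filter_upwards [Lp.coeFn_add (invFt (J.indicator v) hlo) (invFt (Jᶜ.indicator v) hhi), b1]
      with t h1 h2
    rw [h1, Pi.add_apply]
    calc ‖invFt (J.indicator v) hlo t + invFt (Jᶜ.indicator v) hhi t‖ₑ ^ 2
        ≤ (‖invFt (J.indicator v) hlo t‖ₑ + ‖invFt (Jᶜ.indicator v) hhi t‖ₑ) ^ 2 := by
          gcongr; exact enorm_add_le _ _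
      _ ≤ 2 * (‖invFt (J.indicator v) hlo t‖ₑ ^ 2 + ‖invFt (Jᶜ.indicator v) hhi t‖ₑ ^ 2) := by
          have h2 := ENNReal.rpow_add_le_mul_rpow_add_rpow
            ‖invFt (J.indicator v) hlo t‖ₑ ‖invFt (Jᶜ.indicator v) hhi t‖ₑ (p := 2) (by norm_num)
          norm_num at h2
          exact h2
      _ ≤ _ := by rw [mul_add]; gcongr
  calc ∫⁻ t in S, ‖invFt v hv t‖ₑ ^ 2
      ≤ ∫⁻ t in S, (2 * (A * ENNReal.ofReal (2 * M)) +
        2 * ‖invFt (Jᶜ.indicator v) hhi t‖ₑ ^ 2) := lintegral_mono_ae (ae_restrict_of_ae hpt)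
    _ = 2 * (A * ENNReal.ofReal (2 * M)) * volume S +
        2 * ∫⁻ t in S, ‖invFt (Jᶜ.indicator v) hhi t‖ₑ ^ 2 := by
      rw [lintegral_add_left measurable_const, lintegral_const, Measure.restrict_apply_univ,
        lintegral_const_mul' _ _ (by norm_num)]
    _ ≤ 2 * (A * ENNReal.ofReal (2 * M)) * ENNReal.ofReal (ε / (8 * M)) +
        2 * (ENNReal.ofReal (ε / 4) * A) := by
      gcongr
      exact (setLIntegral_le_lintegral _ _).trans b2
    _ = ENNReal.ofReal ε * A := by
      have e1 : ENNReal.ofReal (2 * M) * ENNReal.ofReal (ε / (8 * M)) = ENNReal.ofReal (ε / 4) := by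
        rw [← ENNReal.ofReal_mul (by positivity)]; congr 1; field_simp; norm_num
      have e2 : 4 * ENNReal.ofReal (ε / 4) = ENNReal.ofReal ε := by
        rw [← ENNReal.ofReal_ofNat, ← ENNReal.ofReal_mul (by norm_num)]; congr 1; ring
      rw [← e2, mul_assoc 2, mul_assoc A, e1]
      ring

end Concentration

/-! ### Estimates independent of the steepness of the cutoff -/

section BoundaryLayer

open ComplexConjugate

theorem IsCutoff.contDiff_real {T : ℝ} {χ : ℝ → ℝ} (h : IsCutoff T fun t => (χ t : ℂ)) :
    ContDiff ℝ ∞ χ :=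
  Complex.reCLM.contDiff.comp h.1

theorem deriv_ofReal_comp {χ : ℝ → ℝ} (h : Differentiable ℝ χ) :
    deriv (fun t => (χ t : ℂ)) = fun t => ((deriv χ t : ℝ) : ℂ) :=
  funext fun t => (h t).hasDerivAt.ofReal_comp.deriv

theorem integrable_mul_of_cutoff {T : ℝ} {χ : ℝ → ℂ} (hχ : IsCutoff T χ) {a : ℝ → ℂ}
    (ha : MemLp a 2) : Integrable fun t => χ t * a t :=
  hχ.memLp.integrable_mul ha

theorem memLp_mul_of_cutoff {T : ℝ} {χ : ℝ → ℂ} (hχ : IsCutoff T χ) {a : ℝ → ℂ}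
    (ha : MemLp a 2) : MemLp (fun t => χ t * a t) 2 := by
  obtain ⟨C, hC⟩ := hχ.1.continuous.bounded_above_of_compact_support hχ.2.1
  exact memLp_bdd_mul hχ.1.continuous.aestronglyMeasurable hC ha

theorem ft_add_const_mul {h k : ℝ → ℂ} (hh : Integrable h) (hk : Integrable k) (c : ℂ) (τ : ℝ) :
    ft (fun t => h t + c * k t) τ = ft h τ + c * ft k τ := by
  have hi : ∀ {h : ℝ → ℂ}, Integrable h →
      Integrable fun t : ℝ => Complex.exp (-(Complex.I * τ * t)) * h t := fun hh => by
    refine hh.bdd_mul (c := 1) (by fun_prop) (ae_of_all _ fun t => ?_)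
    rw [Complex.norm_exp]
    simp
  rw [ft, ft, ft, ← integral_const_mul, ← integral_add (hi hh) ((hi hk).const_mul c)]
  refine integral_congr_ae (ae_of_all _ fun t => ?_)
  simp only
  ring

/-- Formally, this integrates the time derivative of `χ² G_k conj(G_l)`. It is carried out on the
Fourier side, where no regularity in time is needed: `H k = χ F_k + i χ' G_k` has transform `-(τ +
k²)` times that of `χ G_k`, and in the difference of the two pairings `τ` cancels and `l² - k²`
remains. -/
theorem mode_identity {T : ℝ} {u f : Distr T} (hsol : IsSolution u f) {v w : ℤ → ℝ → ℂ}
    (hv : IsExtension u v) (hw : IsExtension f w) (hv2 : ∀ k, MemLp (v k) 2)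
    (hw2 : ∀ k, MemLp (w k) 2) {χ : ℝ → ℝ} (hχ : IsCutoff T fun t => (χ t : ℂ)) (k l : ℤ) :
    (((l : ℝ) ^ 2 - (k : ℝ) ^ 2 : ℝ) : ℂ) *
        ∫ t, (χ t : ℂ) ^ 2 * (invFt (v k) (hv2 k) t * conj (invFt (v l) (hv2 l) t)) =
      (∫ t, (χ t : ℂ) ^ 2 * (invFt (w k) (hw2 k) t * conj (invFt (v l) (hv2 l) t))) -
      (∫ t, (χ t : ℂ) ^ 2 * (invFt (v k) (hv2 k) t * conj (invFt (w l) (hw2 l) t))) +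
      Complex.I * ∫ t, ((2 * χ t * deriv χ t : ℝ) : ℂ) *
        (invFt (v k) (hv2 k) t * conj (invFt (v l) (hv2 l) t)) := by
  have hd : Differentiable ℝ χ := hχ.contDiff_real.differentiable (by simp)
  have hχ' : IsCutoff T fun t => ((deriv χ t : ℝ) : ℂ) := by
    rw [← deriv_ofReal_comp hd]; exact hχ.deriv
  set G : ℤ → Lp ℂ 2 (volume : Measure ℝ) := fun k => invFt (v k) (hv2 k)
  set F : ℤ → Lp ℂ 2 (volume : Measure ℝ) := fun k => invFt (w k) (hw2 k)
  set a : ℤ → ℝ → ℂ := fun k t => (χ t : ℂ) * G k t with ha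
  set c : ℤ → ℝ → ℂ := fun k t => (χ t : ℂ) * F k t with hc
  set e : ℤ → ℝ → ℂ := fun k t => ((deriv χ t : ℝ) : ℂ) * G k t with he
  set H : ℤ → ℝ → ℂ := fun k t => c k t + Complex.I * e k t with hH
  have a1 : ∀ k, Integrable (a k) := fun k => integrable_mul_of_cutoff hχ (Lp.memLp _)
  have a2 : ∀ k, MemLp (a k) 2 := fun k => memLp_mul_of_cutoff hχ (Lp.memLp _)
  have c1 : ∀ k, Integrable (c k) := fun k => integrable_mul_of_cutoff hχ (Lp.memLp _)
  have c2 : ∀ k, MemLp (c k) 2 := fun k => memLp_mul_of_cutoff hχ (Lp.memLp _)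
  have e1 : ∀ k, Integrable (e k) := fun k => integrable_mul_of_cutoff hχ' (Lp.memLp _)
  have e2 : ∀ k, MemLp (e k) 2 := fun k => memLp_mul_of_cutoff hχ' (Lp.memLp _)
  have H1 : ∀ k, Integrable (H k) := fun k => (c1 k).add ((e1 k).const_mul _)
  have H2 : ∀ k, MemLp (H k) 2 := fun k => (c2 k).add ((e2 k).const_mul _)
  have hft : ∀ k τ, ft (H k) τ = -((τ + (k : ℝ) ^ 2 : ℝ) : ℂ) * ft (a k) τ := by
    intro k τ
    have h := hsol.conv_eq hv hw hχ k τ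
    rw [deriv_ofReal_comp hd, conv_eq_ft (hv2 k) hχ, conv_eq_ft (hw2 k) hχ,
      conv_eq_ft (hv2 k) hχ'] at h
    have hp : (2 * Real.pi : ℂ) ≠ 0 := by simp [Real.pi_ne_zero]
    rw [hH, ft_add_const_mul (c1 k) (e1 k)]
    apply mul_left_cancel₀ hp
    linear_combination -h
  have i1 := integral_ft_mul_conj_ft (H1 k) (H2 k) (a1 l) (a2 l)
  have i2 := integral_ft_mul_conj_ft (a1 k) (a2 k) (H1 l) (H2 l)
  have i0 := integral_ft_mul_conj_ft (a1 k) (a2 k) (a1 l) (a2 l)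
  have hmul : ∀ {p q : ℝ → ℂ}, MemLp p 2 → MemLp q 2 → Integrable fun t => p t * conj (q t) :=
    fun hp hq => hp.integrable_mul hq.star
  have hsub : (∫ τ, ft (H k) τ * conj (ft (a l) τ)) - ∫ τ, ft (a k) τ * conj (ft (H l) τ) =
      (((l : ℝ) ^ 2 - (k : ℝ) ^ 2 : ℝ) : ℂ) * ∫ τ, ft (a k) τ * conj (ft (a l) τ) := by
    rw [← integral_sub (hmul (memLp_ft (H1 k) (H2 k)) (memLp_ft (a1 l) (a2 l)))
      (hmul (memLp_ft (a1 k) (a2 k)) (memLp_ft (H1 l) (H2 l))), ← integral_const_mul]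
    refine integral_congr_ae (ae_of_all _ fun τ => ?_)
    simp only [hft, map_mul, map_neg, Complex.conj_ofReal]
    push_cast
    ring
  rw [i1, i2, i0, ← mul_sub, mul_left_comm] at hsub
  have hp : (2 * Real.pi : ℂ) ≠ 0 := by simp [Real.pi_ne_zero]
  have hsub := mul_left_cancel₀ hp hsub
  have j0 : ∫ t, a k t * conj (a l t) = ∫ t, (χ t : ℂ) ^ 2 * (G k t * conj (G l t)) := by
    refine integral_congr_ae (ae_of_all _ fun t => ?_)
    simp only [ha, map_mul, Complex.conj_ofReal]
    ring
  rw [j0] at hsub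
  rw [← hsub, ← integral_sub (hmul (H2 k) (a2 l)) (hmul (a2 k) (H2 l))]
  have n1 : Integrable fun t => (χ t : ℂ) ^ 2 * (F k t * conj (G l t)) :=
    (hmul (c2 k) (a2 l)).congr (ae_of_all _ fun t => by
      simp only [ha, hc, map_mul, Complex.conj_ofReal]; ring)
  have n2 : Integrable fun t => (χ t : ℂ) ^ 2 * (G k t * conj (F l t)) :=
    (hmul (a2 k) (c2 l)).congr (ae_of_all _ fun t => by
      simp only [ha, hc, map_mul, Complex.conj_ofReal]; ring)
  have n3 : Integrable fun t => ((2 * χ t * deriv χ t : ℝ) : ℂ) * (G k t * conj (G l t)) :=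
    ((hmul (e2 k) (a2 l)).const_mul 2).congr (ae_of_all _ fun t => by
      simp only [ha, he, map_mul, Complex.conj_ofReal]; push_cast; ring)
  have n12 : Integrable fun t => (χ t : ℂ) ^ 2 * (F k t * conj (G l t)) -
      (χ t : ℂ) ^ 2 * (G k t * conj (F l t)) := n1.sub n2
  rw [← integral_sub n1 n2, ← integral_const_mul, ← integral_add n12 (n3.const_mul _)]
  refine integral_congr_ae (ae_of_all _ fun t => ?_)
  simp only [ha, hH, hc, he, map_mul, map_add, Complex.conj_ofReal, Complex.conj_I]
  push_cast
  ring

theorem norm_integral_mul_conj_le {S : Set ℝ} (hS : MeasurableSet S) {A B : ℝ → ℂ}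
    (hA : MemLp A 2) (hB : MemLp B 2) {h : ℝ → ℂ} {c η : ℝ} (hc : 0 ≤ c) (hη : 0 < η)
    (hh : ∀ t ∈ S, ‖h t‖ ≤ c) (h0 : ∀ t ∉ S, h t = 0) :
    ‖∫ t, h t * (A t * conj (B t))‖ ≤
      c * (η / 2 * (∫ t in S, ‖A t‖ ^ 2) + η⁻¹ / 2 * ∫ t in S, ‖B t‖ ^ 2) := by
  have iA := ((memLp_two_iff_integrable_sq_norm hA.1).1 hA).integrableOn (s := S)
  have iB := ((memLp_two_iff_integrable_sq_norm hB.1).1 hB).integrableOn (s := S)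
  have e : ∫ t, h t * (A t * conj (B t)) = ∫ t in S, h t * (A t * conj (B t)) :=
    (setIntegral_eq_integral_of_forall_compl_eq_zero fun t ht => by rw [h0 t ht, zero_mul]).symm
  rw [e, ← integral_const_mul, ← integral_const_mul, ← integral_add (iA.const_mul _)
    (iB.const_mul _), ← integral_const_mul]
  refine norm_integral_le_of_norm_le (((iA.const_mul _).add (iB.const_mul _)).const_mul _) ?_
  refine (ae_restrict_mem hS).mono fun t ht => ?_
  rw [norm_mul, norm_mul, RCLike.norm_conj]
  refine mul_le_mul (hh t ht) ?_ (by positivity) hc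
  have : η / 2 * ‖A t‖ ^ 2 + η⁻¹ / 2 * ‖B t‖ ^ 2 - ‖A t‖ * ‖B t‖ =
      η / 2 * (‖A t‖ - η⁻¹ * ‖B t‖) ^ 2 := by field_simp; ring
  nlinarith [mul_nonneg hη.le (sq_nonneg (‖A t‖ - η⁻¹ * ‖B t‖))]

/-- A cutoff `αγ` such that `α` is monotone, while the derivative of `γ` is at most `M`. -/
structure IsLayerCutoff (T M : ℝ) (α γ : ℝ → ℝ) : Prop where
  contDiff_left : ContDiff ℝ ∞ α
  contDiff_right : ContDiff ℝ ∞ γ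
  left_mem : ∀ t, α t ∈ Icc (0 : ℝ) 1
  right_mem : ∀ t, γ t ∈ Icc (0 : ℝ) 1
  isCutoff : IsCutoff T fun t => ((α t * γ t : ℝ) : ℂ)
  sign : ∃ s : ℝ, |s| = 1 ∧ ∀ t, 0 ≤ s * deriv α t
  deriv_le : ∀ t ∈ Ioo 0 T, |deriv γ t| ≤ M

theorem integrable_continuous_mul_sq {T : ℝ} {χ φ : ℝ → ℝ} (hχ : IsCutoff T fun t => (χ t : ℂ))
    (hφ : Continuous φ) {A : ℝ → ℂ} (hA : MemLp A 2) :
    Integrable fun t => χ t * φ t * ‖A t‖ ^ 2 := by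
  have hs : HasCompactSupport χ := hχ.2.1.comp_left (g := Complex.re) Complex.zero_re
  obtain ⟨C, hC⟩ := (hχ.contDiff_real.continuous.mul hφ).bounded_above_of_compact_support
    hs.mul_right
  exact ((memLp_two_iff_integrable_sq_norm hA.1).1 hA).bdd_mul (c := C)
    (hχ.contDiff_real.continuous.mul hφ).aestronglyMeasurable (ae_of_all _ hC)

/-- In `(αγ)' = α'γ + αγ'` the steep term has a constant sign, so its absolute integral is a signed
one. The mild term costs at most `2M` times the mass, and it is paid twice: once in passing to the
signed integral of `α'γ`, once in returning to the full derivative. -/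
theorem IsLayerCutoff.integral_layer_le {T M : ℝ} {α γ : ℝ → ℝ} (h : IsLayerCutoff T M α γ)
    {A : ℝ → ℂ} (hA : MemLp A 2) :
    ∫ t, 2 * (α t * γ t) * |deriv (fun t => α t * γ t) t| * ‖A t‖ ^ 2 ≤
      |∫ t, 2 * (α t * γ t) * deriv (fun t => α t * γ t) t * ‖A t‖ ^ 2| +
        4 * M * ∫ t in Ioo 0 T, ‖A t‖ ^ 2 := by
  set χ : ℝ → ℝ := fun t => α t * γ t with hχ
  have hcut : IsCutoff T fun t => (χ t : ℂ) := h.isCutoff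
  have cα' : Continuous (deriv α) := h.contDiff_left.continuous_deriv (by simp)
  have cγ' : Continuous (deriv γ) := h.contDiff_right.continuous_deriv (by simp)
  have cχ' : Continuous (deriv χ) := hcut.contDiff_real.continuous_deriv (by simp)
  have hder : ∀ t, deriv χ t = deriv α t * γ t + α t * deriv γ t := fun t =>
    (((h.contDiff_left.differentiable (by simp)) t).hasDerivAt.mul
      ((h.contDiff_right.differentiable (by simp)) t).hasDerivAt).deriv
  have hχ0 : ∀ t, 0 ≤ χ t := fun t => mul_nonneg (h.left_mem t).1 (h.right_mem t).1
  have hχ1 : ∀ t, χ t ≤ 1 := fun t => mul_le_one₀ (h.left_mem t).2 (h.right_mem t).1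
    (h.right_mem t).2
  have hχS : ∀ t ∉ Ioo 0 T, χ t = 0 := fun t ht => by
    by_contra hne
    exact ht (hcut.2.2 (subset_tsupport _ (Complex.ofReal_ne_zero.2 hne)))
  obtain ⟨s, hs1, hs⟩ := h.sign
  have iA := (memLp_two_iff_integrable_sq_norm hA.1).1 hA
  have i0 : Integrable fun t => 2 * χ t * deriv χ t * ‖A t‖ ^ 2 :=
    ((integrable_continuous_mul_sq hcut cχ' hA).const_mul 2).congr
      (ae_of_all _ fun t => by simp only; ring)
  have i0' : Integrable fun t => 2 * χ t * |deriv χ t| * ‖A t‖ ^ 2 :=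
    ((integrable_continuous_mul_sq hcut cχ'.abs hA).const_mul 2).congr
      (ae_of_all _ fun t => by simp only; ring)
  have i1 : Integrable fun t => 2 * χ t * (s * deriv α t * γ t) * ‖A t‖ ^ 2 :=
    ((integrable_continuous_mul_sq hcut ((cα'.const_mul s).mul h.contDiff_right.continuous)
      hA).const_mul 2).congr (ae_of_all _ fun t => by simp only [Pi.mul_apply]; ring)
  have i2 : Integrable fun t => 2 * χ t * |α t * deriv γ t| * ‖A t‖ ^ 2 :=
    ((integrable_continuous_mul_sq hcut (h.contDiff_left.continuous.mul cγ').abs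
      hA).const_mul 2).congr (ae_of_all _ fun t => by simp only [Pi.mul_apply]; ring)
  have i2' : Integrable fun t => 2 * χ t * (α t * deriv γ t) * ‖A t‖ ^ 2 :=
    ((integrable_continuous_mul_sq hcut (h.contDiff_left.continuous.mul cγ')
      hA).const_mul 2).congr (ae_of_all _ fun t => by simp only [Pi.mul_apply]; ring)
  have hE : ∫ t, 2 * χ t * |α t * deriv γ t| * ‖A t‖ ^ 2 ≤
      2 * M * ∫ t in Ioo 0 T, ‖A t‖ ^ 2 := by
    rw [← integral_const_mul, ← setIntegral_eq_integral_of_forall_compl_eq_zero (s := Ioo 0 T)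
      fun t ht => by rw [hχS t ht]; ring]
    refine setIntegral_mono_on i2.integrableOn (iA.integrableOn.const_mul _) measurableSet_Ioo
      fun t ht => ?_
    have h1 := h.deriv_le t ht
    refine mul_le_mul_of_nonneg_right ?_ (by positivity)
    rw [abs_mul, abs_of_nonneg (h.left_mem t).1]
    have h2 : α t * |deriv γ t| ≤ M :=
      (mul_le_of_le_one_left (abs_nonneg _) (h.left_mem t).2).trans h1
    have h3 : χ t * (α t * |deriv γ t|) ≤ 1 * M :=
      mul_le_mul (hχ1 t) h2 (mul_nonneg (h.left_mem t).1 (abs_nonneg _)) zero_le_one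
    linarith
  have hP : ∫ t, 2 * χ t * (s * deriv α t * γ t) * ‖A t‖ ^ 2 ≤
      |∫ t, 2 * χ t * deriv χ t * ‖A t‖ ^ 2| + ∫ t, 2 * χ t * |α t * deriv γ t| * ‖A t‖ ^ 2 := by
    have e : ∫ t, 2 * χ t * (s * deriv α t * γ t) * ‖A t‖ ^ 2 =
        s * ((∫ t, 2 * χ t * deriv χ t * ‖A t‖ ^ 2) -
          ∫ t, 2 * χ t * (α t * deriv γ t) * ‖A t‖ ^ 2) := by
      rw [← integral_sub i0 i2', ← integral_const_mul]
      refine integral_congr_ae (ae_of_all _ fun t => ?_)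
      simp only [hder]
      ring
    rw [e]
    refine (le_abs_self _).trans ?_
    rw [abs_mul, hs1, one_mul]
    refine (abs_sub _ _).trans (add_le_add le_rfl ?_)
    refine abs_integral_le_integral_abs.trans_eq (integral_congr_ae (ae_of_all _ fun t => ?_))
    simp only [abs_mul, abs_pow, abs_norm, abs_two, abs_of_nonneg (hχ0 t)]
  have hA' : ∫ t, 2 * χ t * |deriv χ t| * ‖A t‖ ^ 2 ≤
      (∫ t, 2 * χ t * (s * deriv α t * γ t) * ‖A t‖ ^ 2) +
        ∫ t, 2 * χ t * |α t * deriv γ t| * ‖A t‖ ^ 2 := by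
    rw [← integral_add i1 i2]
    refine integral_mono i0' (i1.add i2) fun t => ?_
    have h1 : |deriv α t * γ t| = s * deriv α t * γ t := by
      rw [abs_mul, abs_of_nonneg (h.right_mem t).1, ← abs_of_nonneg (hs t), abs_mul, hs1, one_mul]
    have h2 : |deriv χ t| ≤ s * deriv α t * γ t + |α t * deriv γ t| := by
      rw [hder, ← h1]; exact abs_add_le _ _
    have h3 : 0 ≤ 2 * χ t * ‖A t‖ ^ 2 := by
      have := hχ0 t; positivity
    beta_reduce
    nlinarith [mul_le_mul_of_nonneg_left h2 h3]
  linarith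

/-- The algebra behind the estimate of one interaction of modes: `E` is the size of the
resonance, `p`, `r` are the squares of the norms of the modes of `u`, `f`. -/
theorem interaction_le {E Q M c ε κ κ' p p' r r' : ℝ} (hE : 1 ≤ E) (hM : 0 ≤ M)
    (hε : 0 < ε) (hκ : 1 ≤ κ) (hκ' : 1 ≤ κ') (hκE : κ ≤ c * E) (hκE' : κ' ≤ c * E)
    (hp : 0 ≤ p) (hp' : 0 ≤ p') (hr : 0 ≤ r) (hr' : 0 ≤ r')
    (h : E * Q ≤ (ε * κ)⁻¹ * r + (ε * κ')⁻¹ * r' + (ε * κ + ε * κ') / 2 * (p + p') +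
      (2 * M + 1 / 2) * (p + p')) :
    Q ≤ c * (2 + 2 * M) * (ε * (p + p') +
      ε⁻¹ * ((κ ^ 2)⁻¹ * (r + p) + (κ' ^ 2)⁻¹ * (r' + p'))) := by
  have hE0 : 0 < E := by linarith
  have hc : 0 < c := by
    by_contra hn
    nlinarith [mul_nonneg (neg_nonneg.2 (not_lt.1 hn)) hE0.le]
  -- One power of `κ` is paid for by the resonance `E`, which turns `κ⁻¹` into the weight `κ⁻²` of
  -- `X^{-1,0}`.
  have t1 : ∀ {κ r : ℝ}, 1 ≤ κ → κ ≤ c * E → 0 ≤ r →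
      (ε * κ)⁻¹ * r ≤ E * (c * (ε⁻¹ * ((κ ^ 2)⁻¹ * r))) := by
    intro κ r h1 h2 h3
    have : (ε * κ)⁻¹ * r = κ * (ε⁻¹ * ((κ ^ 2)⁻¹ * r)) := by field_simp
    rw [this]
    calc κ * (ε⁻¹ * ((κ ^ 2)⁻¹ * r)) ≤ (c * E) * (ε⁻¹ * ((κ ^ 2)⁻¹ * r)) := by gcongr
      _ = _ := by ring
  -- After division by `E`, the term without weight is of size `κ⁻¹p`, the geometric mean of `εp`
  -- and `ε⁻¹κ⁻²p`.
  have t2 : ∀ {κ p : ℝ}, 1 ≤ κ → κ ≤ c * E → 0 ≤ p →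
      p ≤ E * (c * (ε * p + ε⁻¹ * ((κ ^ 2)⁻¹ * p)) / 2) := by
    intro κ p h1 h2 h3
    have e : ε * p + ε⁻¹ * ((κ ^ 2)⁻¹ * p) - 2 * (κ⁻¹ * p) = ε * p * (1 - (ε * κ)⁻¹) ^ 2 := by
      field_simp; ring
    have e2 : 2 * (κ⁻¹ * p) ≤ ε * p + ε⁻¹ * ((κ ^ 2)⁻¹ * p) := by
      have : 0 ≤ ε * p * (1 - (ε * κ)⁻¹) ^ 2 := by positivity
      linarith
    calc p = κ * (κ⁻¹ * p) := by field_simp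
      _ ≤ (c * E) * ((ε * p + ε⁻¹ * ((κ ^ 2)⁻¹ * p)) / 2) := by
        gcongr
        linarith
      _ = _ := by ring
  have t3 : (ε * κ + ε * κ') / 2 * (p + p') ≤ E * (c * (ε * (p + p'))) := by
    calc (ε * κ + ε * κ') / 2 * (p + p') ≤ (ε * (c * E) + ε * (c * E)) / 2 * (p + p') := by gcongr
      _ = _ := by ring
  have a1 := t1 hκ hκE hr
  have a2 := t1 hκ' hκE' hr'
  have a3 := t2 hκ hκE hp
  have a4 := t2 hκ' hκE' hp'
  set X := ε * p + ε⁻¹ * ((κ ^ 2)⁻¹ * p) with hX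
  set Y := ε * p' + ε⁻¹ * ((κ' ^ 2)⁻¹ * p') with hY
  set R := ε⁻¹ * ((κ ^ 2)⁻¹ * r) with hR
  set R' := ε⁻¹ * ((κ' ^ 2)⁻¹ * r') with hR'
  have hX0 : 0 ≤ X := by positivity
  have hY0 : 0 ≤ Y := by positivity
  have hR0 : 0 ≤ R := by positivity
  have hR0' : 0 ≤ R' := by positivity
  have hXp : ε * p ≤ X := by rw [hX]; have : 0 ≤ ε⁻¹ * ((κ ^ 2)⁻¹ * p) := by positivity
                             linarith
  have hYp : ε * p' ≤ Y := by rw [hY]; have : 0 ≤ ε⁻¹ * ((κ' ^ 2)⁻¹ * p') := by positivity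
                              linarith
  have a5 : (2 * M + 1 / 2) * (p + p') ≤ (2 * M + 1 / 2) * (E * (c * (X + Y) / 2)) := by
    gcongr
    linarith
  have a6 : E * Q ≤ E * (c * (2 + 2 * M) * (X + Y + R + R')) := by
    have b1 : E * (c * (ε * (p + p'))) ≤ E * (c * (X + Y)) := by gcongr; linarith
    have b2 : 0 ≤ E * (c * (R + R')) := by positivity
    have b3 : 0 ≤ E * (c * (X + Y)) := by positivity
    nlinarith [mul_nonneg hM b2, mul_nonneg hM b3]
  have a7 := le_of_mul_le_mul_left a6 hE0
  refine a7.trans_eq ?_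
  rw [hX, hY, hR, hR']
  ring

end BoundaryLayer

/-! ### Summation of the interactions for `b = 0` -/

section LayerSum

open ComplexConjugate

/-- At `τ = 0` the localized mode is `2π ∫ χ G_k`, which does not depend on the extension; letting
`χ` vary determines `G_k` on `]0,T[`. -/
theorem IsExtension.invFt_ae_eq {T : ℝ} {u : Distr T} {v v' : ℤ → ℝ → ℂ} (hv : IsExtension u v)
    (hv' : IsExtension u v') {k : ℤ} (h : MemLp (v k) 2) (h' : MemLp (v' k) 2) :
    ∀ᵐ t, t ∈ Ioo 0 T → invFt (v k) h t = invFt (v' k) h' t := by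
  have hloc : LocallyIntegrableOn (fun t => invFt (v k) h t - invFt (v' k) h' t) (Ioo 0 T) :=
    (((Lp.memLp (invFt (v k) h)).locallyIntegrable (by norm_num)).sub
      ((Lp.memLp (invFt (v' k) h')).locallyIntegrable (by norm_num))).locallyIntegrableOn _
  refine (isOpen_Ioo.ae_eq_zero_of_integral_contDiff_smul_eq_zero hloc fun φ h1 h2 h3 => ?_).mono
    fun t ht hm => sub_eq_zero.1 (ht hm)
  have hχ : IsCutoff T fun t => (φ t : ℂ) :=
    ⟨Complex.ofRealCLM.contDiff.comp h1, h2.comp_left (g := Complex.ofReal) Complex.ofReal_zero,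
      (tsupport_comp_subset (g := Complex.ofReal) Complex.ofReal_zero φ).trans h3⟩
  have e := congrFun (congrFun (hv.conv_eq_conv hv' hχ) k) 0
  rw [conv_eq_ft h hχ, conv_eq_ft h' hχ] at e
  have hp : (2 * Real.pi : ℂ) ≠ 0 := by simp [Real.pi_ne_zero]
  have e := mul_left_cancel₀ hp e
  simp only [ft, Complex.ofReal_zero, mul_zero, zero_mul, neg_zero, Complex.exp_zero, one_mul] at e
  rw [← sub_eq_zero, ← integral_sub (integrable_mul_of_cutoff hχ (Lp.memLp _))
    (integrable_mul_of_cutoff hχ (Lp.memLp _))] at e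
  rw [← e]
  refine integral_congr_ae (ae_of_all _ fun t => ?_)
  simp only [Complex.real_smul]
  ring

/-- The mass of a mode on `]0,T[`. -/
noncomputable def mass (T : ℝ) (A : ℝ → ℂ) : ℝ := ∫ t in Ioo 0 T, ‖A t‖ ^ 2

theorem mass_nonneg (T : ℝ) (A : ℝ → ℂ) : 0 ≤ mass T A := integral_nonneg fun _ => by positivity

theorem ofReal_mass {T : ℝ} {A : ℝ → ℂ} (hA : MemLp A 2) :
    ENNReal.ofReal (mass T A) = ∫⁻ t in Ioo 0 T, ‖A t‖ₑ ^ 2 :=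
  (lintegral_enorm_sq_eq_ofReal (hA.restrict _)).symm

variable {T M : ℝ} {α γ : ℝ → ℝ}

theorem IsLayerCutoff.nonneg (h : IsLayerCutoff T M α γ) (t : ℝ) : 0 ≤ α t * γ t :=
  mul_nonneg (h.left_mem t).1 (h.right_mem t).1

theorem IsLayerCutoff.le_one (h : IsLayerCutoff T M α γ) (t : ℝ) : α t * γ t ≤ 1 :=
  mul_le_one₀ (h.left_mem t).2 (h.right_mem t).1 (h.right_mem t).2

theorem IsLayerCutoff.eq_zero (h : IsLayerCutoff T M α γ) {t : ℝ} (ht : t ∉ Ioo 0 T) :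
    α t * γ t = 0 := by
  by_contra hne
  exact ht (h.isCutoff.2.2 (subset_tsupport _ (Complex.ofReal_ne_zero.2 hne)))

theorem IsLayerCutoff.norm_integral_sq_le (h : IsLayerCutoff T M α γ) {A B : ℝ → ℂ}
    (hA : MemLp A 2) (hB : MemLp B 2) {η : ℝ} (hη : 0 < η) :
    ‖∫ t, ((α t * γ t : ℝ) : ℂ) ^ 2 * (A t * conj (B t))‖ ≤
      η / 2 * mass T A + η⁻¹ / 2 * mass T B := by
  have := norm_integral_mul_conj_le (S := Ioo 0 T) measurableSet_Ioo hA hB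
    (h := fun t => ((α t * γ t : ℝ) : ℂ) ^ 2) zero_le_one hη (fun t _ => ?_) fun t ht => ?_
  · rwa [one_mul] at this
  · rw [norm_pow, Complex.norm_real, Real.norm_of_nonneg (h.nonneg t)]
    exact pow_le_one₀ (h.nonneg t) (h.le_one t)
  · rw [h.eq_zero ht]; simp

/-- The mass of a mode in the layer where the cutoff varies. -/
noncomputable def layerMass (χ : ℝ → ℝ) (A : ℝ → ℂ) : ℝ :=
  ∫ t, 2 * χ t * |deriv χ t| * ‖A t‖ ^ 2

theorem IsLayerCutoff.norm_integral_deriv_le (h : IsLayerCutoff T M α γ) {A B : ℝ → ℂ}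
    (hA : MemLp A 2) (hB : MemLp B 2) :
    ‖∫ t, ((2 * (α t * γ t) * deriv (fun t => α t * γ t) t : ℝ) : ℂ) * (A t * conj (B t))‖ ≤
      (layerMass (fun t => α t * γ t) A + layerMass (fun t => α t * γ t) B) / 2 := by
  have c' : Continuous (deriv fun t => α t * γ t) :=
    h.isCutoff.contDiff_real.continuous_deriv (by simp)
  have i : ∀ {A : ℝ → ℂ}, MemLp A 2 →
      Integrable fun t => 2 * (α t * γ t) * |deriv (fun t => α t * γ t) t| * ‖A t‖ ^ 2 :=
    fun hA => ((integrable_continuous_mul_sq h.isCutoff c'.abs hA).const_mul 2).congr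
      (ae_of_all _ fun t => by simp only; ring)
  rw [layerMass, layerMass, ← integral_add (i hA) (i hB), ← integral_div]
  refine norm_integral_le_of_norm_le (((i hA).add (i hB)).div_const _) (ae_of_all _ fun t => ?_)
  have h0 := h.nonneg t
  rw [norm_mul, norm_mul, RCLike.norm_conj, Complex.norm_real, Real.norm_eq_abs, abs_mul, abs_mul,
    abs_two, abs_of_nonneg h0]
  have h1 : 0 ≤ 2 * (α t * γ t) * |deriv (fun t => α t * γ t) t| := by positivity
  nlinarith [mul_nonneg h1 (sq_nonneg (‖A t‖ - ‖B t‖))]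

variable {u f : Distr T} {v w : ℤ → ℝ → ℂ}

/-- On the diagonal `k = l` of `mode_identity` the factor `l² - k²` vanishes, so the signed layer
integral is expressed by the source alone, however steep the cutoff is. -/
theorem IsLayerCutoff.layerMass_le (h : IsLayerCutoff T M α γ) (hsol : IsSolution u f)
    (hv : IsExtension u v) (hw : IsExtension f w) (hv2 : ∀ k, MemLp (v k) 2)
    (hw2 : ∀ k, MemLp (w k) 2) {η : ℝ} (hη : 0 < η) (k : ℤ) :
    layerMass (fun t => α t * γ t) (invFt (v k) (hv2 k)) ≤
      η * mass T (invFt (w k) (hw2 k)) + η⁻¹ * mass T (invFt (v k) (hv2 k)) +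
        4 * M * mass T (invFt (v k) (hv2 k)) := by
  refine (h.integral_layer_le (Lp.memLp _)).trans (add_le_add ?_ le_rfl)
  have e := mode_identity hsol hv hw hv2 hw2 h.isCutoff k k
  set G := invFt (v k) (hv2 k)
  set F := invFt (w k) (hw2 k)
  rw [sub_self, Complex.ofReal_zero, zero_mul] at e
  have e1 : ∫ t, ((2 * (α t * γ t) * deriv (fun t => α t * γ t) t : ℝ) : ℂ) * (G t * conj (G t)) =
      ((∫ t, 2 * (α t * γ t) * deriv (fun t => α t * γ t) t * ‖G t‖ ^ 2 : ℝ) : ℂ) := by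
    rw [← integral_complex_ofReal]
    refine integral_congr_ae (ae_of_all _ fun t => ?_)
    simp only [Complex.mul_conj']
    push_cast
    ring
  rw [e1] at e
  have e2 := norm_sub_le
    (∫ t, ((α t * γ t : ℝ) : ℂ) ^ 2 * (F t * conj (G t)))
    (∫ t, ((α t * γ t : ℝ) : ℂ) ^ 2 * (G t * conj (F t)))
  rw [eq_neg_of_add_eq_zero_left e.symm, norm_neg, norm_mul, Complex.norm_I, one_mul,
    Complex.norm_real, Real.norm_eq_abs] at e2
  have e3 := h.norm_integral_sq_le (Lp.memLp F) (Lp.memLp G) hη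
  have e4 := h.norm_integral_sq_le (Lp.memLp G) (Lp.memLp F) (inv_pos.2 hη)
  rw [inv_inv] at e4
  linarith

/-- The parameter `η = (εκ)⁻¹` in Young's inequality gives the source the factor `(εκ)⁻¹` and the
solution `εκ`. Division by the resonance, at least of order `κ`, leaves `ε⁻¹κ⁻²`, the weight of
`X^{-1,0}`, and `ε`. -/
theorem IsLayerCutoff.norm_integral_modes_le (h : IsLayerCutoff T M α γ) (hM : 0 ≤ M) {j : ℤ}
    (hj : j ≠ 0) {ε : ℝ} (hε : 0 < ε) (hsol : IsSolution u f)
    (hv : IsExtension u v) (hw : IsExtension f w) (hv2 : ∀ k, MemLp (v k) 2)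
    (hw2 : ∀ k, MemLp (w k) 2) (k : ℤ) :
    ‖∫ t, ((α t * γ t : ℝ) : ℂ) ^ 2 *
        (invFt (v k) (hv2 k) t * conj (invFt (v (k + j)) (hv2 (k + j)) t))‖ ≤
      (1 + |(j : ℝ)|) * (2 + 2 * M) *
        (ε * (mass T (invFt (v k) (hv2 k)) + mass T (invFt (v (k + j)) (hv2 (k + j)))) +
          ε⁻¹ * ((kw k ^ 2)⁻¹ *
              (mass T (invFt (w k) (hw2 k)) + mass T (invFt (v k) (hv2 k))) +
            (kw (k + j) ^ 2)⁻¹ * (mass T (invFt (w (k + j)) (hw2 (k + j))) +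
              mass T (invFt (v (k + j)) (hv2 (k + j)))))) := by
  have k1 := one_le_kw k
  have k2 := one_le_kw (k + j)
  have η1 : 0 < (ε * kw k)⁻¹ := by positivity
  have η2 : 0 < (ε * kw (k + j))⁻¹ := by positivity
  refine interaction_le (E := 1 + |(j : ℝ) * (2 * k + j)|) (by linarith [abs_nonneg ((j : ℝ) * (2 * k + j))])
    hM hε k1 k2 (kw_le hj k) (kw_add_le hj k) (mass_nonneg _ _) (mass_nonneg _ _)
    (mass_nonneg _ _) (mass_nonneg _ _) ?_
  have e := mode_identity hsol hv hw hv2 hw2 h.isCutoff k (k + j)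
  have l1 := h.layerMass_le hsol hv hw hv2 hw2 η1 k
  have l2 := h.layerMass_le hsol hv hw hv2 hw2 η2 (k + j)
  set G := invFt (v k) (hv2 k)
  set F := invFt (w k) (hw2 k)
  set G' := invFt (v (k + j)) (hv2 (k + j))
  set F' := invFt (w (k + j)) (hw2 (k + j))
  have hD : (((k + j : ℤ) : ℝ) ^ 2 - (k : ℝ) ^ 2) = j * (2 * k + j) := by push_cast; ring
  have b0 := h.norm_integral_sq_le (Lp.memLp G) (Lp.memLp G') one_pos
  have b1 := h.norm_integral_sq_le (Lp.memLp F) (Lp.memLp G') η1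
  have b2 := h.norm_integral_sq_le (Lp.memLp G) (Lp.memLp F') (inv_pos.2 η2)
  have b3 := h.norm_integral_deriv_le (Lp.memLp G) (Lp.memLp G')
  have n := congrArg norm e
  rw [hD, norm_mul, Complex.norm_real, Real.norm_eq_abs] at n
  have n2 := n.le.trans ((norm_add_le _ _).trans (add_le_add (norm_sub_le _ _) le_rfl))
  rw [norm_mul, Complex.norm_I, one_mul] at n2
  rw [inv_inv] at b1 b2 l1 l2
  rw [add_mul, one_mul]
  rw [inv_one] at b0
  linarith

/-- The cutoff enters only through `M`, hence the bound holds uniformly along a sequence of steeper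
and steeper cutoffs. -/
theorem IsLayerCutoff.tsum_modes_le (h : IsLayerCutoff T M α γ) (hM : 0 ≤ M) {j : ℤ}
    (hj : j ≠ 0) {ε : ℝ} (hε : 0 < ε) (hsol : IsSolution u f) {v' : ℤ → ℝ → ℂ}
    (hv : IsExtension u v) (hv' : IsExtension u v') (hw : IsExtension f w)
    (hv2 : ∀ k, MemLp (v k) 2) (hv2' : ∀ k, MemLp (v' k) 2) (hw2 : ∀ k, MemLp (w k) 2) :
    ∑' k, ‖∫ t, ((α t * γ t : ℝ) : ℂ) ^ 2 *
        (invFt (v k) (hv2 k) t * conj (invFt (v (k + j)) (hv2 (k + j)) t))‖ₑ ≤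
      ENNReal.ofReal ((1 + |(j : ℝ)|) * (2 + 2 * M)) *
        (ENNReal.ofReal ε * (2 * xSq 0 0 v) +
          ENNReal.ofReal ε⁻¹ * (2 * (xSq (-1) 0 w + xSq (-1) 0 v'))) := by
  set X : ℤ → ℝ≥0∞ := fun k => ∫⁻ τ, ‖v k τ‖ₑ ^ 2 with hX
  set Y : ℤ → ℝ≥0∞ := fun k => ENNReal.ofReal ((kw k ^ 2)⁻¹) *
    ((∫⁻ τ, ‖w k τ‖ₑ ^ 2) + ∫⁻ τ, ‖v' k τ‖ₑ ^ 2) with hY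
  have hm : ∀ {v : ℝ → ℂ} (hv : MemLp v 2),
      ENNReal.ofReal (mass T (invFt v hv)) ≤ ∫⁻ τ, ‖v τ‖ₑ ^ 2 := fun hv => by
    rw [ofReal_mass (Lp.memLp _)]
    exact (setLIntegral_le_lintegral _ _).trans (lintegral_invFt_le hv)
  -- Masses on `]0,T[` do not depend on the extension, so the terms with the factor `ε⁻¹` are
  -- measured with the small extension `v'`.
  have hm' : ∀ k, mass T (invFt (v k) (hv2 k)) = mass T (invFt (v' k) (hv2' k)) := fun k =>
    setIntegral_congr_ae measurableSet_Ioo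
      ((hv.invFt_ae_eq hv' (hv2 k) (hv2' k)).mono fun t ht hm => by rw [ht hm])
  have hYk : ∀ k, ENNReal.ofReal ((kw k ^ 2)⁻¹ *
      (mass T (invFt (w k) (hw2 k)) + mass T (invFt (v k) (hv2 k)))) ≤ Y k := fun k => by
    have := one_le_kw k
    rw [ENNReal.ofReal_mul (by positivity), ENNReal.ofReal_add (mass_nonneg _ _) (mass_nonneg _ _),
      hm' k]
    exact mul_le_mul' le_rfl (add_le_add (hm _) (hm _))
  have hterm : ∀ k, ‖∫ t, ((α t * γ t : ℝ) : ℂ) ^ 2 *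
        (invFt (v k) (hv2 k) t * conj (invFt (v (k + j)) (hv2 (k + j)) t))‖ₑ ≤
      ENNReal.ofReal ((1 + |(j : ℝ)|) * (2 + 2 * M)) *
        (ENNReal.ofReal ε * (X k + X (k + j)) + ENNReal.ofReal ε⁻¹ * (Y k + Y (k + j))) := by
    intro k
    rw [← ofReal_norm]
    refine (ENNReal.ofReal_le_ofReal
      (h.norm_integral_modes_le hM hj hε hsol hv hw hv2 hw2 k)).trans ?_
    rw [ENNReal.ofReal_mul (by positivity)]
    refine mul_le_mul' le_rfl (ENNReal.ofReal_add_le.trans ?_)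
    rw [ENNReal.ofReal_mul hε.le, ENNReal.ofReal_mul (inv_pos.2 hε).le]
    refine add_le_add (mul_le_mul' le_rfl (ENNReal.ofReal_add_le.trans ?_))
      (mul_le_mul' le_rfl (ENNReal.ofReal_add_le.trans ?_))
    · exact add_le_add (hm _) (hm _)
    · exact add_le_add (hYk _) (hYk _)
  have sh : ∀ Z : ℤ → ℝ≥0∞, ∑' k, Z (k + j) = ∑' k, Z k := fun Z =>
    (Equiv.addRight j).tsum_eq Z
  have hXs : ∑' k, X k ≤ xSq 0 0 v := tsum_lintegral_le_xSq le_rfl v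
  have hYs : ∑' k, Y k = xSq (-1) 0 w + xSq (-1) 0 v' := by
    rw [xSq_eq, xSq_eq, ← ENNReal.tsum_add]
    refine tsum_congr fun k => ?_
    have : kw k ^ (2 * (-1) : ℝ) = (kw k ^ 2)⁻¹ := by
      rw [mul_neg_one, Real.rpow_neg (zero_le_one.trans (one_le_kw k)), Real.rpow_two]
    simp only [this, hY, mul_add, Real.rpow_zero, ENNReal.ofReal_one, one_mul]
  refine (ENNReal.tsum_le_tsum hterm).trans ?_
  rw [ENNReal.tsum_mul_left, ENNReal.tsum_add, ENNReal.tsum_mul_left, ENNReal.tsum_mul_left,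
    ENNReal.tsum_add, ENNReal.tsum_add, sh, sh, ← two_mul, ← two_mul, hYs]
  gcongr

end LayerSum

/-! ### Choice of extensions and of cutoffs -/

section Conclusion

open ComplexConjugate

theorem tendsto_zero_of_forall_le {x : ℕ → ℝ≥0∞} {A : ℝ≥0∞} (hA : A ≠ ⊤)
    (h : ∀ ε : ℝ, 0 < ε → ∃ y : ℕ → ℝ≥0∞, Tendsto y atTop (𝓝 0) ∧
      ∀ᶠ n in atTop, x n ≤ ENNReal.ofReal ε * A + y n) : Tendsto x atTop (𝓝 0) := by
  rw [ENNReal.tendsto_nhds_zero]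
  intro ε hε
  have h1 : Tendsto (fun e : ℝ => ENNReal.ofReal e * A) (𝓝[>] 0) (𝓝 0) := by
    have : Tendsto (fun e : ℝ => ENNReal.ofReal e * A) (𝓝 0) (𝓝 (ENNReal.ofReal 0 * A)) :=
      ENNReal.Tendsto.mul_const (ENNReal.continuous_ofReal.tendsto 0) (Or.inr hA)
    rw [ENNReal.ofReal_zero, zero_mul] at this
    exact this.mono_left nhdsWithin_le_nhds
  have hε2 : 0 < ε / 2 := ENNReal.half_pos hε.ne'
  obtain ⟨e, he, he0⟩ := ((ENNReal.tendsto_nhds_zero.1 h1 _ hε2).and self_mem_nhdsWithin).exists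
  obtain ⟨y, hy, hxy⟩ := h e he0
  filter_upwards [ENNReal.tendsto_nhds_zero.1 hy _ hε2, hxy] with n h2 h3
  calc x n ≤ ε / 2 + ε / 2 := h3.trans (add_le_add he h2)
    _ = ε := ENNReal.add_halves ε

theorem exists_seq_isExtension {T s b : ℝ} {u : ℕ → Distr T}
    (h : Tendsto (fun n => (u n).xNorm s b) atTop (𝓝 0)) :
    ∃ v : ℕ → ℤ → ℝ → ℂ, (∀ᶠ n in atTop, IsExtension (u n) (v n)) ∧
      Tendsto (fun n => xSq s b (v n)) atTop (𝓝 0) := by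
  have hex : ∀ n, ∃ v, ((u n).xNorm s b < ⊤ → IsExtension (u n) v) ∧
      xSq s b v ≤ ((u n).xNorm s b + (n : ℝ≥0∞)⁻¹) ^ 2 := by
    intro n
    by_cases hn : (u n).xNorm s b < ⊤
    · have : (u n).xNorm s b < (u n).xNorm s b + (n : ℝ≥0∞)⁻¹ :=
        ENNReal.lt_add_right hn.ne (ENNReal.inv_ne_zero.2 (ENNReal.natCast_ne_top n))
      obtain ⟨v, h1, h2⟩ := exists_isExtension_of_xNorm_lt this
      exact ⟨v, fun _ => h1, h2⟩
    -- With infinite norm there may be no extension at all. The default `0` concerns finitely many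
    -- `n` only, since the norms tend to `0`.
    · refine ⟨0, fun h => absurd h hn, ?_⟩
      rw [not_lt_top_iff.1 hn]
      simp
  choose v hv1 hv2 using hex
  refine ⟨v, (h.eventually_lt_const ENNReal.zero_lt_top).mono fun n hn => hv1 n hn, ?_⟩
  have h2 := ENNReal.Tendsto.pow (n := 2) (h.add ENNReal.tendsto_inv_nat_nhds_zero)
  rw [add_zero, zero_pow two_ne_zero] at h2
  exact tendsto_of_tendsto_of_tendsto_of_le_of_le tendsto_const_nhds h2 (fun _ => zero_le) hv2

theorem exists_modes {T b : ℝ} (hb : 0 ≤ b) {u : ℕ → Distr T} {C : ℝ≥0}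
    (h : ∀ n, (u n).xNorm 0 b ≤ C) :
    ∃ (v : ℕ → ℤ → ℝ → ℂ) (hv2 : ∀ n k, MemLp (v n k) 2)
      (g : ℕ → Lp ℂ 2 (volume : Measure (ℝ × Torus))) (M : ℝ),
      (∀ n, IsExtension (u n) (v n)) ∧ (∀ n, xSq 0 b (v n) ≤ ((C : ℝ≥0∞) + 1) ^ 2) ∧
      (∀ n, HasSum (fun k => embed k (invFt (v n k) (hv2 n k))) (g n)) ∧ ∀ n, ‖g n‖ ≤ M := by
  have hlt : ∀ n, (u n).xNorm 0 b < (C : ℝ≥0∞) + 1 := fun n =>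
    (h n).trans_lt (ENNReal.lt_add_right ENNReal.coe_ne_top one_ne_zero)
  choose v hv hvC using fun n => exists_isExtension_of_xNorm_lt (hlt n)
  have hC : ((C : ℝ≥0∞) + 1) ^ 2 < ⊤ := ENNReal.pow_lt_top (by finiteness)
  have hs : ∀ n, ∑' k, ∫⁻ τ, ‖v n k τ‖ₑ ^ 2 ≤ ((C : ℝ≥0∞) + 1) ^ 2 := fun n =>
    (tsum_lintegral_le_xSq hb (v n)).trans (hvC n)
  have hv2 : ∀ n k, MemLp (v n k) 2 := fun n => (hv n).memLp ((hs n).trans_lt hC)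
  have hG : ∀ n, ∑' k, ∫⁻ t, ‖invFt (v n k) (hv2 n k) t‖ₑ ^ 2 ≤ ((C : ℝ≥0∞) + 1) ^ 2 := fun n =>
    (ENNReal.tsum_le_tsum fun k => lintegral_invFt_le (hv2 n k)).trans (hs n)
  have hg := fun n => (summable_embed ((hG n).trans_lt hC)).hasSum
  set K : ℝ≥0∞ := ENNReal.ofReal (2 * Real.pi) * ((C : ℝ≥0∞) + 1) ^ 2 with hK
  have hKt : K ≠ ⊤ := ENNReal.mul_ne_top ENNReal.ofReal_ne_top hC.ne
  -- From `‖g‖² ≤ K` the crude bound `‖g‖ ≤ 1 + K` suffices.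
  refine ⟨v, hv2, _, 1 + K.toReal, hv, hvC, hg, fun n => ?_⟩
  have h1 := lintegral_sq_modes_le (hg n) MeasurableSet.univ
  rw [univ_prod_univ, Measure.restrict_univ, Measure.restrict_univ, ← eLpNorm_two_sq,
    ← Lp.enorm_def] at h1
  have h2 := ENNReal.toReal_mono hKt (h1.trans (mul_le_mul' le_rfl (hG n)))
  rw [ENNReal.toReal_pow, toReal_enorm] at h2
  nlinarith [sq_nonneg (‖∑' k, embed k (invFt (v n k) (hv2 n k))‖ - 1), ENNReal.toReal_nonneg (a := K)]

theorem l2Norm_univ_sq_le {T : ℝ} {u : Distr T} {g : Lp ℂ 2 (volume : Measure (ℝ × Torus))}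
    (h : ∀ ψ : testFun T, u.toFun ψ = ∫ q, g q * (ψ : ℝ × Torus → ℂ) q) :
    u.l2Norm univ ^ 2 ≤ ∫⁻ q in Ioo 0 T ×ˢ univ, ‖g q‖ₑ ^ 2 := by
  rw [← eLpNorm_two_sq]
  gcongr
  refine iInf_le_of_le g (iInf_le_of_le (Lp.aestronglyMeasurable g).restrict
    (iInf_le_of_le (fun ψ _ => ?_) le_rfl))
  rw [h]
  refine (setIntegral_eq_integral_of_forall_compl_eq_zero fun q hq => ?_).symm
  rw [image_eq_zero_of_notMem_tsupport fun hq' => hq (ψ.2.2.2 hq'), mul_zero]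

theorem IsExtension.toFun_eq_integral {T : ℝ} {u : Distr T} {v : ℤ → ℝ → ℂ}
    (h : IsExtension u v) (hv : ∀ k, MemLp (v k) 2)
    {g : Lp ℂ 2 (volume : Measure (ℝ × Torus))}
    (hg : HasSum (fun k => embed k (invFt (v k) (hv k))) g) (ψ : testFun T) :
    u.toFun ψ = ∫ q, g q * (ψ : ℝ × Torus → ℂ) q := by
  rw [h.2]
  exact fourierPairing_eq_integral hv hg (continuous_of_contDiff_lift ψ.2.1) ψ.2.2.1

/-- Reduction of the convergence of `u` on a cutoff region to that of the interactions between
different modes. -/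
theorem tendsto_lintegral_cutoff {T : ℝ} {Ω : Set Torus} (hΩ : IsOpen Ω) (hne : Ω.Nonempty)
    {u : ℕ → Distr T} {v : ℕ → ℤ → ℝ → ℂ} {hv2 : ∀ n k, MemLp (v n k) 2}
    {g : ℕ → Lp ℂ 2 (volume : Measure (ℝ × Torus))} (hv : ∀ n, IsExtension (u n) (v n))
    (hg : ∀ n, HasSum (fun k => embed k (invFt (v n k) (hv2 n k))) (g n))
    {M : ℝ} (hM : ∀ n, ‖g n‖ ≤ M) {χ : ℕ → ℝ → ℝ} (hχ : ∀ n, IsCutoff T fun t => (χ n t : ℂ))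
    (hχ1 : ∀ n t, |χ n t| ≤ 1)
    (huΩ : Tendsto (fun n => (u n).l2Norm Ω) atTop (𝓝 0))
    (hj : ∀ j : ℤ, j ≠ 0 → Tendsto (fun n => ∑' k, ‖∫ t, (χ n t : ℂ) ^ 2 *
      (invFt (v n k) (hv2 n k) t * conj (invFt (v n (k + j)) (hv2 n (k + j)) t))‖ₑ) atTop (𝓝 0)) :
    Tendsto (fun n => ∫⁻ q : ℝ × Torus, ENNReal.ofReal (χ n q.1 ^ 2) * ‖g n q‖ₑ ^ 2)
      atTop (𝓝 0) := by
  refine tendsto_integral_sq_of_modes hΩ hne (fun n => (hv n).toFun_eq_integral (hv2 n) (hg n))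
    (fun n => mem_closure_smoothL2 (hg n)) hM hχ hχ1 huΩ fun j hj0 => ?_
  rw [tendsto_zero_iff_enorm_tendsto_zero]
  have h1 := ENNReal.Tendsto.const_mul (a := ENNReal.ofReal (2 * Real.pi)) (hj j hj0)
    (Or.inr ENNReal.ofReal_ne_top)
  rw [mul_zero] at h1
  exact tendsto_of_tendsto_of_tendsto_of_le_of_le tendsto_const_nhds h1 (fun _ => zero_le)
    fun n => enorm_integral_modes_le (hg n) (hχ n).contDiff_real.continuous.measurable (hχ1 n) j

theorem setLIntegral_sq_le_cutoff {χ : ℝ → ℝ} {g : ℝ × Torus → ℂ} {S : Set ℝ}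
    (hS : MeasurableSet S) (h1 : ∀ t ∈ S, χ t = 1) :
    ∫⁻ q in S ×ˢ univ, ‖g q‖ₑ ^ 2 ≤ ∫⁻ q, ENNReal.ofReal (χ q.1 ^ 2) * ‖g q‖ₑ ^ 2 := by
  refine le_trans (lintegral_mono_ae ((ae_restrict_mem (hS.prod MeasurableSet.univ)).mono
    fun q hq => ?_)) (setLIntegral_le_lintegral _ _)
  rw [h1 q.1 hq.1, one_pow, ENNReal.ofReal_one, one_mul]

/-- A cutoff which equals `1` away from the end points of `]0,T[`. -/
theorem exists_isCutoff {T η : ℝ} (hη : 0 < η) (hT : 2 * η < T) :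
    ∃ χ : ℝ → ℝ, IsCutoff T (fun t => (χ t : ℂ)) ∧ (∀ t, |χ t| ≤ 1) ∧
      ∀ t ∈ Icc η (T - η), χ t = 1 := by
  set φ : ContDiffBump (T / 2) := ⟨T / 2 - η, T / 2 - η / 2, by linarith, by linarith⟩ with hφ
  refine ⟨φ, ⟨Complex.ofRealCLM.contDiff.comp φ.contDiff,
    φ.hasCompactSupport.comp_left (g := Complex.ofReal) Complex.ofReal_zero,
    (tsupport_comp_subset (g := Complex.ofReal) Complex.ofReal_zero φ).trans ?_⟩, fun t => ?_,
    fun t ht => φ.one_of_mem_closedBall ?_⟩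
  · rw [φ.tsupport_eq, Real.closedBall_eq_Icc]
    intro t ht
    constructor <;> [have := ht.1; have := ht.2] <;> simp only [hφ] at this <;> linarith
  · rw [abs_of_nonneg φ.nonneg]; exact φ.le_one
  · rw [Real.closedBall_eq_Icc]
    constructor <;> [have := ht.1; have := ht.2] <;> simp only [hφ] <;> linarith

/-- Time reversal carries a cutoff that is steep near `0` to one that is steep near `T`; this is why
`sign` allows both signs. -/
theorem IsLayerCutoff.reflect {T M : ℝ} {α γ : ℝ → ℝ} (h : IsLayerCutoff T M α γ) :
    IsLayerCutoff T M (fun t => α (T - t)) (fun t => γ (T - t)) := by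
  have hr : ContDiff ℝ ∞ fun t : ℝ => T - t := contDiff_const.sub contDiff_id
  obtain ⟨s, hs1, hs⟩ := h.sign
  refine ⟨h.contDiff_left.comp hr, h.contDiff_right.comp hr, fun t => h.left_mem _,
    fun t => h.right_mem _, ⟨h.isCutoff.1.comp hr,
      h.isCutoff.2.1.comp_homeomorph (Homeomorph.subLeft T), fun t ht => ?_⟩,
    ⟨-s, by rw [abs_neg, hs1], fun t => ?_⟩, fun t ht => ?_⟩
  · have h1 : T - t ∈ tsupport fun t => ((α t * γ t : ℝ) : ℂ) :=
      tsupport_comp_subset_preimage (fun t => ((α t * γ t : ℝ) : ℂ))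
        (f := fun t : ℝ => T - t) hr.continuous ht
    have h2 := h.isCutoff.2.2 h1
    exact ⟨by linarith [h2.2], by linarith [h2.1]⟩
  · rw [deriv_comp_const_sub, neg_mul_neg]
    exact hs _
  · rw [deriv_comp_const_sub, abs_neg]
    exact h.deriv_le _ ⟨by linarith [ht.2], by linarith [ht.1]⟩

/-- The factor `α` rises between `δ` and `2δ`, while `γ` falls between `T/2` and `3T/4`. The latter
is fixed, so `M` does not depend on `δ`. Only the left half of the interval is served; reflection
takes care of the other half. -/
theorem exists_isLayerCutoff {T : ℝ} (hT : 0 < T) :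
    ∃ M : ℝ, 0 ≤ M ∧ ∀ δ : ℝ, 0 < δ → ∃ α γ, IsLayerCutoff T M α γ ∧
      ∀ t ∈ Icc (2 * δ) (T / 2), α t * γ t = 1 := by
  set γ : ℝ → ℝ := fun t => Real.smoothTransition (3 - 4 * t / T) with hγ
  have hγs : ContDiff ℝ ∞ γ := Real.smoothTransition.contDiff.comp (by fun_prop)
  have hγ' : Continuous (deriv γ) := hγs.continuous_deriv (by simp)
  obtain ⟨M, hM⟩ := isCompact_Icc.exists_bound_of_continuousOn (s := Icc 0 T) hγ'.continuousOn
  refine ⟨M, (norm_nonneg _).trans (hM 0 ⟨le_rfl, hT.le⟩), fun δ hδ => ?_⟩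
  set α : ℝ → ℝ := fun t => Real.smoothTransition (t / δ - 1) with hα
  have hαs : ContDiff ℝ ∞ α := Real.smoothTransition.contDiff.comp (by fun_prop)
  have hsub : (tsupport fun t => ((α t * γ t : ℝ) : ℂ)) ⊆ Icc δ (3 * T / 4) := by
    refine closure_minimal (fun t ht => ?_) isClosed_Icc
    by_contra hn
    apply ht
    rw [mem_Icc, not_and_or, not_le, not_le] at hn
    rcases hn with hn | hn
    · have : α t = 0 := Real.smoothTransition.zero_of_nonpos (by
        have := (div_lt_one hδ).2 hn; linarith)
      simp [this]
    · have : γ t = 0 := Real.smoothTransition.zero_of_nonpos (by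
        have : 3 < 4 * t / T := by rw [lt_div_iff₀ hT]; linarith
        linarith)
      simp [this]
  refine ⟨α, γ, ⟨hαs, hγs, fun t => ⟨Real.smoothTransition.nonneg _, Real.smoothTransition.le_one _⟩,
    fun t => ⟨Real.smoothTransition.nonneg _, Real.smoothTransition.le_one _⟩,
    ⟨Complex.ofRealCLM.contDiff.comp (hαs.mul hγs),
      isCompact_Icc.of_isClosed_subset (isClosed_tsupport _) hsub,
      hsub.trans (Icc_subset_Ioo hδ (by linarith))⟩, ⟨1, abs_one, fun t => ?_⟩,
    fun t ht => hM t (Ioo_subset_Icc_self ht)⟩, fun t ht => ?_⟩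
  · rw [one_mul]
    refine (Real.smoothTransition.monotone.comp fun x y hxy => ?_).deriv_nonneg
    have := (div_le_div_iff_of_pos_right hδ).2 hxy
    linarith
  · have h1 : α t = 1 := Real.smoothTransition.one_of_one_le (by
      have : 2 ≤ t / δ := (le_div_iff₀ hδ).2 ht.1
      linarith)
    have h2 : γ t = 1 := Real.smoothTransition.one_of_one_le (by
      have : 4 * t / T ≤ 2 := (div_le_iff₀ hT).2 (by linarith [ht.2])
      linarith)
    rw [h1, h2, one_mul]

end Conclusion

/-! ### The two cases `b > 0` and `b = 0` -/

section Cases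

open ComplexConjugate

/-- For `b = 0` the weight depends on `k` alone, and on a single mode it is a positive constant. -/
theorem memLp_of_xSq_lt_top {T s : ℝ} {u : Distr T} {v : ℤ → ℝ → ℂ} (h : IsExtension u v)
    (hf : xSq s 0 v < ⊤) (k : ℤ) : MemLp (v k) 2 := by
  refine memLp_two_of_lintegral_lt_top (h.1 k) ?_
  rw [xSq_eq] at hf
  have h1 := (ENNReal.le_tsum k).trans_lt hf
  simp only [Real.rpow_zero, ENNReal.ofReal_one, one_mul] at h1
  have h2 : ENNReal.ofReal (kw k ^ (2 * s)) ≠ 0 := by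
    have := one_le_kw k
    rw [Ne, ENNReal.ofReal_eq_zero, not_le]
    positivity
  exact ENNReal.lt_top_of_mul_ne_top_right h1.ne h2

variable {T b : ℝ} {Ω : Set Torus} {u f : ℕ → Distr T} {B : ℝ≥0∞} {v v' w : ℕ → ℤ → ℝ → ℂ}
  {hv2 : ∀ n k, MemLp (v n k) 2} {g : ℕ → Lp ℂ 2 (volume : Measure (ℝ × Torus))} {M : ℝ}

/-- Up to a small error, uniform in `n`, the mass near the end points can be discarded, so a cutoff
independent of `n` suffices for each `ε`. -/
theorem tendsto_lintegral_of_pos (hT : 0 < T) (hb0 : 0 < b) (hb1 : b ≤ 1)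
    (hΩ : IsOpen Ω) (hne : Ω.Nonempty) (hsol : ∀ n, IsSolution (u n) (f n)) (hB : B ≠ ⊤)
    (hv : ∀ n, IsExtension (u n) (v n)) (hvB : ∀ n, xSq 0 b (v n) ≤ B)
    (hg : ∀ n, HasSum (fun k => embed k (invFt (v n k) (hv2 n k))) (g n))
    (hM : ∀ n, ‖g n‖ ≤ M)
    (hv' : ∀ᶠ n in atTop, IsExtension (u n) (v' n))
    (hv'0 : Tendsto (fun n => xSq (-1 + b) (-b) (v' n)) atTop (𝓝 0))
    (hw : ∀ᶠ n in atTop, IsExtension (f n) (w n))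
    (hw0 : Tendsto (fun n => xSq (-1 + b) (-b) (w n)) atTop (𝓝 0))
    (huΩ : Tendsto (fun n => (u n).l2Norm Ω) atTop (𝓝 0)) :
    Tendsto (fun n => ∫⁻ q in Ioo 0 T ×ˢ univ, ‖g n q‖ₑ ^ 2) atTop (𝓝 0) := by
  refine tendsto_zero_of_forall_le (A := ENNReal.ofReal (2 * Real.pi) * B)
    (ENNReal.mul_ne_top ENNReal.ofReal_ne_top hB) fun ε hε => ?_
  obtain ⟨δ, hδ, hlay⟩ := exists_lintegral_invFt_le hb0 hε
  -- Two end layers of length `η` have total measure at most `δ`, and `T / 4` keeps them from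
  -- covering the interval.
  set η := min (δ / 2) (T / 4) with hη
  have hη0 : 0 < η := by positivity
  have hηδ : 2 * η ≤ δ := by linarith [min_le_left (δ / 2) (T / 4)]
  have hηT : 2 * η < T := by linarith [min_le_right (δ / 2) (T / 4)]
  obtain ⟨χ, hχ, hχ1, hχη⟩ := exists_isCutoff hη0 hηT
  refine ⟨_, tendsto_lintegral_cutoff hΩ hne hv hg hM (χ := fun _ => χ) (fun _ => hχ)
    (fun _ => hχ1) huΩ fun j hj => ?_, Eventually.of_forall fun n => ?_⟩
  · obtain ⟨A, hA, hAD⟩ := exists_tsum_lintegral_conv_le hb0.le hb1 hj hχ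
    refine tendsto_zero_of_forall_le (ENNReal.mul_ne_top hA hB) fun e he => ?_
    obtain ⟨D, hD, hDe⟩ := hAD e he
    refine ⟨fun n => D * (xSq (-1 + b) (-b) (v' n) + xSq (-1 + b) (-b) (w n)), ?_, ?_⟩
    · have := ENNReal.Tendsto.const_mul (a := D) (hv'0.add hw0) (Or.inr hD)
      rwa [add_zero, mul_zero] at this
    · filter_upwards [hv', hw] with n h1 h2
      refine (ENNReal.tsum_le_tsum fun k =>
        enorm_integral_sq_mul_le_conv (hv2 n) hχ k (k + j)).trans ?_
      refine (hDe (hsol n) (hv n) h1 h2 ((hvB n).trans_lt hB.lt_top)).trans ?_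
      gcongr
      exact hvB n
  · set S := Ioo 0 η ∪ Ioo (T - η) T with hS
    have hSm : MeasurableSet S := measurableSet_Ioo.union measurableSet_Ioo
    have hSv : volume S ≤ ENNReal.ofReal δ := by
      refine (measure_union_le _ _).trans ?_
      rw [Real.volume_Ioo, Real.volume_Ioo, ← ENNReal.ofReal_add (by linarith) (by linarith)]
      exact ENNReal.ofReal_le_ofReal (by linarith)
    have hsub : Ioo 0 T ×ˢ (univ : Set Torus) ⊆ S ×ˢ univ ∪ Icc η (T - η) ×ˢ univ := by
      rintro q ⟨⟨h1, h2⟩, -⟩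
      by_cases h3 : q.1 < η
      · exact Or.inl ⟨Or.inl ⟨h1, h3⟩, trivial⟩
      · by_cases h4 : T - η < q.1
        · exact Or.inl ⟨Or.inr ⟨h4, h2⟩, trivial⟩
        · exact Or.inr ⟨⟨not_lt.1 h3, not_lt.1 h4⟩, trivial⟩
    refine (lintegral_mono_set hsub).trans ((lintegral_union_le _ _ _).trans (add_le_add ?_
      (setLIntegral_sq_le_cutoff measurableSet_Icc hχη)))
    refine (lintegral_sq_modes_le (hg n) hSm).trans ?_
    rw [mul_left_comm]
    refine mul_le_mul' le_rfl (le_trans ?_ (mul_le_mul' le_rfl (hvB n)))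
    rw [xSq_eq, ← ENNReal.tsum_mul_left]
    refine ENNReal.tsum_le_tsum fun k => ?_
    rw [mul_zero, Real.rpow_zero, ENNReal.ofReal_one, one_mul]
    exact hlay k (v n k) (hv2 n k) S hSv

/-- Absolute continuity of the integral for one function; the width of the layers depends on `g`. -/
theorem exists_pos_layer_le {T : ℝ} {g : ℝ × Torus → ℂ} (hg : ∫⁻ q, ‖g q‖ₑ ^ 2 ≠ ⊤) {ε : ℝ≥0∞}
    (hε : ε ≠ 0) :
    ∃ δ : ℝ, 0 < δ ∧ ∫⁻ q in (Ioo 0 (2 * δ) ∪ Ioo (T - 2 * δ) T) ×ˢ univ, ‖g q‖ₑ ^ 2 ≤ ε := by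
  obtain ⟨d, hd0, hd⟩ := exists_pos_setLIntegral_lt_of_measure_lt hg hε
  have h1 : Tendsto (fun δ : ℝ => ENNReal.ofReal (4 * δ) * volume (univ : Set Torus)) (𝓝[>] 0)
      (𝓝 0) := by
    have : Tendsto (fun δ : ℝ => ENNReal.ofReal (4 * δ) * volume (univ : Set Torus)) (𝓝 0)
        (𝓝 (ENNReal.ofReal (4 * 0) * volume (univ : Set Torus))) :=
      ENNReal.Tendsto.mul_const ((ENNReal.continuous_ofReal.comp
        (continuous_const.mul continuous_id)).tendsto 0) (Or.inr (measure_ne_top _ _))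
    rw [mul_zero, ENNReal.ofReal_zero, zero_mul] at this
    exact this.mono_left nhdsWithin_le_nhds
  obtain ⟨δ, hδ, hδ0⟩ := ((h1.eventually_lt_const hd0).and self_mem_nhdsWithin).exists
  have hδ0 : 0 < δ := hδ0
  refine ⟨δ, hδ0, (hd _ (lt_of_le_of_lt ?_ hδ)).le⟩
  rw [Measure.volume_eq_prod, Measure.prod_prod]
  gcongr
  refine (measure_union_le _ _).trans ?_
  rw [Real.volume_Ioo, Real.volume_Ioo, ← ENNReal.ofReal_add (by linarith) (by linarith)]
  exact ENNReal.ofReal_le_ofReal (by linarith)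

/-- The end layers are chosen for each `n` so that `g n` has mass at most `1/n` there. The cutoffs
may become arbitrarily steep, which the uniform bound `IsLayerCutoff.tsum_modes_le` tolerates. -/
theorem tendsto_lintegral_of_zero (hT : 0 < T)
    (hΩ : IsOpen Ω) (hne : Ω.Nonempty) (hsol : ∀ n, IsSolution (u n) (f n)) (hB : B ≠ ⊤)
    (hv : ∀ n, IsExtension (u n) (v n)) (hvB : ∀ n, xSq 0 0 (v n) ≤ B)
    (hg : ∀ n, HasSum (fun k => embed k (invFt (v n k) (hv2 n k))) (g n))
    (hM : ∀ n, ‖g n‖ ≤ M)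
    (hv' : ∀ᶠ n in atTop, IsExtension (u n) (v' n))
    (hv'0 : Tendsto (fun n => xSq (-1) 0 (v' n)) atTop (𝓝 0))
    (hw : ∀ᶠ n in atTop, IsExtension (f n) (w n))
    (hw0 : Tendsto (fun n => xSq (-1) 0 (w n)) atTop (𝓝 0))
    (huΩ : Tendsto (fun n => (u n).l2Norm Ω) atTop (𝓝 0)) :
    Tendsto (fun n => ∫⁻ q in Ioo 0 T ×ˢ univ, ‖g n q‖ₑ ^ 2) atTop (𝓝 0) := by
  obtain ⟨L, hL, hlay⟩ := exists_isLayerCutoff hT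
  have hgt : ∀ n, ∫⁻ q, ‖g n q‖ₑ ^ 2 ≠ ⊤ := fun n => (lintegral_enorm_sq_lt_top (Lp.memLp _)).ne
  choose δ hδ hδn using fun n : ℕ => exists_pos_layer_le (T := T) (hgt n)
    (ENNReal.inv_ne_zero.2 (ENNReal.natCast_ne_top n))
  choose α γ hαγ h1 using fun n => hlay (δ n) (hδ n)
  -- Stated for any sequence of layer cutoffs with the common bound `L`, since it serves both the
  -- left half of `]0,T[` and, for the reflected cutoffs, the right half.
  have key : ∀ {α γ : ℕ → ℝ → ℝ}, (∀ n, IsLayerCutoff T L (α n) (γ n)) →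
      Tendsto (fun n => ∫⁻ q, ENNReal.ofReal ((α n q.1 * γ n q.1) ^ 2) * ‖g n q‖ₑ ^ 2)
        atTop (𝓝 0) := by
    intro α γ h
    refine tendsto_lintegral_cutoff hΩ hne hv hg hM (χ := fun n t => α n t * γ n t)
      (fun n => (h n).isCutoff)
      (fun n t => (abs_of_nonneg ((h n).nonneg t)).trans_le ((h n).le_one t)) huΩ fun j hj => ?_
    set c := ENNReal.ofReal ((1 + |(j : ℝ)|) * (2 + 2 * L)) with hc
    refine tendsto_zero_of_forall_le (A := c * (2 * B))
      (by finiteness) fun ε hε => ?_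
    refine ⟨fun n => c * (ENNReal.ofReal ε⁻¹ * (2 * (xSq (-1) 0 (w n) + xSq (-1) 0 (v' n)))),
      ?_, ?_⟩
    · have h0 := hw0.add hv'0
      have h2 := ENNReal.Tendsto.const_mul (a := 2) h0 (Or.inr ENNReal.ofNat_ne_top)
      have h3 := ENNReal.Tendsto.const_mul (a := ENNReal.ofReal ε⁻¹) h2
        (Or.inr ENNReal.ofReal_ne_top)
      have h4 := ENNReal.Tendsto.const_mul (a := c) h3 (Or.inr ENNReal.ofReal_ne_top)
      simpa only [add_zero, mul_zero] using h4
    · filter_upwards [hv', hw, hv'0.eventually_lt_const ENNReal.zero_lt_top,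
        hw0.eventually_lt_const ENNReal.zero_lt_top] with n e1 e2 e3 e4
      refine ((h n).tsum_modes_le hL hj hε (hsol n) (hv n) e1 e2 (hv2 n)
        (memLp_of_xSq_lt_top e1 e3) (memLp_of_xSq_lt_top e2 e4)).trans ?_
      rw [mul_add, ← mul_assoc (ENNReal.ofReal ε) c, mul_comm (ENNReal.ofReal ε) c, mul_assoc]
      gcongr
      exact hvB n
  have hlim := (ENNReal.tendsto_inv_nat_nhds_zero.add
    (key hαγ)).add (key fun n => (hαγ n).reflect)
  rw [add_zero, add_zero] at hlim
  refine tendsto_of_tendsto_of_tendsto_of_le_of_le tendsto_const_nhds hlim (fun _ => zero_le)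
    fun n => ?_
  have hsub : Ioo 0 T ×ˢ (univ : Set Torus) ⊆
      ((Ioo 0 (2 * δ n) ∪ Ioo (T - 2 * δ n) T) ×ˢ univ ∪ Icc (2 * δ n) (T / 2) ×ˢ univ) ∪
        Icc (T / 2) (T - 2 * δ n) ×ˢ univ := by
    rintro q ⟨⟨h1, h2⟩, -⟩
    by_cases h3 : q.1 < 2 * δ n
    · exact Or.inl (Or.inl ⟨Or.inl ⟨h1, h3⟩, trivial⟩)
    · by_cases h4 : T - 2 * δ n < q.1
      · exact Or.inl (Or.inl ⟨Or.inr ⟨h4, h2⟩, trivial⟩)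
      · rcases le_total q.1 (T / 2) with h5 | h5
        · exact Or.inl (Or.inr ⟨⟨not_lt.1 h3, h5⟩, trivial⟩)
        · exact Or.inr ⟨⟨h5, not_lt.1 h4⟩, trivial⟩
  refine (lintegral_mono_set hsub).trans ((lintegral_union_le _ _ _).trans (add_le_add
    ((lintegral_union_le _ _ _).trans (add_le_add (hδn n) ?_)) ?_))
  · exact setLIntegral_sq_le_cutoff measurableSet_Icc (h1 n)
  · exact setLIntegral_sq_le_cutoff measurableSet_Icc fun t ht =>
      h1 n (T - t) ⟨by linarith [ht.2], by linarith [ht.1]⟩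

end Cases

end SchrodingerTorus

/-! ### The theorem -/

open SchrodingerTorus in
theorem mainTheorem6 (T : ℝ) (hT : 0 < T) (b : ℝ) (hb0 : 0 ≤ b) (hb1 : b ≤ 1)
    (Ω : Set Torus) (hΩ : IsOpen Ω) (hΩne : Ω.Nonempty)
    (u f : ℕ → Distr T) (hsol : ∀ n, IsSolution (u n) (f n))
    (C : ℝ≥0) (hbound : ∀ n, (u n).xNorm 0 b ≤ C)
    (hu : Tendsto (fun n => (u n).xNorm (-1 + b) (-b)) atTop (𝓝 0))
    (hf : Tendsto (fun n => (f n).xNorm (-1 + b) (-b)) atTop (𝓝 0))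
    (huΩ : Tendsto (fun n => (u n).l2Norm Ω) atTop (𝓝 0)) :
    Tendsto (fun n => (u n).l2Norm univ) atTop (𝓝 0) := by
  obtain ⟨v, hv2, g, M, hv, hvC, hg, hM⟩ := exists_modes hb0 hbound
  obtain ⟨v', hv', hv'0⟩ := exists_seq_isExtension hu
  obtain ⟨w, hw, hw0⟩ := exists_seq_isExtension hf
  have hC : ((C : ℝ≥0∞) + 1) ^ 2 ≠ ⊤ := by finiteness
  have key : Tendsto (fun n => ∫⁻ q in Ioo 0 T ×ˢ univ, ‖g n q‖ₑ ^ 2) atTop (𝓝 0) := by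
    -- At `b = 0` the norm is a pure `L²` norm in time and permits concentration at the end points,
    -- hence the separate argument.
    rcases hb0.eq_or_lt with rfl | hb
    · rw [neg_zero, add_zero] at hv'0 hw0
      exact tendsto_lintegral_of_zero hT hΩ hΩne hsol hC hv hvC hg hM hv' hv'0 hw hw0 huΩ
    · exact tendsto_lintegral_of_pos hT hb hb1 hΩ hΩne hsol hC hv hvC hg hM hv' hv'0 hw hw0 huΩ
  have hsq : Tendsto (fun n => (u n).l2Norm univ ^ 2) atTop (𝓝 0) :=
    tendsto_of_tendsto_of_tendsto_of_le_of_le tendsto_const_nhds key (fun _ => zero_le)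
      fun n => l2Norm_univ_sq_le ((hv n).toFun_eq_integral (hv2 n) (hg n))
  have hroot := (ENNReal.continuous_rpow_const (y := 1 / 2)).tendsto (0 : ℝ≥0∞) |>.comp hsq
  rw [ENNReal.zero_rpow_of_pos (by norm_num)] at hroot
  refine hroot.congr fun n => ?_
  rw [Function.comp_apply, ← ENNReal.rpow_natCast, ← ENNReal.rpow_mul]
  norm_num
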